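/- Let $0<a<\infty$, $I=(-a,a)$, and let $q\in C^\infty(I)$ be complex-valued. Let $\mathcal D'(I)$ be the space of complex distributions on $I$ (continuous linear functionals on $C_c^\infty(I)$), with the topology of pointwise convergence. Let $H$ be the continuous solution of $$H(u,v)=\tfrac12\int_0^u q(s)\,ds+\int_0^u\!\int_0^v q(\alpha+\beta)H(\alpha,\beta)\,d\beta\,d\alpha ,\qquad |u+v|<a,\ |u-v|<a,$$ put $K(x,t)=H\big(\tfrac{x+t}2,\tfrac{x-t}2\big)$ for $x,t\in I$, and let $\mathbf T$ be the extension to $\mathcal D'(I)$ of the operator $u\mapsto u(x)+\int_{-x}^{x}K(x,t)u(t)\,dt$, that is, $\langle \mathbf Tu,\phi\rangle=\langle u,\mathbf T^{\square}\phi\rangle$ for $u\in\mathcal D'(I)$, $\phi\in C_c^\infty(I)$, where $$\mathbf T^{\square}\phi(x)=\phi(x)-\int_{-a}^{-|x|}K(t,x)\phi(t)\,dt+\int_{|x|}^{a}K(t,x)\phi(t)\,dt .$$ These formulas define exactly one continuous linear operator $\mathbf T:\mathcal D'(I)\to\mathcal D'(I)$. Let $P_\pm u(x)=\tfrac12(u(x)\pm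 u(-x))$ and $Au(x)=\int_0^x u(t)\,dt$; the operators $P_\pm$, $\frac d{dx}$ and $AP_+$ are taken in their continuous extensions to $\mathcal D'(I)$, defined through the transposes $P_\pm$, $-\frac d{dx}$ and $\phi\mapsto\int_x^a P_-\phi(t)\,dt$ on $C_c^\infty(I)$. A continuous linear operator $\mathcal T:\mathcal D'(I)\to\mathcal D'(I)$ is called an s-transmutation on $\mathcal D'(I)$ if $\big(\frac{d^2}{dx^2}-q\big)\mathcal Tu=\mathcal T\frac{d^2}{dx^2}u$ for all $u\in\mathcal D'(I)$, and the distributions $\varphi_k=\mathcal T[x^k]$, $k=0,1,2,\dots$, are functions in $C^\infty(I)$ that form a standard $L$-base for $L=\frac{d^2}{dx^2}-q$: $L\varphi_0=L\varphi_1=0$, $L\varphi_k=k(k-1)\varphi_{k-2}$ for $k\ge2$, and $\varphi_k(0)=\varphi_k'(0)=0$ for all $k\ge2$. Then a continuous linear operator $\mathcal T:\mathcal D'(I)\to\mathcal D'(I)$ is an s-transmutation on $\mathcal D'(I)$ if and only if there are $c_1,c_2,c_3,c_4\in\mathbb C$ with $$\mathcal T=c_1\mathbf TP_++c_2\mathbf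 TP_-+c_3\mathbf TAP_++c_4\mathbf T\tfrac{d}{dx}P_- .$$ -/

import Mathlib

open scoped Distributions ContDiff

namespace STransmutation

noncomputable section

/-! ### Test functions and distributions on the interval `I = (-a, a)` -/

/-- The open interval `I = (-a, a)`. -/
def symmI (a : ℝ) : TopologicalSpace.Opens ℝ := ⟨Set.Ioo (-a) a, isOpen_Ioo⟩

/-- The space `C_c^∞(I)` of complex-valued test functions on `I = (-a, a)`,
with its usual inductive limit topology. -/
abbrev TestFun (a : ℝ) : Type := 𝓓(symmI a, ℂ)

/-- The space `𝓓'(I)` of complex distributions on `I = (-a, a)`, that is, of continuous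
`ℂ`-linear functionals on `C_c^∞(I)`, with the topology of pointwise convergence. -/
abbrev Distr (a : ℝ) : Type := TestFun a →Lₚₜ[ℂ] ℂ

/-- The transpose `u ↦ u ∘ S` of a continuous linear operator `S` on test functions. -/
def transposeOp {a : ℝ} (S : TestFun a →L[ℂ] TestFun a) : Distr a →L[ℂ] Distr a :=
  PointwiseConvergenceCLM.precomp ℂ S

/-- The regular distribution `φ ↦ ∫ f φ` of a function `f` which is locally integrable on `I`. -/
def regular (a : ℝ) (f : ℝ → ℂ) : Distr a :=
  (TestFunction.integralAgainstBilinCLM (ContinuousLinearMap.mul ℂ ℂ)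
    MeasureTheory.volume f : TestFun a →L[ℂ] ℂ)

/-! ### A constructor for continuous linear operators on test functions -/

lemma exists_bound_of_compact {a : ℝ} (K : TopologicalSpace.Compacts ℝ)
    (hK : (K : Set ℝ) ⊆ symmI a) : ∃ b < a, ∀ x ∈ K, |x| ≤ b := by
  by_cases hne : (K : Set ℝ).Nonempty
  · obtain ⟨x, hx, hmax⟩ := K.isCompact.exists_isMaxOn hne continuous_abs.continuousOn
    refine ⟨|x|, ?_, fun y hy => hmax hy⟩
    have : x ∈ Set.Ioo (-a) a := hK hx
    exact abs_lt.2 this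
  · refine ⟨a - 1, by linarith, fun x hx => (hne ⟨x, hx⟩).elim⟩

lemma exists_bound_of_test {a : ℝ} (φ : TestFun a) : ∃ b < a, ∀ x, b < |x| → φ x = 0 := by
  obtain ⟨b, hb, h⟩ := exists_bound_of_compact (a := a)
    ⟨tsupport φ, φ.hasCompactSupport⟩ φ.tsupport_subset
  refine ⟨b, hb, fun x hx => ?_⟩
  by_contra hne
  exact absurd (h x (subset_tsupport _ hne)) (not_le.2 hx)

/-- A linear operator on test functions is continuous if it keeps supports inside every
`[-b, b]` with `b < a` and is bounded there in each derivative. -/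
def testOp (a : ℝ) (A : TestFun a → ℝ → ℂ)
    (hadd : ∀ φ ψ x, A (φ + ψ) x = A φ x + A ψ x)
    (hsmul : ∀ (c : ℂ) φ x, A (c • φ) x = c * A φ x)
    (hsmooth : ∀ φ, ContDiff ℝ ∞ (A φ))
    (hsupp : ∀ b < a, ∀ φ : TestFun a, (∀ x, b < |x| → φ x = 0) →
      ∀ x, b < |x| → A φ x = 0)
    (hbound : ∀ b < a, ∀ i : ℕ, ∃ C : ℝ, 0 ≤ C ∧ ∀ φ : TestFun a, (∀ x, b < |x| → φ x = 0) →
      ∀ M : ℝ, (∀ j ≤ i, ∀ x, ‖iteratedFDeriv ℝ j φ x‖ ≤ M) →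
      ∀ x, |x| ≤ b → ‖iteratedFDeriv ℝ i (A φ) x‖ ≤ C * M) :
    TestFun a →L[ℂ] TestFun a :=
  have hts : ∀ b < a, ∀ φ : TestFun a, (∀ x, b < |x| → φ x = 0) →
      tsupport (A φ) ⊆ Set.Icc (-b) b := fun b hb φ hφ =>
    closure_minimal (fun x hx => by
      by_contra hn
      exact hx (hsupp b hb φ hφ x (not_le.1 fun h => hn (abs_le.1 h)))) isClosed_Icc
  TestFunction.mkCLM ℂ
    (fun φ => ⟨A φ, hsmooth φ, by
        obtain ⟨b, hb, h⟩ := exists_bound_of_test φ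
        exact isCompact_Icc.of_isClosed_subset (isClosed_tsupport _) (hts b hb φ h), by
        obtain ⟨b, hb, h⟩ := exists_bound_of_test φ
        exact (hts b hb φ h).trans fun x hx =>
          ⟨by linarith [hx.1], lt_of_le_of_lt hx.2 hb⟩⟩)
    (fun φ ψ => by ext x; exact hadd φ ψ x)
    (fun c φ => by ext x; exact hsmul c φ x)
    (by
      intro K hK
      obtain ⟨b, hb, hKb⟩ := exists_bound_of_compact K hK
      have hz : ∀ f : 𝓓_{K}(ℝ, ℂ), ∀ x, b < |x| → TestFunction.ofSupportedIn hK f x = 0 :=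
        fun f x hx => f.zero_on_compl (fun hm => absurd (hKb x hm) (not_le.2 hx))
      let K' : TopologicalSpace.Compacts ℝ := ⟨Set.Icc (-b) b, isCompact_Icc⟩
      have hK' : (K' : Set ℝ) ⊆ symmI a := fun x hx =>
        ⟨by linarith [hx.1], lt_of_le_of_lt hx.2 hb⟩
      let B : 𝓓_{K}(ℝ, ℂ) →L[ℂ] 𝓓_{K'}(ℝ, ℂ) := ContDiffMapSupportedIn.mkCLM ℂ
        (fun f => A (TestFunction.ofSupportedIn hK f))
        (fun f g x => hadd (TestFunction.ofSupportedIn hK f) (TestFunction.ofSupportedIn hK g) x)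
        (fun c f x => hsmul c (TestFunction.ofSupportedIn hK f) x)
        (fun f => hsmooth _)
        (fun f x hx => hsupp b hb _ (hz f) x (not_le.1 fun h => hx (abs_le.1 h)))
        (by
          intro i _
          obtain ⟨C, hC, h⟩ := hbound b hb i
          refine ⟨Finset.range (i + 1), C, hC, fun f x hx => ?_⟩
          refine h _ (hz f) _ (fun j hj y => ?_) x (abs_le.2 hx)
          refine (ContDiffMapSupportedIn.norm_iteratedFDeriv_apply_le_seminorm_top
            (i := j) ℂ (f := f) (x := y)).trans ?_
          exact Seminorm.le_def.1 (Finset.le_sup (f := fun j => N[ℂ]_{K, j})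
            (Finset.mem_range.2 (Nat.lt_succ_of_le hj))) f)
      exact (TestFunction.continuous_ofSupportedIn hK').comp B.continuous)

/-! ### Differentiation, multiplication by a smooth function, reflection -/

/-- The distributional derivative, `⟨u', φ⟩ = -⟨u, φ'⟩`. -/
def ddx (a : ℝ) : Distr a →L[ℂ] Distr a :=
  -transposeOp (TestFunction.lineDerivCLM ℂ (1 : ℝ))

/-- Multiplication `φ ↦ q φ` of test functions by a function `q ∈ C^∞(I)`. -/
def testMul (a : ℝ) (q : ℝ → ℂ) (hq : ContDiffOn ℝ ∞ q (Set.Ioo (-a) a)) :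
    TestFun a →L[ℂ] TestFun a :=
  testOp a (fun φ x => q x * φ x)
    (fun φ ψ x => by simp [mul_add])
    (fun c φ x => by simp [mul_left_comm])
    (fun φ => by
      rw [contDiff_iff_contDiffAt]
      intro x
      by_cases hx : x ∈ tsupport φ
      · exact ((hq x (φ.tsupport_subset hx)).contDiffAt
          (isOpen_Ioo.mem_nhds (φ.tsupport_subset hx))).mul φ.contDiff.contDiffAt
      · have h0 : (fun y => q y * φ y) =ᶠ[nhds x] fun _ => (0 : ℂ) := by
          filter_upwards [notMem_tsupport_iff_eventuallyEq.1 hx] with y hy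
          simp [hy]
        exact contDiffAt_const.congr_of_eventuallyEq h0)
    (fun b _ φ h x hx => by simp [h x hx])
    (by
      intro b hb i
      have hsub : Set.Icc (-b) b ⊆ Set.Ioo (-a) a := fun x hx =>
        ⟨by linarith [hx.1], lt_of_le_of_lt hx.2 hb⟩
      have hB : ∀ j : ℕ, ∃ B : ℝ, ∀ x ∈ Set.Icc (-b) b,
          ‖iteratedFDerivWithin ℝ j q (Set.Ioo (-a) a) x‖ ≤ B := fun j =>
        isCompact_Icc.exists_bound_of_continuousOn
          ((hq.continuousOn_iteratedFDerivWithin (m := j) (by exact_mod_cast le_top)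
            isOpen_Ioo.uniqueDiffOn).mono hsub)
      choose B hB using hB
      refine ⟨∑ j ∈ Finset.range (i + 1), (i.choose j : ℝ) * |B j|, by positivity, ?_⟩
      intro φ _ M hM x hx
      have hxI : x ∈ Set.Ioo (-a) a := hsub (abs_le.1 hx)
      rw [← iteratedFDerivWithin_of_isOpen i isOpen_Ioo hxI]
      refine (norm_iteratedFDerivWithin_mul_le (N := ∞) hq φ.contDiff.contDiffOn
        isOpen_Ioo.uniqueDiffOn hxI (by exact_mod_cast le_top)).trans ?_
      rw [Finset.sum_mul]
      refine Finset.sum_le_sum fun j hj => ?_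
      have h1 : ‖iteratedFDerivWithin ℝ j q (Set.Ioo (-a) a) x‖ ≤ |B j| :=
        (hB j x (abs_le.1 hx)).trans (le_abs_self _)
      have h2 : ‖iteratedFDerivWithin ℝ (i - j) φ (Set.Ioo (-a) a) x‖ ≤ M := by
        rw [iteratedFDerivWithin_of_isOpen (i - j) isOpen_Ioo hxI]
        exact hM _ (Nat.sub_le _ _) x
      gcongr)

/-- Multiplication of distributions by `q ∈ C^∞(I)`, `⟨q u, φ⟩ = ⟨u, q φ⟩`. -/
def mulOp (a : ℝ) (q : ℝ → ℂ) (hq : ContDiffOn ℝ ∞ q (Set.Ioo (-a) a)) :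
    Distr a →L[ℂ] Distr a :=
  transposeOp (testMul a q hq)

/-- The reflection `φ ↦ φ(-·)` of test functions. -/
def testReflect (a : ℝ) : TestFun a →L[ℂ] TestFun a :=
  testOp a (fun φ x => φ (-x))
    (fun φ ψ x => by simp) (fun c φ x => by simp)
    (fun φ => φ.contDiff.comp contDiff_neg)
    (fun b _ φ h x hx => h (-x) (by rwa [abs_neg]))
    (by
      intro b _ i
      refine ⟨1, zero_le_one, fun φ _ M hM x _ => ?_⟩
      rw [one_mul]
      have := (LinearIsometryEquiv.neg ℝ (E := ℝ)).norm_iteratedFDeriv_comp_right (𝕜 := ℝ)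
        (φ : ℝ → ℂ) x i
      exact this.trans_le (hM i le_rfl _))

/-- `P₊ u(x) = (u(x) + u(-x)) / 2` on distributions. -/
def Pplus (a : ℝ) : Distr a →L[ℂ] Distr a :=
  (2⁻¹ : ℂ) • (ContinuousLinearMap.id ℂ (Distr a) + transposeOp (testReflect a))

/-- `P₋ u(x) = (u(x) - u(-x)) / 2` on distributions. -/
def Pminus (a : ℝ) : Distr a →L[ℂ] Distr a :=
  (2⁻¹ : ℂ) • (ContinuousLinearMap.id ℂ (Distr a) - transposeOp (testReflect a))

/-! ### The operator `A P₊`, where `A u(x) = ∫₀ˣ u` -/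

lemma norm_iteratedFDeriv_oddPart_le {a : ℝ} (φ : TestFun a) (i : ℕ) (M : ℝ)
    (hM : ∀ x, ‖iteratedFDeriv ℝ i φ x‖ ≤ M) (x : ℝ) :
    ‖iteratedFDeriv ℝ i (fun t => (φ t - φ (-t)) / 2) x‖ ≤ M := by
  have hφ : ContDiff ℝ i φ := φ.contDiff.of_le (by exact_mod_cast le_top)
  have hr : ContDiff ℝ i (fun t => φ (-t)) := hφ.comp contDiff_neg
  have h1 : (fun t => (φ t - φ (-t)) / 2) =
      (2⁻¹ : ℝ) • ((φ : ℝ → ℂ) - fun t => φ (-t)) := by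
    ext t
    simp only [Pi.smul_apply, Pi.sub_apply, Complex.real_smul]
    push_cast
    ring
  have h3 : ‖iteratedFDeriv ℝ i (fun t => φ (-t)) x‖ ≤ M :=
    ((LinearIsometryEquiv.neg ℝ (E := ℝ)).norm_iteratedFDeriv_comp_right (𝕜 := ℝ)
      (φ : ℝ → ℂ) x i).trans_le (hM _)
  have h2 : iteratedFDeriv ℝ i ((2⁻¹ : ℝ) • ((φ : ℝ → ℂ) - fun t => φ (-t))) x =
      (2⁻¹ : ℝ) • iteratedFDeriv ℝ i ((φ : ℝ → ℂ) - fun t => φ (-t)) x :=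
    iteratedFDeriv_const_smul_apply (hφ.sub hr).contDiffAt
  rw [h1, h2, norm_smul, iteratedFDeriv_sub_apply hφ.contDiffAt hr.contDiffAt]
  have h4 := norm_sub_le (iteratedFDeriv ℝ i φ x) (iteratedFDeriv ℝ i (fun t => φ (-t)) x)
  have h5 := hM x
  rw [Real.norm_of_nonneg (by norm_num)]
  linarith

lemma continuous_oddPart {a : ℝ} (φ : TestFun a) :
    Continuous (fun t => (φ t - φ (-t)) / 2) := by
  have := φ.continuous
  fun_prop

lemma hasDerivAt_tailIntegral {a : ℝ} (φ : TestFun a) (x : ℝ) :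
    HasDerivAt (fun x => ∫ t in x..a, (φ t - φ (-t)) / 2) (-((φ x - φ (-x)) / 2)) x :=
  intervalIntegral.integral_hasDerivAt_left
    ((continuous_oddPart φ).intervalIntegrable _ _)
    (continuous_oddPart φ).stronglyMeasurable.stronglyMeasurableAtFilter
    (continuous_oddPart φ).continuousAt

lemma tailIntegral_eq_zero {a b : ℝ} (hb : b < a) (φ : TestFun a)
    (h : ∀ x, b < |x| → φ x = 0) (x : ℝ) (hx : b < |x|) :
    ∫ t in x..a, (φ t - φ (-t)) / 2 = 0 := by
  -- the integral over `[|x|, a]` vanishes, and so does the integral of an odd function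
  have key : ∀ y, b < y → ∫ t in y..a, (φ t - φ (-t)) / 2 = 0 := by
    intro y hy
    have hz : Set.EqOn (fun t => (φ t - φ (-t)) / 2) (fun _ => (0 : ℂ)) (Set.uIcc y a) := by
      intro t ht
      have hbt : b < t := lt_of_lt_of_le (lt_min hy hb) ht.1
      have h1 : b < |t| := lt_of_lt_of_le hbt (le_abs_self t)
      simp [h t h1, h (-t) (by rwa [abs_neg])]
    rw [intervalIntegral.integral_congr hz]
    simp
  rcases le_total 0 x with hx0 | hx0
  · exact key x (by rwa [abs_of_nonneg hx0] at hx)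
  · have hodd : ∫ t in x..(-x), (φ t - φ (-t)) / 2 = 0 := by
      have h1 := intervalIntegral.integral_comp_neg (a := x) (b := -x)
        (fun t => (φ t - φ (-t)) / 2)
      rw [neg_neg] at h1
      have h2 : ∫ t in x..(-x), (φ (-t) - φ (- -t)) / 2 =
          -∫ t in x..(-x), (φ t - φ (-t)) / 2 := by
        rw [← intervalIntegral.integral_neg]
        refine intervalIntegral.integral_congr fun t _ => ?_
        simp only [neg_neg]
        ring
      have h3 := h2.symm.trans h1
      exact self_eq_neg.1 h3.symm
    rw [← intervalIntegral.integral_add_adjacent_intervals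
      ((continuous_oddPart φ).intervalIntegrable x (-x))
      ((continuous_oddPart φ).intervalIntegrable (-x) a), hodd,
      key (-x) (by rwa [abs_of_nonpos hx0] at hx), add_zero]

/-- The transpose of `A P₊`, `φ ↦ ∫ₓᵃ P₋ φ`. Since `P₋ φ` is odd, for `x ≤ 0` this is the same
as `-∫₋ₐˣ P₋ φ`, so that this function is the transpose of `A` applied to `P₋ φ`. -/
def testAPplus (a : ℝ) : TestFun a →L[ℂ] TestFun a :=
  testOp a (fun φ x => ∫ t in x..a, (φ t - φ (-t)) / 2)
    (fun φ ψ x => by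
      rw [← intervalIntegral.integral_add ((continuous_oddPart φ).intervalIntegrable _ _)
        ((continuous_oddPart ψ).intervalIntegrable _ _)]
      refine intervalIntegral.integral_congr fun t _ => ?_
      simp only [FunLike.coe_add, Pi.add_apply]
      ring)
    (fun c φ x => by
      rw [← intervalIntegral.integral_const_mul]
      refine intervalIntegral.integral_congr fun t _ => ?_
      simp only [FunLike.coe_smul, Pi.smul_apply, smul_eq_mul]
      ring)
    (fun φ => by
      rw [contDiff_infty_iff_deriv]
      refine ⟨fun x => (hasDerivAt_tailIntegral φ x).differentiableAt, ?_⟩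
      rw [funext fun x => (hasDerivAt_tailIntegral φ x).deriv]
      exact ((φ.contDiff.sub (φ.contDiff.comp contDiff_neg)).div_const 2).neg)
    (fun b hb φ h x hx => tailIntegral_eq_zero hb φ h x hx)
    (by
      intro b hb i
      rcases i with _ | i
      · refine ⟨|2 * a|, abs_nonneg _, fun φ _ M hM x hx => ?_⟩
        rw [norm_iteratedFDeriv_zero]
        have h0 : ∀ t, ‖(φ t - φ (-t)) / 2‖ ≤ M := fun t => by
          have := norm_iteratedFDeriv_oddPart_le φ 0 M (hM 0 le_rfl) t
          rwa [norm_iteratedFDeriv_zero] at this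
        have hM0 : 0 ≤ M := (norm_nonneg _).trans (h0 0)
        refine (intervalIntegral.norm_integral_le_of_norm_le_const fun t _ => h0 t).trans ?_
        rw [mul_comm]
        have h1 := abs_le.1 hx
        have : |a - x| ≤ |2 * a| := by
          rw [abs_of_nonneg (by linarith)]
          exact le_trans (by linarith) (le_abs_self _)
        gcongr
      · refine ⟨1, zero_le_one, fun φ _ M hM x _ => ?_⟩
        rw [one_mul, norm_iteratedFDeriv_eq_norm_iteratedDeriv, iteratedDeriv_succ',
          funext fun x => (hasDerivAt_tailIntegral φ x).deriv,
          ← norm_iteratedFDeriv_eq_norm_iteratedDeriv]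
        have hneg : (fun x => -((φ x - φ (-x)) / 2)) = -(fun x => (φ x - φ (-x)) / 2) := rfl
        rw [hneg, iteratedFDeriv_neg_apply, norm_neg]
        exact norm_iteratedFDeriv_oddPart_le φ i M (hM i (Nat.le_succ i)) x)

/-- The continuous extension of `A P₊` to distributions, where `A u(x) = ∫₀ˣ u(t) dt`. -/
def APplus (a : ℝ) : Distr a →L[ℂ] Distr a := transposeOp (testAPplus a)

/-! ### Transmutation operators for `L = d²/dx² - q` -/

/-- The Schrödinger operator `L = d²/dx² - q` on distributions. -/
def schrodinger (a : ℝ) (q : ℝ → ℂ) (hq : ContDiffOn ℝ ∞ q (Set.Ioo (-a) a)) :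
    Distr a →L[ℂ] Distr a :=
  ddx a ∘L ddx a - mulOp a q hq

/-- `𝒯` is a transmutation operator on `𝓓'(I)`: `(d²/dx² - q) 𝒯 u = 𝒯 (d²/dx²) u`. -/
def IsTransmutation (a : ℝ) (q : ℝ → ℂ) (hq : ContDiffOn ℝ ∞ q (Set.Ioo (-a) a))
    (𝒯 : Distr a →L[ℂ] Distr a) : Prop :=
  ∀ u : Distr a, schrodinger a q hq (𝒯 u) = 𝒯 (ddx a (ddx a u))

/-- A standard `L`-base of smooth functions on `I`: `L φ₀ = L φ₁ = 0` and
`L φₖ = k (k - 1) φₖ₋₂` for `k ≥ 2`, in the weak sense, and `φₖ(0) = φₖ'(0) = 0` for `k ≥ 2`. -/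
structure IsSLBase (a : ℝ) (q : ℝ → ℂ) (hq : ContDiffOn ℝ ∞ q (Set.Ioo (-a) a))
    (φ : ℕ → ℝ → ℂ) : Prop where
  smooth : ∀ k, ContDiffOn ℝ ∞ (φ k) (Set.Ioo (-a) a)
  eq_zero : schrodinger a q hq (regular a (φ 0)) = 0
  eq_one : schrodinger a q hq (regular a (φ 1)) = 0
  eq_add_two : ∀ k : ℕ, schrodinger a q hq (regular a (φ (k + 2))) =
    (((k : ℂ) + 2) * ((k : ℂ) + 1)) • regular a (φ k)
  value_zero : ∀ k, 2 ≤ k → φ k 0 = 0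
  deriv_zero : ∀ k, 2 ≤ k → deriv (φ k) 0 = 0

/-- `𝒯` is an s-transmutation (standard transmutation) on `𝓓'(I)`: it is a transmutation
operator, and the images `𝒯[xᵏ]` are smooth functions that form a standard `L`-base. -/
def IsSTransmutation (a : ℝ) (q : ℝ → ℂ) (hq : ContDiffOn ℝ ∞ q (Set.Ioo (-a) a))
    (𝒯 : Distr a →L[ℂ] Distr a) : Prop :=
  IsTransmutation a q hq 𝒯 ∧
    ∃ φ : ℕ → ℝ → ℂ, IsSLBase a q hq φ ∧
      ∀ k : ℕ, 𝒯 (regular a fun x => (x : ℂ) ^ k) = regular a (φ k)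

/-! ### The operator `𝐓` -/

/-- `H` is a continuous solution of
`H(u,v) = ½ ∫₀ᵘ q(s) ds + ∫₀ᵘ ∫₀ᵛ q(α + β) H(α, β) dβ dα`
on the open square of all `(u, v)` with `u + v ∈ I` and `u - v ∈ I`. -/
def IsGoursatSolution (a : ℝ) (q : ℝ → ℂ) (H : ℝ → ℝ → ℂ) : Prop :=
  ContinuousOn (fun p : ℝ × ℝ => H p.1 p.2) {p | |p.1 + p.2| < a ∧ |p.1 - p.2| < a} ∧
  ∀ u v : ℝ, |u + v| < a → |u - v| < a →
    H u v = (∫ s in 0..u, q s) / 2 + ∫ α in 0..u, ∫ β in 0..v, q (α + β) * H α β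

/-- The kernel `K(x, t) = H((x + t)/2, (x - t)/2)`. -/
def kernelOf (H : ℝ → ℝ → ℂ) (x t : ℝ) : ℂ := H ((x + t) / 2) ((x - t) / 2)

/-- The transpose of the Volterra operator `u ↦ u(x) + ∫₋ₓˣ K(x, t) u(t) dt`, namely
`ψ ↦ ψ(x) - ∫_{-a}^{-|x|} K(t, x) ψ(t) dt + ∫_{|x|}^{a} K(t, x) ψ(t) dt`. -/
def volterraTranspose (a : ℝ) (K : ℝ → ℝ → ℂ) (ψ : ℝ → ℂ) (x : ℝ) : ℂ :=
  ψ x - (∫ t in (-a)..(-|x|), K t x * ψ t) + ∫ t in |x|..a, K t x * ψ t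

/-- `T` is the operator `𝐓` on `𝓓'(I)`, the extension of
`u ↦ u(x) + ∫₋ₓˣ K(x, t) u(t) dt` by `⟨𝐓 u, φ⟩ = ⟨u, 𝐓^□ φ⟩`: for every test function `φ`, the
function `𝐓^□ φ` agrees on `I` with a test function `ψ`, and `⟨T u, φ⟩ = ⟨u, ψ⟩` for all `u`. -/
def IsVolterraTransmutation (a : ℝ) (q : ℝ → ℂ) (T : Distr a →L[ℂ] Distr a) : Prop :=
  ∃ H : ℝ → ℝ → ℂ, IsGoursatSolution a q H ∧
    ∀ φ : TestFun a, ∃ ψ : TestFun a,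
      (∀ x ∈ Set.Ioo (-a) a, ψ x = volterraTranspose a (kernelOf H) φ x) ∧
      ∀ u : Distr a, T u φ = u ψ

end

end STransmutation

open STransmutation

open scoped Distributions ContDiff

namespace STransmutation

open MeasureTheory Set Filter Topology

/-! ### Interval integrals -/

/-! An s-transmutation is fixed by four numbers. A functional `u ↦ 𝒯 u φ` that is continuous for
pointwise convergence is evaluation at some test function (`exists_transpose_apply`), and by
Weierstrass a test function is determined by its moments (`test_ext_of_moments`). Hence `𝒯` is
determined by the images of the monomials (`distr_clm_ext`). In a standard `L`-base each member of
index at least 2 solves a Cauchy problem with zero data at 0 and a right side given by an earlier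
member, so the base is determined by its members of index 0 and 1 (`IsSLBase.eqOn`). These solve `L
φ = 0`, hence are determined by their values and derivatives at 0: four free constants.

The operator `𝐓` leaves the Cauchy data of `xᵏ` at 0 unchanged, because `K(0, 0) = 0` makes the
Volterra integral `o(x)` (`hasDerivAt_volterra_zero`). So `𝐓1` and `𝐓x` have data (1, 0) and (0, 1).
The four operators of the theorem send `1` to `𝐓1` or `𝐓x`, and `x` to `𝐓x` or `𝐓1`, one case each,
and thus realize every choice of the constants. Conversely, `P₊`, `P₋`, `A P₊` and `d/dx P₋` commute
with the second derivative, so composing them with `𝐓` keeps the intertwining relation, and parity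
keeps the data of index at least 2 equal to zero (`isSLBase_combinationBase`).

The analytic work lies in constructing `𝐓` and proving `(𝐓^□ φ)'' = 𝐓^□(φ'' - q φ)`
(`hasDerivAt_deriv_volterraTranspose`). Along characteristics `𝐓^□ φ - φ` is an integral with fixed
limits (`volterraTranspose_eq_charOp`). Differentiating it twice and using `H_uv = q H`, `H_u(u, 0)
= q(u)/2` and `H_v(0, v) = 0` yields the identity (`charInt_second_deriv`). Iterated, the same
identity gives the smoothness of `𝐓^□ φ` and all seminorm bounds, so that no derivatives of `H`
beyond second order are needed. Since `q` may be unbounded near the ends of `I`, the Goursat problem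
is solved on the plane for test functions that agree with `q` on `[-b, b]`, and the solutions are
compared by uniqueness. -/

lemma norm_integral_le_exp {f : ℝ → ℂ} {C l u : ℝ} (hl : 0 < l) (hC : 0 ≤ C)
    (h : ∀ t ∈ uIcc 0 u, ‖f t‖ ≤ C * Real.exp (l * |t|)) :
    ‖∫ t in (0 : ℝ)..u, f t‖ ≤ C / l * Real.exp (l * |u|) := by
  have key : ∀ (g : ℝ → ℂ) (u : ℝ), 0 ≤ u → (∀ t ∈ Icc 0 u, ‖g t‖ ≤ C * Real.exp (l * t)) →
      ‖∫ t in (0 : ℝ)..u, g t‖ ≤ C / l * Real.exp (l * u) := by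
    intro g u hu hg
    have hcont : Continuous fun t => C * Real.exp (l * t) := by fun_prop
    have h1 := intervalIntegral.norm_integral_le_of_norm_le (μ := volume) hu
      (ae_of_all _ fun t ht => hg t (Ioc_subset_Icc_self ht)) (hcont.intervalIntegrable 0 u)
    have h2 : ∫ t in (0 : ℝ)..u, C * Real.exp (l * t) =
        C / l * Real.exp (l * u) - C / l * Real.exp (l * 0) := by
      refine intervalIntegral.integral_eq_sub_of_hasDerivAt
        (f := fun t => C / l * Real.exp (l * t)) (fun t _ => ?_) (hcont.intervalIntegrable 0 u)
      have := (((hasDerivAt_id t).const_mul l).exp).const_mul (C / l)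
      refine this.congr_deriv ?_
      rw [mul_one, id, mul_comm _ l, div_mul_eq_mul_div, mul_left_comm, mul_div_cancel_left₀ _ hl.ne']
    rw [h2] at h1
    have : 0 ≤ C / l * Real.exp (l * 0) := by positivity
    linarith
  rcases le_total 0 u with hu | hu
  · rw [abs_of_nonneg hu]
    refine key f u hu fun t ht => ?_
    have := h t (by rwa [uIcc_of_le hu])
    rwa [abs_of_nonneg ht.1] at this
  · rw [abs_of_nonpos hu]
    have h1 := key (fun t => f (-t)) (-u) (by linarith) fun t ht => by
      have := h (-t) (by rw [uIcc_of_ge hu]; constructor <;> linarith [ht.1, ht.2])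
      rwa [abs_neg, abs_of_nonneg ht.1] at this
    rw [intervalIntegral.integral_comp_neg, neg_neg, neg_zero,
      intervalIntegral.integral_symm, norm_neg] at h1
    exact h1

lemma hasDerivAt_integral_param {F F' : ℝ → ℝ → ℂ} (hF : ∀ x, Continuous (F x))
    (hF' : Continuous F'.uncurry) (h : ∀ x t, HasDerivAt (fun x => F x t) (F' x t) x)
    (a b x : ℝ) :
    HasDerivAt (fun x => ∫ t in a..b, F x t) (∫ t in a..b, F' x t) x := by
  obtain ⟨C, hC⟩ := ((isCompact_closedBall x 1).prod
    (isCompact_uIcc (a := a) (b := b))).exists_bound_of_continuousOn hF'.continuousOn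
  refine (intervalIntegral.hasDerivAt_integral_of_dominated_loc_of_deriv_le
    (bound := fun _ => C) (Metric.closedBall_mem_nhds x one_pos)
    (Eventually.of_forall fun y => (hF y).aestronglyMeasurable)
    ((hF x).intervalIntegrable _ _) (hF'.uncurry_left x).aestronglyMeasurable
    (ae_of_all _ fun t ht y hy => hC (y, t) ⟨hy, uIoc_subset_uIcc ht⟩)
    intervalIntegrable_const (ae_of_all _ fun t _ y _ => h y t)).2

lemma continuous_integral_right {f : ℝ → ℝ → ℂ} (hf : Continuous f.uncurry) :
    Continuous fun p : ℝ × ℝ => ∫ t in (0 : ℝ)..p.2, f p.1 t :=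
  intervalIntegral.continuous_parametric_primitive_of_continuous hf

lemma continuous_integral_left {f : ℝ → ℝ → ℂ} (hf : Continuous f.uncurry) :
    Continuous fun p : ℝ × ℝ => ∫ t in (0 : ℝ)..p.1, f t p.2 :=
  (intervalIntegral.continuous_parametric_primitive_of_continuous
    (f := fun v t => f t v) (hf.comp continuous_swap)).comp continuous_swap

lemma continuous_integral_integral {f : ℝ → ℝ → ℂ} (hf : Continuous f.uncurry) :
    Continuous fun p : ℝ × ℝ => ∫ α in (0 : ℝ)..p.1, ∫ β in (0 : ℝ)..p.2, f α β :=
  continuous_integral_left (f := fun α v => ∫ β in (0 : ℝ)..v, f α β)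
    (continuous_integral_right hf)

/-- Each integration of the exponential weight gains a factor `1 / l`. For large `l` the Goursat
integral operator is therefore a contraction in the weighted sup norm. -/
lemma norm_integral_integral_le_exp {f : ℝ → ℝ → ℂ} {C l u v : ℝ} (hl : 0 < l) (hC : 0 ≤ C)
    (h : ∀ α ∈ uIcc 0 u, ∀ β ∈ uIcc 0 v, ‖f α β‖ ≤ C * Real.exp (l * (|α| + |β|))) :
    ‖∫ α in (0 : ℝ)..u, ∫ β in (0 : ℝ)..v, f α β‖ ≤
      C / l / l * Real.exp (l * (|u| + |v|)) := by
  have h1 : ∀ α ∈ uIcc 0 u, ‖∫ β in (0 : ℝ)..v, f α β‖ ≤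
      (C / l * Real.exp (l * |v|)) * Real.exp (l * |α|) := by
    intro α hα
    refine (norm_integral_le_exp (C := C * Real.exp (l * |α|)) hl (by positivity)
      fun β hβ => ?_).trans_eq (by ring)
    refine (h α hα β hβ).trans_eq ?_
    rw [mul_add, Real.exp_add]; ring
  refine (norm_integral_le_exp hl (by positivity) h1).trans_eq ?_
  rw [mul_add, Real.exp_add]; ring

/-! ### The Goursat problem on the plane -/

/-- Banach's fixed point theorem for the unknown `h = H / w` among bounded continuous functions on
the plane. The weight `w` gives a global solution at once, without continuation from small squares.
-/
lemma exists_goursat_solution {Q : ℝ → ℂ} (hQ : Continuous Q) {M : ℝ} (hM : ∀ t, ‖Q t‖ ≤ M) :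
    ∃ H : ℝ → ℝ → ℂ, Continuous H.uncurry ∧ ∀ u v, H u v =
      (∫ s in (0 : ℝ)..u, Q s) / 2 + ∫ α in (0 : ℝ)..u, ∫ β in (0 : ℝ)..v, Q (α + β) * H α β := by
  have hM0 : 0 ≤ M := (norm_nonneg _).trans (hM 0)
  -- This choice gives both `M / l² ≤ 1/2`, the contraction constant, and `M / l ≤ 1`, the bound for
  -- the free term.
  set l : ℝ := 1 + 2 * M with hl_def
  have hl : 0 < l := by positivity
  let w : ℝ × ℝ → ℝ := fun p => Real.exp (l * (|p.1| + |p.2|))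
  have hw : Continuous w := by fun_prop
  have hw0 : ∀ p, 0 < w p := fun p => Real.exp_pos _
  let J : (ℝ × ℝ → ℂ) → ℝ × ℝ → ℂ := fun h p =>
    ∫ α in (0 : ℝ)..p.1, ∫ β in (0 : ℝ)..p.2, Q (α + β) * (w (α, β) * h (α, β))
  have hJint : ∀ h : ℝ × ℝ → ℂ, Continuous h →
      Continuous (Function.uncurry fun α β : ℝ => Q (α + β) * (w (α, β) * h (α, β))) := by
    intro h hh
    have h1 : Continuous fun p : ℝ × ℝ => Q (p.1 + p.2) * (w p * h p) := by fun_prop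
    exact h1
  have hJc : ∀ h : ℝ × ℝ → ℂ, Continuous h → Continuous (J h) := fun h hh =>
    continuous_integral_integral (hJint h hh)
  have hJb : ∀ (h : ℝ × ℝ → ℂ) (C : ℝ), 0 ≤ C → (∀ p, ‖h p‖ ≤ C) → ∀ p,
      ‖J h p‖ ≤ C / 2 * w p := by
    intro h C hC hh p
    refine (norm_integral_integral_le_exp (C := M * C) hl (by positivity)
      fun α _ β _ => ?_).trans ?_
    · rw [norm_mul, norm_mul, Complex.norm_real, Real.norm_of_nonneg (hw0 _).le]
      calc ‖Q (α + β)‖ * (w (α, β) * ‖h (α, β)‖) ≤ M * (w (α, β) * C) := by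
            have := hh (α, β); have := hM (α + β); have := (hw0 (α, β)).le; gcongr
        _ = _ := by simp only [w]; ring
    · refine mul_le_mul_of_nonneg_right ?_ (hw0 p).le
      rw [div_div, div_le_div_iff₀ (by positivity) two_pos]
      nlinarith [mul_nonneg hC hM0, mul_nonneg (mul_nonneg hC hM0) hM0]
  have hJsub : ∀ h k : ℝ × ℝ → ℂ, Continuous h → Continuous k → ∀ p,
      J h p - J k p = J (h - k) p := by
    intro h k hh hk p
    have e : ∀ h : ℝ × ℝ → ℂ, Continuous h → IntervalIntegrable
        (fun α => ∫ β in (0 : ℝ)..p.2, Q (α + β) * (w (α, β) * h (α, β))) volume 0 p.1 := by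
      intro h hh
      refine Continuous.intervalIntegrable ?_ _ _
      exact (continuous_integral_right (hJint h hh)).comp (continuous_id.prodMk continuous_const)
    simp only [J]
    rw [← intervalIntegral.integral_sub (e h hh) (e k hk)]
    refine intervalIntegral.integral_congr fun α _ => ?_
    rw [← intervalIntegral.integral_sub (((hJint h hh).uncurry_left α).intervalIntegrable _ _)
      (((hJint k hk).uncurry_left α).intervalIntegrable _ _)]
    refine intervalIntegral.integral_congr fun β _ => ?_
    simp only [Pi.sub_apply]
    ring
  have hq : Continuous fun p : ℝ × ℝ => (∫ s in (0 : ℝ)..p.1, Q s) / 2 :=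
    ((intervalIntegral.continuous_primitive (fun a b => hQ.intervalIntegrable a b) 0).comp
      continuous_fst).div_const 2
  have hqb : ∀ p : ℝ × ℝ, ‖(∫ s in (0 : ℝ)..p.1, Q s) / 2‖ ≤ w p := by
    intro p
    have h1 := norm_integral_le_exp (f := Q) (C := M) (u := p.1) hl hM0 fun t _ =>
      (hM t).trans (le_mul_of_one_le_right hM0 (Real.one_le_exp (by positivity)))
    rw [norm_div]
    have h2 : M / l * Real.exp (l * |p.1|) ≤ 1 * w p := by
      refine mul_le_mul ?_ ?_ (Real.exp_pos _).le zero_le_one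
      · rw [div_le_one hl]; linarith
      · refine Real.exp_le_exp.2 (mul_le_mul_of_nonneg_left ?_ hl.le)
        linarith [abs_nonneg p.2]
    have h3 : ‖(2 : ℂ)‖ = 2 := by simp
    rw [h3]
    linarith [norm_nonneg (∫ s in (0 : ℝ)..p.1, Q s)]
  let Φ : BoundedContinuousFunction (ℝ × ℝ) ℂ → BoundedContinuousFunction (ℝ × ℝ) ℂ := fun h =>
    BoundedContinuousFunction.ofNormedAddCommGroup
      (fun p => ((w p)⁻¹ : ℝ) * ((∫ s in (0 : ℝ)..p.1, Q s) / 2 + J h p))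
      ((Complex.continuous_ofReal.comp (hw.inv₀ fun p => (hw0 p).ne')).mul
        (hq.add (hJc h h.continuous))) (1 + ‖h‖ / 2) (by
        intro p
        rw [norm_mul, Complex.norm_real, Real.norm_of_nonneg (inv_pos.2 (hw0 p)).le,
          inv_mul_le_iff₀ (hw0 p)]
        have h1 := hJb h ‖h‖ (norm_nonneg _) h.norm_coe_le_norm p
        refine (norm_add_le _ _).trans ?_
        linarith [hqb p])
  have hΦ : ContractingWith (1 / 2) Φ := by
    refine ⟨by rw [← NNReal.coe_lt_coe]; norm_num, LipschitzWith.of_dist_le_mul fun h k => ?_⟩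
    rw [BoundedContinuousFunction.dist_le (by positivity)]
    intro p
    have h1 := hJb (h - k) (dist h k) dist_nonneg (fun p => by
      rw [Pi.sub_apply, ← dist_eq_norm]; exact BoundedContinuousFunction.dist_coe_le_dist p) p
    rw [← hJsub h k h.continuous k.continuous] at h1
    simp only [Φ, BoundedContinuousFunction.coe_ofNormedAddCommGroup]
    rw [dist_eq_norm, ← mul_sub, norm_mul, Complex.norm_real,
      Real.norm_of_nonneg (inv_pos.2 (hw0 p)).le, inv_mul_le_iff₀ (hw0 p), add_sub_add_left_eq_sub]
    refine h1.trans_eq ?_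
    push_cast
    ring
  let h := ContractingWith.fixedPoint Φ hΦ
  have hfix : Φ h = h := hΦ.fixedPoint_isFixedPt
  refine ⟨fun u v => w (u, v) * h (u, v), ?_, fun u v => ?_⟩
  · have : Continuous fun p : ℝ × ℝ => (w p : ℂ) * h p :=
      (Complex.continuous_ofReal.comp hw).mul h.continuous
    exact this
  · have h1 : h (u, v) = ((w (u, v))⁻¹ : ℝ) *
        ((∫ s in (0 : ℝ)..u, Q s) / 2 + J h (u, v)) := by
      conv_lhs => rw [← hfix]
      rfl
    have h2 : (w (u, v) : ℂ) ≠ 0 := by exact_mod_cast (hw0 _).ne'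
    beta_reduce
    nth_rewrite 1 [h1]
    push_cast
    rw [mul_inv_cancel_left₀ h2]

/-- A continuous solution of a homogeneous Goursat problem on a rectangle vanishes. -/
lemma eq_zero_of_goursat_homogeneous {k d : ℝ → ℝ → ℂ} (hk : Continuous k.uncurry)
    (hd : Continuous d.uncurry) {u₀ v₀ : ℝ}
    (h : ∀ u ∈ uIcc 0 u₀, ∀ v ∈ uIcc 0 v₀,
      d u v = ∫ α in (0 : ℝ)..u, ∫ β in (0 : ℝ)..v, k α β * d α β) :
    ∀ u ∈ uIcc 0 u₀, ∀ v ∈ uIcc 0 v₀, d u v = 0 := by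
  have hR : IsCompact (uIcc 0 u₀ ×ˢ uIcc 0 v₀) := isCompact_uIcc.prod isCompact_uIcc
  obtain ⟨M, hM⟩ := hR.exists_bound_of_continuousOn hk.continuousOn
  have hM0 : 0 ≤ M := (norm_nonneg _).trans (hM (0, 0) ⟨left_mem_uIcc, left_mem_uIcc⟩)
  set l : ℝ := 1 + 2 * M
  have hl : 0 < l := by positivity
  let w : ℝ × ℝ → ℝ := fun p => Real.exp (l * (|p.1| + |p.2|))
  have hw : Continuous w := by fun_prop
  have hw0 : ∀ p, 0 < w p := fun p => Real.exp_pos _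
  -- At a maximum point of `‖d‖ / w` the integral equation bounds the maximum `s` by `s / 2`.
  obtain ⟨p, hp, hmax⟩ := hR.exists_isMaxOn ⟨(0, 0), left_mem_uIcc, left_mem_uIcc⟩
    (f := fun p => (w p)⁻¹ * ‖d p.1 p.2‖)
    ((hw.inv₀ fun p => (hw0 p).ne').mul hd.norm).continuousOn
  set s := (w p)⁻¹ * ‖d p.1 p.2‖ with hs
  have hs0 : 0 ≤ s := mul_nonneg (inv_pos.2 (hw0 p)).le (norm_nonneg _)
  have hle : ∀ u ∈ uIcc 0 u₀, ∀ v ∈ uIcc 0 v₀, ‖d u v‖ ≤ s * w (u, v) := by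
    intro u hu v hv
    have h1 : (w (u, v))⁻¹ * ‖d u v‖ ≤ s := hmax (show (u, v) ∈ _ from ⟨hu, hv⟩)
    rw [inv_mul_le_iff₀ (hw0 _)] at h1
    linarith
  have hsub : ∀ {x y : ℝ}, x ∈ uIcc 0 y → uIcc 0 x ⊆ uIcc 0 y := fun hx =>
    uIcc_subset_uIcc left_mem_uIcc hx
  have h1 : ‖d p.1 p.2‖ ≤ M * s / l / l * w p := by
    rw [h p.1 hp.1 p.2 hp.2]
    refine norm_integral_integral_le_exp hl (by positivity) fun α hα β hβ => ?_
    rw [norm_mul, mul_assoc]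
    exact mul_le_mul (hM (α, β) ⟨hsub hp.1 hα, hsub hp.2 hβ⟩)
      (hle α (hsub hp.1 hα) β (hsub hp.2 hβ)) (norm_nonneg _) hM0
  have h2 : s ≤ s / 2 := by
    have h3 : M * s / l / l ≤ s / 2 := by
      rw [div_div, div_le_div_iff₀ (by positivity) two_pos]
      simp only [l]
      nlinarith [mul_nonneg hs0 hM0, mul_nonneg (mul_nonneg hs0 hM0) hM0]
    have h4 : s ≤ M * s / l / l := by
      rw [hs, inv_mul_le_iff₀ (hw0 _), ← hs]
      linarith
    linarith
  have hs1 : s = 0 := by linarith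
  intro u hu v hv
  have := hle u hu v hv
  rw [hs1, zero_mul] at this
  exact norm_le_zero_iff.1 this

/-- Two solutions of the Goursat problem which are continuous on a rectangle agree there. -/
lemma goursat_unique {q₁ q₂ : ℝ → ℂ} {H₁ H₂ : ℝ → ℝ → ℂ} {r u₀ v₀ : ℝ}
    (hr : |u₀| + |v₀| ≤ r) (hq : ContinuousOn q₁ (Icc (-r) r)) (hqq : EqOn q₁ q₂ (Icc (-r) r))
    (hc₁ : ContinuousOn H₁.uncurry {p | |p.1| + |p.2| ≤ r})
    (hc₂ : ContinuousOn H₂.uncurry {p | |p.1| + |p.2| ≤ r})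
    (h₁ : ∀ u v, |u| + |v| ≤ r → H₁ u v =
      (∫ s in (0 : ℝ)..u, q₁ s) / 2 + ∫ α in (0 : ℝ)..u, ∫ β in (0 : ℝ)..v, q₁ (α + β) * H₁ α β)
    (h₂ : ∀ u v, |u| + |v| ≤ r → H₂ u v =
      (∫ s in (0 : ℝ)..u, q₂ s) / 2 + ∫ α in (0 : ℝ)..u, ∫ β in (0 : ℝ)..v, q₂ (α + β) * H₂ α β) :
    H₁ u₀ v₀ = H₂ u₀ v₀ := by
  -- `c y` is the retraction of the line onto the segment from 0 to `y`. Composing with it makes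
  -- functions that are continuous only for `|u| + |v| ≤ r` continuous on the plane, without
  -- changing them on the rectangle.
  let c : ℝ → ℝ → ℝ := fun y x => max (min 0 y) (min (max 0 y) x)
  have hcc : ∀ y, Continuous (c y) := fun y => by fun_prop
  have hcm : ∀ y x, c y x ∈ uIcc 0 y := fun y x =>
    ⟨le_max_left _ _, max_le (min_le_max) (min_le_left _ _)⟩
  have hci : ∀ y x, x ∈ uIcc 0 y → c y x = x := fun y x hx => by
    simp only [c]
    rw [min_eq_right hx.2, max_eq_right hx.1]
  have habs : ∀ y x : ℝ, x ∈ uIcc 0 y → |x| ≤ |y| := fun y x hx => by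
    simpa using abs_sub_left_of_mem_uIcc hx
  have hsub : ∀ {x y : ℝ}, x ∈ uIcc 0 y → uIcc 0 x ⊆ uIcc 0 y := fun hx =>
    uIcc_subset_uIcc left_mem_uIcc hx
  have hmaps : ∀ p : ℝ × ℝ, |c u₀ p.1| + |c v₀ p.2| ≤ r := fun p =>
    (add_le_add (habs _ _ (hcm _ _)) (habs _ _ (hcm _ _))).trans hr
  let G : (ℝ → ℝ → ℂ) → ℝ → ℝ → ℂ := fun H u v => H (c u₀ u) (c v₀ v)
  have hG : ∀ H : ℝ → ℝ → ℂ, ContinuousOn H.uncurry {p | |p.1| + |p.2| ≤ r} →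
      Continuous (G H).uncurry := fun H hH =>
    hH.comp_continuous (f := fun p : ℝ × ℝ => (c u₀ p.1, c v₀ p.2))
      (((hcc _).comp continuous_fst).prodMk ((hcc _).comp continuous_snd)) hmaps
  let k : ℝ → ℝ → ℂ := fun u v => q₁ (c u₀ u + c v₀ v)
  have hk : Continuous k.uncurry :=
    hq.comp_continuous (f := fun p : ℝ × ℝ => c u₀ p.1 + c v₀ p.2)
      (((hcc _).comp continuous_fst).add ((hcc _).comp continuous_snd))
      fun p => abs_le.1 ((abs_add_le _ _).trans (hmaps p))
  have heq : ∀ (q : ℝ → ℂ) (H : ℝ → ℝ → ℂ), EqOn q₁ q (Icc (-r) r) →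
      (∀ u v, |u| + |v| ≤ r → H u v = (∫ s in (0 : ℝ)..u, q s) / 2 +
        ∫ α in (0 : ℝ)..u, ∫ β in (0 : ℝ)..v, q (α + β) * H α β) →
      ∀ u ∈ uIcc 0 u₀, ∀ v ∈ uIcc 0 v₀, G H u v = (∫ s in (0 : ℝ)..u, q₁ s) / 2 +
        ∫ α in (0 : ℝ)..u, ∫ β in (0 : ℝ)..v, k α β * G H α β := by
    intro q H hqq h u hu v hv
    have hur : |u| + |v| ≤ r := (add_le_add (habs _ _ hu) (habs _ _ hv)).trans hr
    simp only [G, hci _ _ hu, hci _ _ hv]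
    rw [h u v hur]
    congr 1
    · congr 1
      refine intervalIntegral.integral_congr fun s hs => (hqq (abs_le.1 ?_)).symm
      linarith [habs _ _ hs, abs_nonneg v]
    · refine intervalIntegral.integral_congr fun α hα => ?_
      refine intervalIntegral.integral_congr fun β hβ => ?_
      have h1 : q₁ (α + β) = q (α + β) := hqq (abs_le.1 ((abs_add_le _ _).trans
        ((add_le_add (habs _ _ hα) (habs _ _ hβ)).trans hur)))
      simp only [k, hci _ _ (hsub hu hα), hci _ _ (hsub hv hβ), h1]
  have e : ∀ H : ℝ → ℝ → ℂ, Continuous (G H).uncurry →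
      Continuous (Function.uncurry fun α β => k α β * G H α β) := fun H hH => hk.mul hH
  have hmain := eq_zero_of_goursat_homogeneous (d := fun u v => G H₁ u v - G H₂ u v)
    (u₀ := u₀) (v₀ := v₀) hk ((hG _ hc₁).sub (hG _ hc₂)) (by
      intro u hu v hv
      rw [heq q₁ H₁ (eqOn_refl _ _) h₁ u hu v hv, heq q₂ H₂ hqq h₂ u hu v hv,
        add_sub_add_left_eq_sub]
      have e2 : ∀ H : ℝ → ℝ → ℂ, Continuous (G H).uncurry → IntervalIntegrable
          (fun α => ∫ β in (0 : ℝ)..v, k α β * G H α β) volume 0 u := fun H hH =>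
        ((continuous_integral_right (e H hH)).comp
          (continuous_id.prodMk continuous_const)).intervalIntegrable _ _
      rw [← intervalIntegral.integral_sub (e2 _ (hG _ hc₁)) (e2 _ (hG _ hc₂))]
      refine intervalIntegral.integral_congr fun α _ => ?_
      rw [← intervalIntegral.integral_sub
        (((e _ (hG _ hc₁)).uncurry_left α).intervalIntegrable _ _)
        (((e _ (hG _ hc₂)).uncurry_left α).intervalIntegrable _ _)]
      refine intervalIntegral.integral_congr fun β _ => ?_
      ring) u₀ right_mem_uIcc v₀ right_mem_uIcc
  simp only [G, hci _ _ (right_mem_uIcc (a := (0 : ℝ)))] at hmain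
  exact sub_eq_zero.1 hmain

/-! ### Regularity of the solution of the Goursat problem -/

/-- A solution of the Goursat problem on the plane together with its derivatives of order at
most two. -/
structure GoursatKernel (Q : ℝ → ℂ) where
  (H Hu Hv Huu Hvv : ℝ → ℝ → ℂ)
  continuous_H : Continuous H.uncurry
  continuous_Hu : Continuous Hu.uncurry
  continuous_Hv : Continuous Hv.uncurry
  continuous_Huu : Continuous Huu.uncurry
  continuous_Hvv : Continuous Hvv.uncurry
  deriv_u : ∀ u v, HasDerivAt (fun u => H u v) (Hu u v) u
  deriv_v : ∀ u v, HasDerivAt (fun v => H u v) (Hv u v) v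
  deriv_uu : ∀ u v, HasDerivAt (fun u => Hu u v) (Huu u v) u
  deriv_vv : ∀ u v, HasDerivAt (fun v => Hv u v) (Hvv u v) v
  deriv_uv : ∀ u v, HasDerivAt (fun v => Hu u v) (Q (u + v) * H u v) v
  deriv_vu : ∀ u v, HasDerivAt (fun u => Hv u v) (Q (u + v) * H u v) u
  Hu_zero : ∀ u, Hu u 0 = Q u / 2
  Hv_zero : ∀ v, Hv 0 v = 0
  goursat : ∀ u v, H u v = (∫ s in (0 : ℝ)..u, Q s) / 2 +
    ∫ α in (0 : ℝ)..u, ∫ β in (0 : ℝ)..v, Q (α + β) * H α β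

lemma hasDerivAt_primitive {f : ℝ → ℂ} (hf : Continuous f) (u : ℝ) :
    HasDerivAt (fun u => ∫ t in (0 : ℝ)..u, f t) (f u) u :=
  intervalIntegral.integral_hasDerivAt_right (hf.intervalIntegrable _ _)
    hf.stronglyMeasurable.stronglyMeasurableAtFilter hf.continuousAt

/-- The integral equation exhibits `Hu` and `Hv` as a term in `Q` plus one-variable integrals of
`Q(u + v) H(u, v)`. These can be differentiated once more because `Q` is `C¹`. The boundary values
on the axes are read off from the same formulas. -/
lemma nonempty_goursatKernel {Q : ℝ → ℂ} (hQ : ContDiff ℝ 1 Q) {M : ℝ} (hM : ∀ t, ‖Q t‖ ≤ M) :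
    Nonempty (GoursatKernel Q) := by
  obtain ⟨H, hH, hG⟩ := exists_goursat_solution hQ.continuous hM
  have hQc := hQ.continuous
  have hQ' : Continuous (deriv Q) := hQ.continuous_deriv le_rfl
  have hQd : ∀ t, HasDerivAt Q (deriv Q t) t := fun t =>
    (hQ.differentiable one_ne_zero t).hasDerivAt
  have hadd : Continuous fun p : ℝ × ℝ => p.1 + p.2 := continuous_add
  let F : ℝ → ℝ → ℂ := fun u v => Q (u + v) * H u v
  have hF : Continuous F.uncurry := (hQc.comp hadd).mul hH
  let Hu : ℝ → ℝ → ℂ := fun u v => Q u / 2 + ∫ β in (0 : ℝ)..v, F u β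
  let Hv : ℝ → ℝ → ℂ := fun u v => ∫ α in (0 : ℝ)..u, F α v
  have hHu : Continuous Hu.uncurry :=
    ((hQc.comp continuous_fst).div_const 2).add (continuous_integral_right hF)
  have hHv : Continuous Hv.uncurry := continuous_integral_left hF
  have du : ∀ u v, HasDerivAt (fun u => H u v) (Hu u v) u := by
    intro u v
    have h1 := ((hasDerivAt_primitive hQc u).div_const 2).add
      (hasDerivAt_primitive (f := fun α => ∫ β in (0 : ℝ)..v, F α β)
        ((continuous_integral_right hF).comp (continuous_id.prodMk continuous_const)) u)
    exact h1.congr_of_eventuallyEq (Eventually.of_forall fun u => hG u v)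
  have dv : ∀ u v, HasDerivAt (fun v => H u v) (Hv u v) v := by
    intro u v
    have h1 := (hasDerivAt_integral_param (F := fun v α => ∫ β in (0 : ℝ)..v, F α β)
      (F' := fun v α => F α v)
      (fun v => (continuous_integral_right hF).comp (continuous_id.prodMk continuous_const))
      (hF.comp continuous_swap)
      (fun v α => hasDerivAt_primitive (hF.uncurry_left α) v) 0 u v).const_add
      ((∫ s in (0 : ℝ)..u, Q s) / 2)
    exact h1.congr_of_eventuallyEq (Eventually.of_forall fun v => hG u v)
  let Fu : ℝ → ℝ → ℂ := fun u v => deriv Q (u + v) * H u v + Q (u + v) * Hu u v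
  let Fv : ℝ → ℝ → ℂ := fun u v => deriv Q (u + v) * H u v + Q (u + v) * Hv u v
  have hFu : Continuous Fu.uncurry :=
    ((hQ'.comp hadd).mul hH).add ((hQc.comp hadd).mul hHu)
  have hFv : Continuous Fv.uncurry :=
    ((hQ'.comp hadd).mul hH).add ((hQc.comp hadd).mul hHv)
  have dFu : ∀ u v, HasDerivAt (fun u => F u v) (Fu u v) u := fun u v =>
    ((hQd (u + v)).comp_add_const u v).mul (du u v)
  have dFv : ∀ u v, HasDerivAt (fun v => F u v) (Fv u v) v := fun u v =>
    ((hQd (u + v)).comp_const_add u v).mul (dv u v)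
  refine ⟨⟨H, Hu, Hv, fun u v => deriv Q u / 2 + ∫ β in (0 : ℝ)..v, Fu u β,
    fun u v => ∫ α in (0 : ℝ)..u, Fv α v, hH, hHu, hHv,
    ((hQ'.comp continuous_fst).div_const 2).add (continuous_integral_right hFu),
    continuous_integral_left hFv, du, dv, fun u v => ?_, fun u v => ?_, fun u v => ?_,
    fun u v => ?_, fun u => ?_, fun v => ?_, hG⟩⟩
  · exact ((hQd u).div_const 2).add (hasDerivAt_integral_param (F := F) (F' := Fu)
      (fun u => hF.uncurry_left u) hFu dFu 0 v u)
  · exact hasDerivAt_integral_param (F := fun v α => F α v) (F' := fun v α => Fv α v)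
      (fun v => hF.uncurry_right v) (hFv.comp continuous_swap) (fun v α => dFv α v) 0 u v
  · exact (hasDerivAt_primitive (hF.uncurry_left u) v).const_add _
  · exact hasDerivAt_primitive (f := fun α => F α v) (hF.uncurry_right v) u
  · simp [Hu]
  · simp [Hv]

/-! ### Integral operators along characteristics -/

/-- Continuity of both partial derivatives gives strict differentiability in two variables, hence
the chain rule along `v ↦ (x + v, v)`. -/
lemma hasDerivAt_comp_diagonal {g g₁ g₂ : ℝ → ℝ → ℂ} (h₁ : Continuous g₁.uncurry)
    (h₂ : Continuous g₂.uncurry) (d₁ : ∀ u v, HasDerivAt (fun u => g u v) (g₁ u v) u)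
    (d₂ : ∀ u v, HasDerivAt (fun v => g u v) (g₂ u v) v) (x v : ℝ) :
    HasDerivAt (fun v => g (x + v) v) (g₁ (x + v) v + g₂ (x + v) v) v := by
  let L : ℂ →L[ℝ] (ℝ →L[ℝ] ℂ) := ContinuousLinearMap.toSpanSingletonCLE.toContinuousLinearMap
  have hs := hasStrictFDerivAt_uncurry_coprod (𝕜 := ℝ) (u := (x + v, v)) (f := g)
    (f₁ := fun u v => L (g₁ u v)) (f₂ := fun u v => L (g₂ u v))
    (Eventually.of_forall fun p => (d₁ p.1 p.2).hasFDerivAt)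
    (Eventually.of_forall fun p => (d₂ p.1 p.2).hasFDerivAt)
    (L.continuous.comp h₁).continuousAt (L.continuous.comp h₂).continuousAt
  have hc : HasDerivAt (fun v : ℝ => (x + v, v)) ((1 : ℝ), (1 : ℝ)) v :=
    ((hasDerivAt_id v).const_add x).prodMk (hasDerivAt_id v)
  have := HasFDerivAt.comp_hasDerivAt (f := fun v : ℝ => (x + v, v)) v hs.hasFDerivAt hc
  refine this.congr_deriv ?_
  simp [L, Function.HasUncurry.uncurry]

/-- The operator `f ↦ ∫₀ᴺ h(x + v, v) f(x + 2v) dv`. -/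
noncomputable def charInt (h : ℝ → ℝ → ℂ) (f : ℝ → ℂ) (N x : ℝ) : ℂ :=
  ∫ v in (0 : ℝ)..N, h (x + v) v * f (x + 2 * v)

lemma continuous_charInt_integrand {h : ℝ → ℝ → ℂ} {f : ℝ → ℂ} (hh : Continuous h.uncurry)
    (hf : Continuous f) :
    Continuous (Function.uncurry fun x v : ℝ => h (x + v) v * f (x + 2 * v)) := by
  have h1 : Continuous fun p : ℝ × ℝ => h.uncurry (p.1 + p.2, p.2) * f (p.1 + 2 * p.2) := by
    fun_prop
  exact h1

lemma hasDerivAt_charInt {h h₁ : ℝ → ℝ → ℂ} {f f' : ℝ → ℂ} (hh : Continuous h.uncurry)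
    (hh₁ : Continuous h₁.uncurry) (hf : Continuous f) (hf' : Continuous f')
    (d : ∀ u v, HasDerivAt (fun u => h u v) (h₁ u v) u) (df : ∀ t, HasDerivAt f (f' t) t)
    (N x : ℝ) :
    HasDerivAt (charInt h f N) (charInt h₁ f N x + charInt h f' N x) x := by
  have h1 := continuous_charInt_integrand hh₁ hf
  have h2 := continuous_charInt_integrand hh hf'
  have := hasDerivAt_integral_param (F := fun x v => h (x + v) v * f (x + 2 * v))
    (F' := fun x v => h₁ (x + v) v * f (x + 2 * v) + h (x + v) v * f' (x + 2 * v))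
    (fun x => (continuous_charInt_integrand hh hf).uncurry_left x) (h1.add h2)
    (fun x v => ((d (x + v) v).comp_add_const x v).mul ((df (x + 2 * v)).comp_add_const x (2 * v)))
    0 N x
  refine this.congr_deriv ?_
  exact intervalIntegral.integral_add ((h1.uncurry_left x).intervalIntegrable _ _)
    ((h2.uncurry_left x).intervalIntegrable _ _)

/-- The left side is the second derivative of `charInt h f N` under the integral sign. The
`v`-derivative of `h₁(x + v, v) f(x + 2v)` is `h₁₁ f + 2 h₁ f' + P h f`, so integrating it trades
all terms with `h₁` and `h₁₁` for `-P h f` and the boundary term at `v = 0`; the one at `v = N`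
vanishes by `hx`. -/
lemma charInt_second_deriv {P : ℝ → ℂ} {h h₁ h₁₁ : ℝ → ℝ → ℂ} {f f' f'' : ℝ → ℂ}
    (hP : Continuous P) (hh : Continuous h.uncurry) (hh₁ : Continuous h₁.uncurry)
    (hh₁₁ : Continuous h₁₁.uncurry) (hf : Continuous f) (hf' : Continuous f')
    (hf'' : Continuous f'') (d : ∀ u v, HasDerivAt (fun u => h₁ u v) (h₁₁ u v) u)
    (dP : ∀ u v, HasDerivAt (fun v => h₁ u v) (P (u + v) * h u v) v)
    (df : ∀ t, HasDerivAt f (f' t) t) (N x : ℝ) (hx : f (x + 2 * N) = 0) :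
    charInt h₁₁ f N x + charInt h₁ f' N x + (charInt h₁ f' N x + charInt h f'' N x) =
      charInt h (fun t => f'' t - P t * f t) N x - h₁ x 0 * f x := by
  have hPh : Continuous (Function.uncurry fun u v : ℝ => P (u + v) * h u v) :=
    (hP.comp continuous_add).mul hh
  have i : ∀ {g : ℝ → ℝ → ℂ} {k : ℝ → ℂ}, Continuous g.uncurry → Continuous k →
      IntervalIntegrable (fun v : ℝ => g (x + v) v * k (x + 2 * v)) volume 0 N := fun hg hk =>
    ((continuous_charInt_integrand hg hk).uncurry_left x).intervalIntegrable _ _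
  have hd : ∀ v, HasDerivAt (fun v => h₁ (x + v) v * f (x + 2 * v))
      ((h₁₁ (x + v) v * f (x + 2 * v) + 2 * (h₁ (x + v) v * f' (x + 2 * v))) +
        (P (x + v + v) * h (x + v) v) * f (x + 2 * v)) v := by
    intro v
    have h2 : HasDerivAt (fun v : ℝ => x + 2 * v) 2 v := by
      simpa using ((hasDerivAt_id v).const_mul 2).const_add x
    have h3 := (df (x + 2 * v)).scomp v h2
    have h4 := (hasDerivAt_comp_diagonal hh₁₁ hPh d dP x v).mul h3
    refine h4.congr_deriv ?_
    simp only [Function.comp, Complex.real_smul]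
    push_cast
    ring
  have hint : charInt h₁₁ f N x + 2 * charInt h₁ f' N x +
      charInt (fun u v => P (u + v) * h u v) f N x = -(h₁ x 0 * f x) := by
    have h5 := intervalIntegral.integral_eq_sub_of_hasDerivAt (a := 0) (b := N)
      (fun v _ => hd v) (((i hh₁₁ hf).add ((i hh₁ hf').const_mul 2)).add (i hPh hf))
    rw [intervalIntegral.integral_add ((i hh₁₁ hf).add ((i hh₁ hf').const_mul 2)) (i hPh hf),
      intervalIntegral.integral_add (i hh₁₁ hf) ((i hh₁ hf').const_mul 2),
      intervalIntegral.integral_const_mul, hx] at h5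
    simpa [charInt] using h5
  have hsub : charInt h (fun t => f'' t - P t * f t) N x =
      charInt h f'' N x - charInt (fun u v => P (u + v) * h u v) f N x := by
    simp only [charInt]
    rw [← intervalIntegral.integral_sub (i hh hf'') (i hPh hf)]
    refine intervalIntegral.integral_congr fun v _ => ?_
    simp only [show x + v + v = x + 2 * v by ring]
    ring
  rw [hsub]
  linear_combination hint

namespace GoursatKernel

variable {Q : ℝ → ℂ} (G : GoursatKernel Q)

/-- The reflected kernel `(u, v) ↦ g(-v, -u)`. -/
def refl (g : ℝ → ℝ → ℂ) (u v : ℝ) : ℂ := g (-v) (-u)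

lemma continuous_refl {g : ℝ → ℝ → ℂ} (hg : Continuous g.uncurry) :
    Continuous (refl g).uncurry := by
  have : Continuous fun p : ℝ × ℝ => g.uncurry (-p.2, -p.1) := by fun_prop
  exact this

/-- The operator `𝐓^□ φ - φ` for a Goursat kernel on the plane, written along characteristics. -/
noncomputable def charOp (N : ℝ) (φ : ℝ → ℂ) (x : ℝ) : ℂ :=
  2 * charInt G.H φ N x - 2 * charInt (refl G.H) (fun t => φ (-t)) N x

/-- The derivative of `G.charOp N φ`. -/
noncomputable def charOpDeriv (N : ℝ) (φ : ℝ → ℂ) (x : ℝ) : ℂ :=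
  2 * (charInt G.Hu φ N x + charInt G.H (deriv φ) N x) -
    2 * (charInt (fun u v => -refl G.Hv u v) (fun t => φ (-t)) N x +
      charInt (refl G.H) (fun t => -deriv φ (-t)) N x)

lemma continuous_neg_refl {g : ℝ → ℝ → ℂ} (hg : Continuous g.uncurry) :
    Continuous (Function.uncurry fun u v => -refl g u v) :=
  (continuous_refl hg).neg

lemma deriv_refl {g g' : ℝ → ℝ → ℂ} (h : ∀ u v, HasDerivAt (fun v => g u v) (g' u v) v) (u v : ℝ) :
    HasDerivAt (fun u => refl g u v) (-refl g' u v) u := by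
  have := (h (-v) (-u)).scomp u (hasDerivAt_neg u)
  simpa [Function.comp_def, refl] using this

lemma hasDerivAt_charOp {φ : ℝ → ℂ} (hφ : ContDiff ℝ ∞ φ) (N x : ℝ) :
    HasDerivAt (G.charOp N φ) (G.charOpDeriv N φ x) x := by
  have h1 : ContDiff ℝ ∞ (deriv φ) := (contDiff_infty_iff_deriv.1 hφ).2
  have d : ∀ t, HasDerivAt φ (deriv φ t) t := fun t =>
    (hφ.differentiable (by simp) t).hasDerivAt
  refine ((hasDerivAt_charInt G.continuous_H G.continuous_Hu hφ.continuous h1.continuous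
    G.deriv_u d N x).const_mul 2).sub ((hasDerivAt_charInt (continuous_refl G.continuous_H)
    (continuous_neg_refl G.continuous_Hv) (hφ.continuous.comp continuous_neg)
    (h1.continuous.comp continuous_neg).neg (deriv_refl G.deriv_v) (fun t => ?_) N x).const_mul 2)
  have := (d (-t)).scomp t (hasDerivAt_neg t)
  simpa [Function.comp_def] using this

/-- `charInt_second_deriv` is applied to `H` and to the reflected kernel, which solves the equation
for the potential `Q(-·)`. The boundary term of the first is `H_u(x, 0) φ(x) = Q(x) φ(x) / 2`,
doubled by the factor 2 in `charOp`; that of the second is zero since `H_v(0, ·) = 0`. -/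
lemma hasDerivAt_charOpDeriv (hQ : Continuous Q) {φ : ℝ → ℂ} (hφ : ContDiff ℝ ∞ φ) {N x : ℝ}
    (h₁ : φ (x + 2 * N) = 0) (h₂ : φ (-(x + 2 * N)) = 0) :
    HasDerivAt (G.charOpDeriv N φ)
      (G.charOp N (fun t => deriv (deriv φ) t - Q t * φ t) x - Q x * φ x) x := by
  have c1 : ContDiff ℝ ∞ (deriv φ) := (contDiff_infty_iff_deriv.1 hφ).2
  have c2 : ContDiff ℝ ∞ (deriv (deriv φ)) := (contDiff_infty_iff_deriv.1 c1).2
  have d0 : ∀ t, HasDerivAt φ (deriv φ t) t := fun t =>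
    (hφ.differentiable (by simp) t).hasDerivAt
  have d1 : ∀ t, HasDerivAt (deriv φ) (deriv (deriv φ) t) t := fun t =>
    (c1.differentiable (by simp) t).hasDerivAt
  have r0 : ∀ t, HasDerivAt (fun t => φ (-t)) (-deriv φ (-t)) t := fun t => by
    simpa [Function.comp_def] using (d0 (-t)).scomp t (hasDerivAt_neg t)
  have r1 : ∀ t, HasDerivAt (fun t => -deriv φ (-t)) (deriv (deriv φ) (-t)) t := fun t => by
    simpa [Function.comp_def] using ((d1 (-t)).scomp t (hasDerivAt_neg t)).fun_neg
  have k0 := hφ.continuous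
  have k1 := c1.continuous
  have k2 := c2.continuous
  have n0 : Continuous fun t => φ (-t) := k0.comp continuous_neg
  have n1 : Continuous fun t => -deriv φ (-t) := (k1.comp continuous_neg).neg
  have n2 : Continuous fun t => deriv (deriv φ) (-t) := k2.comp continuous_neg
  have m0 := continuous_refl G.continuous_H
  have m1 := (continuous_neg_refl G.continuous_Hv)
  have m2 := continuous_refl G.continuous_Hvv
  have dm : ∀ u v, HasDerivAt (fun u => -refl G.Hv u v) (refl G.Hvv u v) u := fun u v => by
    simpa using (deriv_refl G.deriv_vv u v).fun_neg
  have dmP : ∀ u v, HasDerivAt (fun v => -refl G.Hv u v) (Q (-(u + v)) * refl G.H u v) v :=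
    fun u v => by
      have := ((G.deriv_vu (-v) (-u)).scomp v (hasDerivAt_neg v)).fun_neg
      simpa [Function.comp_def, refl] using this
  have key := (((hasDerivAt_charInt G.continuous_Hu G.continuous_Huu k0 k1 G.deriv_uu d0 N x).add
    (hasDerivAt_charInt G.continuous_H G.continuous_Hu k1 k2 G.deriv_u d1 N x)).const_mul 2).sub
    (((hasDerivAt_charInt m1 m2 n0 n1 dm r0 N x).add
    (hasDerivAt_charInt m0 m1 n1 n2 (deriv_refl G.deriv_v) r1 N x)).const_mul 2)
  refine key.congr_deriv ?_
  have e1 := charInt_second_deriv hQ G.continuous_H G.continuous_Hu G.continuous_Huu k0 k1 k2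
    G.deriv_uu G.deriv_uv d0 N x h₁
  have e2 := charInt_second_deriv (P := fun t => Q (-t)) (hQ.comp continuous_neg) m0 m1 m2 n0 n1 n2
    dm dmP r0 N x h₂
  have e3 : refl G.Hv x 0 = 0 := by simp [refl, G.Hv_zero]
  rw [G.Hu_zero] at e1
  simp only [e3] at e2
  simp only [charOp]
  linear_combination 2 * e1 - 2 * e2

end GoursatKernel

/-! ### The Goursat problem on the open square -/

/-- Seen as an `ℓ¹` ball, the open square visibly contains, with each `(u, v)`, the whole rectangle
spanned by 0 and `(u, v)`, so the integral equation never leaves it. -/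
lemma abs_add_abs_lt_iff {u v a : ℝ} : |u| + |v| < a ↔ |u + v| < a ∧ |u - v| < a := by
  constructor
  · intro h
    exact ⟨(abs_add_le u v).trans_lt h, (abs_sub u v).trans_lt h⟩
  · rintro ⟨h₁, h₂⟩
    rw [abs_lt] at h₁ h₂
    rcases abs_cases u with ⟨hu, _⟩ | ⟨hu, _⟩ <;> rcases abs_cases v with ⟨hv, _⟩ | ⟨hv, _⟩ <;>
      rw [hu, hv] <;> linarith [h₁.1, h₁.2, h₂.1, h₂.2]

/-- A test function on `(-a, a)` which equals `1` on `[-b, b]`. -/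
lemma exists_test_eq_one {a b : ℝ} (hb : 0 < b) (hba : b < a) :
    ∃ χ : TestFun a, ∀ x, |x| ≤ b → χ x = 1 := by
  let B : ContDiffBump (0 : ℝ) := ⟨b, (a + b) / 2, hb, by linarith⟩
  refine ⟨⟨fun x => (B x : ℂ), Complex.ofRealCLM.contDiff.comp B.contDiff,
    B.hasCompactSupport.comp_left Complex.ofReal_zero, ?_⟩, fun x hx => ?_⟩
  · have hsub : Function.support (fun x => (B x : ℂ)) ⊆ Function.support B := fun x hx h =>
      hx (by simp [h])
    refine (closure_mono hsub).trans ?_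
    · rw [← tsupport, B.tsupport_eq, Real.closedBall_eq_Icc]
      intro x hx
      have h1 : B.rOut = (a + b) / 2 := rfl
      rw [h1] at hx
      exact ⟨by linarith [hx.1], by linarith [hx.2]⟩
  · have : B x = 1 := B.one_of_mem_closedBall (by simpa using hx)
    change ((B x : ℝ) : ℂ) = 1
    rw [this, Complex.ofReal_one]

lemma testMul_apply {a : ℝ} {q : ℝ → ℂ} (hq : ContDiffOn ℝ ∞ q (Ioo (-a) a)) (φ : TestFun a)
    (x : ℝ) : testMul a q hq φ x = q x * φ x := rfl

/-- On each interval `[-b, b]` the potential agrees with a test function, for which the Goursat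
problem is solvable in the plane. -/
lemma exists_goursatKernel {a b : ℝ} {q : ℝ → ℂ} (hq : ContDiffOn ℝ ∞ q (Ioo (-a) a))
    (hb : 0 < b) (hba : b < a) :
    ∃ Q : TestFun a, EqOn q Q (Icc (-b) b) ∧ Nonempty (GoursatKernel Q) := by
  obtain ⟨χ, hχ⟩ := exists_test_eq_one hb hba
  refine ⟨testMul a q hq χ, fun x hx => ?_, ?_⟩
  · rw [testMul_apply, hχ x (abs_le.2 hx), mul_one]
  · obtain ⟨M, hM⟩ := (testMul a q hq χ).hasCompactSupport.exists_bound_of_continuous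
      (testMul a q hq χ).continuous
    exact nonempty_goursatKernel ((testMul a q hq χ).contDiff.of_le (by simp)) hM

/-- Domain of dependence: on `|u| + |v| ≤ r` the solution sees the potential only on `[-r, r]`. -/
lemma GoursatKernel.eq_of_eqOn {Q₁ Q₂ : ℝ → ℂ} (G₁ : GoursatKernel Q₁) (G₂ : GoursatKernel Q₂)
    (hQ : Continuous Q₁) {r : ℝ} (h : EqOn Q₁ Q₂ (Icc (-r) r)) {u v : ℝ} (huv : |u| + |v| ≤ r) :
    G₁.H u v = G₂.H u v :=
  goursat_unique huv hQ.continuousOn h G₁.continuous_H.continuousOn G₂.continuous_H.continuousOn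
    (fun u v _ => G₁.goursat u v) (fun u v _ => G₂.goursat u v)

lemma IsGoursatSolution.eq_of_eqOn {a : ℝ} {q Q : ℝ → ℂ} {H : ℝ → ℝ → ℂ}
    (hH : IsGoursatSolution a q H) (G : GoursatKernel Q) (hQ : Continuous Q) {r : ℝ} (hr : r < a)
    (h : EqOn q Q (Icc (-r) r)) {u v : ℝ} (huv : |u| + |v| ≤ r) :
    H u v = G.H u v :=
  (goursat_unique huv hQ.continuousOn h.symm G.continuous_H.continuousOn
    (hH.1.mono fun _ hp => abs_add_abs_lt_iff.1 (lt_of_le_of_lt hp hr))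
    (fun u v _ => G.goursat u v)
    (fun u v huv => hH.2 u v (abs_add_abs_lt_iff.1 (huv.trans_lt hr)).1
      (abs_add_abs_lt_iff.1 (huv.trans_lt hr)).2)).symm

lemma IsGoursatSolution.eq_of_isGoursatSolution {a : ℝ} {q : ℝ → ℂ} {H₁ H₂ : ℝ → ℝ → ℂ}
    (hq : ContinuousOn q (Ioo (-a) a)) (h₁ : IsGoursatSolution a q H₁)
    (h₂ : IsGoursatSolution a q H₂) {u v : ℝ} (huv : |u| + |v| < a) : H₁ u v = H₂ u v :=
  goursat_unique le_rfl
    (hq.mono fun x hx => ⟨by linarith [hx.1], lt_of_le_of_lt hx.2 huv⟩) (eqOn_refl _ _)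
    (h₁.1.mono fun p hp => abs_add_abs_lt_iff.1 (lt_of_le_of_lt hp huv))
    (h₂.1.mono fun p hp => abs_add_abs_lt_iff.1 (lt_of_le_of_lt hp huv))
    (fun u' v' h => h₁.2 u' v' (abs_add_abs_lt_iff.1 (h.trans_lt huv)).1
      (abs_add_abs_lt_iff.1 (h.trans_lt huv)).2)
    (fun u' v' h => h₂.2 u' v' (abs_add_abs_lt_iff.1 (h.trans_lt huv)).1
      (abs_add_abs_lt_iff.1 (h.trans_lt huv)).2)

/-- The plane solutions for potentials that agree with `q` on growing intervals are glued; they are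
compatible by the domain of dependence. The radius `(r + a) / 2` is positive, below `a` and above
`r`, which leaves room for a neighbourhood in the proof of continuity. -/
lemma exists_isGoursatSolution {a : ℝ} (ha : 0 < a) {q : ℝ → ℂ}
    (hq : ContDiffOn ℝ ∞ q (Ioo (-a) a)) : ∃ H, IsGoursatSolution a q H := by
  have hex : ∀ r : Ico 0 a, ∃ Q : TestFun a,
      EqOn q Q (Icc (-((r + a) / 2)) ((r + a) / 2)) ∧ Nonempty (GoursatKernel Q) := fun r =>
    exists_goursatKernel hq (by linarith [r.2.1]) (by linarith [r.2.2])
  choose Q hQ G using hex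
  replace G := fun r => (G r).some
  let H : ℝ → ℝ → ℂ := fun u v =>
    if h : |u| + |v| < a then (G ⟨|u| + |v|, by positivity, h⟩).H u v else 0
  have key : ∀ (r : Ico 0 a) (u v : ℝ), |u| + |v| ≤ (r + a) / 2 → H u v = (G r).H u v := by
    intro r u v huv
    have h : |u| + |v| < a := by linarith [r.2.2]
    simp only [H, dif_pos h]
    refine (G _).eq_of_eqOn (G r) (Q _).continuous (r := |u| + |v|) (fun x hx => ?_) le_rfl
    rw [← hQ r ⟨by linarith [hx.1], by linarith [hx.2]⟩, ← hQ ⟨|u| + |v|, by positivity, h⟩]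
    exact ⟨by linarith [hx.1], by linarith [hx.2]⟩
  refine ⟨H, fun p hp => ?_, fun u v h₁ h₂ => ?_⟩
  · have h : |p.1| + |p.2| < a := abs_add_abs_lt_iff.2 hp
    let r : Ico 0 a := ⟨|p.1| + |p.2|, by positivity, h⟩
    refine ContinuousAt.continuousWithinAt ?_
    refine (G r).continuous_H.continuousAt.congr ?_
    have hopen : IsOpen {p : ℝ × ℝ | |p.1| + |p.2| < (r + a) / 2} :=
      isOpen_lt (by fun_prop) continuous_const
    filter_upwards [hopen.mem_nhds (show |p.1| + |p.2| < (|p.1| + |p.2| + a) / 2 by linarith)]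
      with x hx
    exact (key r x.1 x.2 (le_of_lt hx)).symm
  · have h : |u| + |v| < a := abs_add_abs_lt_iff.2 ⟨h₁, h₂⟩
    let r : Ico 0 a := ⟨|u| + |v|, by positivity, h⟩
    have habs : ∀ y x : ℝ, x ∈ uIcc 0 y → |x| ≤ |y| := fun y x hx => by
      simpa using abs_sub_left_of_mem_uIcc hx
    have hr : |u| + |v| ≤ (r + a) / 2 := by
      change |u| + |v| ≤ (|u| + |v| + a) / 2
      linarith
    rw [key r u v hr, (G r).goursat]
    congr 1
    · congr 1
      refine intervalIntegral.integral_congr fun s hs => (hQ r (abs_le.1 ?_)).symm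
      linarith [habs _ _ hs, abs_nonneg v]
    · refine intervalIntegral.integral_congr fun α hα => ?_
      refine intervalIntegral.integral_congr fun β hβ => ?_
      have h3 : |α| + |β| ≤ (r + a) / 2 := (add_le_add (habs _ _ hα) (habs _ _ hβ)).trans hr
      rw [key r α β h3, hQ r (abs_le.1 ((abs_add_le _ _).trans h3))]

/-! ### The transposed Volterra operator -/

lemma volterraTranspose_eq_zero {a b : ℝ} (hb : b < a) (K : ℝ → ℝ → ℂ) {φ : ℝ → ℂ}
    (hφ : ∀ x, b < |x| → φ x = 0) {x : ℝ} (hx : b < |x|) : volterraTranspose a K φ x = 0 := by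
  have h1 : ∫ t in (-a)..(-|x|), K t x * φ t = 0 := by
    rw [intervalIntegral.integral_congr (g := fun _ => (0 : ℂ)), intervalIntegral.integral_zero]
    intro t ht
    have h2 : t ≤ max (-a) (-|x|) := ht.2
    have h3 : max (-a) (-|x|) < -b := max_lt (by linarith) (by linarith)
    simp [hφ t (lt_of_lt_of_le (by linarith) (neg_le_abs t))]
  have h2 : ∫ t in |x|..a, K t x * φ t = 0 := by
    rw [intervalIntegral.integral_congr (g := fun _ => (0 : ℂ)), intervalIntegral.integral_zero]
    intro t ht
    have h2 : min |x| a ≤ t := ht.1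
    have h3 : b < min |x| a := lt_min hx hb
    simp [hφ t (lt_of_lt_of_le (by linarith) (le_abs_self t))]
  rw [volterraTranspose, h1, h2, hφ x hx]
  simp

/-- The two triangles over which `𝐓^□` integrates, without absolute values. -/
lemma integral_sub_integral_abs {f : ℝ → ℂ} (hf : Continuous f) (a x : ℝ) :
    (∫ t in |x|..a, f t) - ∫ t in (-a)..(-|x|), f t =
      (∫ t in x..a, f t) - ∫ t in (-a)..(-x), f t := by
  rcases le_total 0 x with hx | hx
  · rw [abs_of_nonneg hx]
  · rw [abs_of_nonpos hx, neg_neg]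
    have i : ∀ s t, IntervalIntegrable f volume s t := fun s t => hf.intervalIntegrable s t
    rw [← intervalIntegral.integral_add_adjacent_intervals (i x (-x)) (i (-x) a),
      ← intervalIntegral.integral_add_adjacent_intervals (i (-a) x) (i x (-x))]
    ring

lemma IsGoursatSolution.kernelOf_eq {a b : ℝ} {q Q : ℝ → ℂ} {H : ℝ → ℝ → ℂ} (hb : b < a)
    (hH : IsGoursatSolution a q H) (G : GoursatKernel Q) (hQ : Continuous Q)
    (hqQ : EqOn q Q (Icc (-b) b)) {x t : ℝ} (hx : |x| ≤ b) (ht : |t| ≤ b) :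
    kernelOf H x t = kernelOf G.H x t := by
  rw [kernelOf, kernelOf, hH.eq_of_eqOn G hQ hb hqQ]
  rw [abs_le] at hx ht
  rcases abs_cases ((x + t) / 2) with ⟨hu, _⟩ | ⟨hu, _⟩ <;>
  rcases abs_cases ((x - t) / 2) with ⟨hv, _⟩ | ⟨hv, _⟩ <;> rw [hu, hv] <;>
    linarith [ht.1, ht.2, hx.1, hx.2]

/-- Only `|t| ≤ b` matters, where `H` may be replaced by the plane kernel. That kernel is continuous
everywhere, so the absolute values in the limits can be dropped. -/
lemma volterraTranspose_eq_triangles {a b : ℝ} {q Q : ℝ → ℂ} {H : ℝ → ℝ → ℂ} (hb : b < a)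
    (hH : IsGoursatSolution a q H) (G : GoursatKernel Q) (hQ : Continuous Q)
    (hqQ : EqOn q Q (Icc (-b) b)) {φ : ℝ → ℂ} (hφc : Continuous φ)
    (hφ : ∀ x, b < |x| → φ x = 0) {x : ℝ} (hx : |x| ≤ b) :
    volterraTranspose a (kernelOf H) φ x = φ x +
      ((∫ t in x..a, kernelOf G.H t x * φ t) - ∫ t in (-a)..(-x), kernelOf G.H t x * φ t) := by
  have hc : Continuous fun t => kernelOf G.H t x * φ t := by
    have := G.continuous_H
    have h1 : Continuous fun t : ℝ => G.H.uncurry ((t + x) / 2, (t - x) / 2) * φ t := by fun_prop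
    exact h1
  have hK : ∀ t, kernelOf H t x * φ t = kernelOf G.H t x * φ t := by
    intro t
    by_cases ht : b < |t|
    · simp [hφ t ht]
    · rw [hH.kernelOf_eq hb G hQ hqQ (not_lt.1 ht) hx]
  rw [volterraTranspose, ← integral_sub_integral_abs hc]
  simp only [hK]
  ring

/-- The substitution `t = x + 2v` turns `K(t, x)` into `H(x + v, v)`, and `t = -(x + 2v)` turns it
into `H(-v, -(x + v))`; `dt = 2 dv` accounts for the factors 2. The limit `v = a` reaches beyond the
support since `x + 2a ≥ a`. The gain is that the limits no longer depend on `x`. -/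
lemma volterraTranspose_eq_charOp {a b : ℝ} {q Q : ℝ → ℂ} {H : ℝ → ℝ → ℂ} (hb : b < a)
    (hH : IsGoursatSolution a q H) (G : GoursatKernel Q) (hQ : Continuous Q)
    (hqQ : EqOn q Q (Icc (-b) b)) {φ : ℝ → ℂ} (hφc : Continuous φ)
    (hφ : ∀ x, b < |x| → φ x = 0) {x : ℝ} (hx : |x| ≤ b) :
    volterraTranspose a (kernelOf H) φ x = φ x + G.charOp a φ x := by
  rw [volterraTranspose_eq_triangles hb hH G hQ hqQ hφc hφ hx]
  set f : ℝ → ℂ := fun t => kernelOf G.H t x * φ t with hf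
  have hc : Continuous f := by
    have := G.continuous_H
    have h1 : Continuous fun t : ℝ => G.H.uncurry ((t + x) / 2, (t - x) / 2) * φ t := by fun_prop
    exact h1
  have i : ∀ s t, IntervalIntegrable f volume s t := fun s t => hc.intervalIntegrable s t
  rw [abs_le] at hx
  have e1 : 2 * charInt G.H φ a x = ∫ t in x..a, f t := by
    have h1 : charInt G.H φ a x = ∫ v in (0 : ℝ)..a, f (x + 2 * v) := by
      refine intervalIntegral.integral_congr fun v _ => ?_
      simp only [hf, kernelOf]
      congr 2 <;> ring
    have h2 : ∫ t in a..(x + 2 * a), f t = 0 := by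
      rw [intervalIntegral.integral_congr (g := fun _ => (0 : ℂ)), intervalIntegral.integral_zero]
      intro t ht
      rw [uIcc_of_le (by linarith)] at ht
      simp [hf, hφ t (lt_of_lt_of_le (by linarith [ht.1]) (le_abs_self t))]
    rw [h1, intervalIntegral.integral_comp_add_mul _ two_ne_zero, mul_zero, add_zero,
      ← intervalIntegral.integral_add_adjacent_intervals (i x a) (i a _), h2, add_zero,
      Complex.real_smul]
    push_cast
    rw [mul_inv_cancel_left₀ two_ne_zero]
  have e2 : 2 * charInt (GoursatKernel.refl G.H) (fun t => φ (-t)) a x =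
      ∫ t in (-a)..(-x), f t := by
    have h1 : charInt (GoursatKernel.refl G.H) (fun t => φ (-t)) a x =
        ∫ v in (0 : ℝ)..a, (fun t => f (-t)) (x + 2 * v) := by
      refine intervalIntegral.integral_congr fun v _ => ?_
      simp only [hf, kernelOf, GoursatKernel.refl]
      congr 2 <;> ring
    have h2 : ∫ t in (-(x + 2 * a))..(-a), f t = 0 := by
      rw [intervalIntegral.integral_congr (g := fun _ => (0 : ℂ)), intervalIntegral.integral_zero]
      intro t ht
      rw [uIcc_of_le (by linarith)] at ht
      simp [hf, hφ t (lt_of_lt_of_le (by linarith [ht.2]) (neg_le_abs t))]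
    rw [h1, intervalIntegral.integral_comp_add_mul (fun t => f (-t)) two_ne_zero, mul_zero,
      add_zero, intervalIntegral.integral_comp_neg,
      ← intervalIntegral.integral_add_adjacent_intervals (i _ (-a)) (i (-a) (-x)), h2, zero_add,
      Complex.real_smul]
    push_cast
    rw [mul_inv_cancel_left₀ two_ne_zero]
  rw [GoursatKernel.charOp, e1, e2]

/-! ### Additivity and bounds of the characteristic integrals. -/

lemma charInt_add {h : ℝ → ℝ → ℂ} {f g : ℝ → ℂ} (hh : Continuous h.uncurry) (hf : Continuous f)
    (hg : Continuous g) (N x : ℝ) :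
    charInt h (fun t => f t + g t) N x = charInt h f N x + charInt h g N x := by
  simp only [charInt, mul_add]
  exact intervalIntegral.integral_add
    (((continuous_charInt_integrand hh hf).uncurry_left x).intervalIntegrable _ _)
    (((continuous_charInt_integrand hh hg).uncurry_left x).intervalIntegrable _ _)

lemma exists_bound_charInt {h : ℝ → ℝ → ℂ} (hh : Continuous h.uncurry) (N r : ℝ) :
    ∃ C : ℝ, 0 ≤ C ∧ ∀ (f : ℝ → ℂ) (M : ℝ), (∀ t, ‖f t‖ ≤ M) → ∀ x, |x| ≤ r →
      ‖charInt h f N x‖ ≤ C * M := by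
  have hc : Continuous fun p : ℝ × ℝ => h.uncurry (p.1 + p.2, p.2) := by fun_prop
  obtain ⟨B, hB⟩ := ((isCompact_Icc (a := -r) (b := r)).prod
    (isCompact_uIcc (a := (0 : ℝ)) (b := N))).exists_bound_of_continuousOn hc.continuousOn
  refine ⟨|B| * |N|, by positivity, fun f M hM x hx => ?_⟩
  have hM0 : 0 ≤ M := (norm_nonneg _).trans (hM 0)
  have := intervalIntegral.norm_integral_le_of_norm_le_const (a := 0) (b := N) (C := |B| * M)
    (f := fun v => h (x + v) v * f (x + 2 * v)) fun v hv => by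
      rw [norm_mul]
      exact mul_le_mul ((hB (x, v) ⟨abs_le.1 hx, uIoc_subset_uIcc hv⟩).trans (le_abs_self _))
        (hM _) (norm_nonneg _) (abs_nonneg _)
  rw [sub_zero] at this
  exact this.trans_eq (by ring)

noncomputable section

/-! ### The Schrödinger operator on test functions -/

/-- Differentiation of test functions. -/
def testDeriv (a : ℝ) : TestFun a →L[ℂ] TestFun a := TestFunction.lineDerivCLM ℂ (1 : ℝ)

lemma testDeriv_apply {a : ℝ} (φ : TestFun a) (x : ℝ) : testDeriv a φ x = deriv φ x := by
  rw [testDeriv, TestFunction.lineDerivCLM_apply_of_le (by simp), lineDeriv]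
  simpa using deriv_comp_const_add (f := φ) x 0

lemma coe_testDeriv {a : ℝ} (φ : TestFun a) : ⇑(testDeriv a φ) = deriv φ :=
  funext (testDeriv_apply φ)

lemma hasDerivAt_test {a : ℝ} (φ : TestFun a) (x : ℝ) : HasDerivAt φ (testDeriv a φ x) x := by
  rw [testDeriv_apply]
  exact (φ.contDiff.differentiable (by simp) x).hasDerivAt

/-- The Schrödinger operator `φ ↦ φ'' - q φ` on test functions. -/
def testSchrodinger (a : ℝ) (q : ℝ → ℂ) (hq : ContDiffOn ℝ ∞ q (Ioo (-a) a)) :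
    TestFun a →L[ℂ] TestFun a :=
  testDeriv a ∘L testDeriv a - testMul a q hq

lemma testSchrodinger_apply {a : ℝ} {q : ℝ → ℂ} (hq : ContDiffOn ℝ ∞ q (Ioo (-a) a))
    (φ : TestFun a) (x : ℝ) :
    testSchrodinger a q hq φ x = deriv (deriv φ) x - q x * φ x := by
  change testDeriv a (testDeriv a φ) x - testMul a q hq φ x = _
  rw [testDeriv_apply, coe_testDeriv, testMul_apply]

lemma deriv_eq_zero_of_forall_lt {b : ℝ} {f : ℝ → ℂ} (hf : ∀ x, b < |x| → f x = 0) :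
    ∀ x, b < |x| → deriv f x = 0 := by
  intro x hx
  have h : f =ᶠ[𝓝 x] fun _ => (0 : ℂ) := by
    filter_upwards [(isOpen_lt continuous_const continuous_abs).mem_nhds hx] with y hy
    exact hf y hy
  rw [h.deriv_eq, deriv_const]

lemma testSchrodinger_eq_zero {a b : ℝ} {q : ℝ → ℂ} (hq : ContDiffOn ℝ ∞ q (Ioo (-a) a))
    {φ : TestFun a} (hφ : ∀ x, b < |x| → φ x = 0) :
    ∀ x, b < |x| → testSchrodinger a q hq φ x = 0 := by
  intro x hx
  rw [testSchrodinger_apply, hφ x hx,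
    deriv_eq_zero_of_forall_lt (deriv_eq_zero_of_forall_lt hφ) x hx]
  simp

/-- On functions supported in `[-b, b]` the potential can be replaced by a test function, all of
whose derivatives are bounded; Leibniz' rule does the rest. -/
lemma testSchrodinger_bound {a b : ℝ} {q : ℝ → ℂ} (hq : ContDiffOn ℝ ∞ q (Ioo (-a) a))
    (hb : b < a) (hb0 : 0 < b) (i : ℕ) :
    ∃ C : ℝ, 0 ≤ C ∧ ∀ φ : TestFun a, (∀ x, b < |x| → φ x = 0) → ∀ M : ℝ,
      (∀ j ≤ i + 2, ∀ x, ‖iteratedDeriv j φ x‖ ≤ M) →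
      ∀ j ≤ i, ∀ x, ‖iteratedDeriv j (testSchrodinger a q hq φ) x‖ ≤ C * M := by
  obtain ⟨Q, hqQ, -⟩ := exists_goursatKernel hq hb0 hb
  have hB : ∀ j : ℕ, ∃ B : ℝ, ∀ x, ‖iteratedDeriv j Q x‖ ≤ B := by
    intro j
    obtain ⟨B, hB⟩ := (Q.hasCompactSupport.iteratedFDeriv (𝕜 := ℝ) j).exists_bound_of_continuous
      (Q.contDiff.continuous_iteratedFDeriv (by exact_mod_cast le_top))
    exact ⟨B, fun x => by rw [← norm_iteratedFDeriv_eq_norm_iteratedDeriv]; exact hB x⟩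
  choose B hB using hB
  have hS : ∀ φ : TestFun a, (∀ x, b < |x| → φ x = 0) →
      ⇑(testSchrodinger a q hq φ) = deriv (deriv φ) - fun x => Q x * φ x := by
    intro φ hφ
    ext x
    rw [testSchrodinger_apply, Pi.sub_apply]
    by_cases hx : b < |x|
    · simp [hφ x hx]
    · rw [hqQ (abs_le.1 (not_lt.1 hx))]
  have hone : ∀ j : ℕ, 0 ≤ ∑ k ∈ Finset.range (j + 1), (j.choose k : ℝ) * |B k| := fun j =>
    Finset.sum_nonneg fun k _ => by positivity
  refine ⟨∑ j ∈ Finset.range (i + 1),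
    (1 + ∑ k ∈ Finset.range (j + 1), (j.choose k : ℝ) * |B k|),
    Finset.sum_nonneg fun j _ => add_nonneg zero_le_one (hone j), fun φ hφ M hM j hj x => ?_⟩
  have hM0 : 0 ≤ M := (norm_nonneg _).trans (hM 0 (Nat.zero_le _) 0)
  have hφ' : ContDiff ℝ ∞ (deriv (deriv φ)) := by
    rw [← coe_testDeriv, ← coe_testDeriv]
    exact (testDeriv a (testDeriv a φ)).contDiff
  have hle : (j : ℕ∞ω) ≤ ∞ := by exact_mod_cast le_top
  have h1 : ‖iteratedDeriv j (deriv (deriv φ)) x‖ ≤ M := by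
    rw [← iteratedDeriv_succ', ← iteratedDeriv_succ']
    exact hM (j + 2) (by omega) x
  have h2 : ‖iteratedDeriv j (fun x => Q x * φ x) x‖ ≤
      (∑ k ∈ Finset.range (j + 1), (j.choose k : ℝ) * |B k|) * M := by
    rw [← norm_iteratedFDeriv_eq_norm_iteratedDeriv, Finset.sum_mul]
    refine (norm_iteratedFDeriv_mul_le (N := ∞) Q.contDiff φ.contDiff x hle).trans ?_
    refine Finset.sum_le_sum fun k hk => ?_
    rw [norm_iteratedFDeriv_eq_norm_iteratedDeriv, norm_iteratedFDeriv_eq_norm_iteratedDeriv]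
    have h3 := (hB k x).trans (le_abs_self _)
    have h4 := hM (j - k) (by omega) x
    gcongr
  rw [hS φ hφ, iteratedDeriv_sub (hφ'.of_le hle).contDiffAt
    ((Q.contDiff.mul φ.contDiff).of_le hle).contDiffAt]
  refine (norm_sub_le _ _).trans ?_
  have h5 : 1 + ∑ k ∈ Finset.range (j + 1), (j.choose k : ℝ) * |B k| ≤
      ∑ j ∈ Finset.range (i + 1), (1 + ∑ k ∈ Finset.range (j + 1), (j.choose k : ℝ) * |B k|) :=
    Finset.single_le_sum (f := fun j => 1 + ∑ k ∈ Finset.range (j + 1), (j.choose k : ℝ) * |B k|)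
      (fun j _ => add_nonneg zero_le_one (hone j)) (Finset.mem_range.2 (by omega))
  refine le_trans ?_ (mul_le_mul_of_nonneg_right h5 hM0)
  rw [add_mul, one_mul]
  exact add_le_add h1 h2

/-! ### The transposed Volterra operator on test functions -/

section VolterraTest

variable {a : ℝ} {q : ℝ → ℂ} {H : ℝ → ℝ → ℂ}

lemma hasDerivAt_volterraTranspose {c : ℝ} (hH : IsGoursatSolution a q H) (hc : c < a)
    {Q : TestFun a} (hqQ : EqOn q Q (Icc (-c) c)) (G : GoursatKernel Q) {φ : TestFun a}
    (hφ : ∀ x, c < |x| → φ x = 0) {x : ℝ} (hx : |x| < c) :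
    HasDerivAt (volterraTranspose a (kernelOf H) φ) (deriv φ x + G.charOpDeriv a φ x) x := by
  have h1 : HasDerivAt (fun x => φ x + G.charOp a φ x) (deriv φ x + G.charOpDeriv a φ x) x :=
    (φ.contDiff.differentiable (by simp) x).hasDerivAt.add (G.hasDerivAt_charOp φ.contDiff a x)
  refine h1.congr_of_eventuallyEq ?_
  filter_upwards [(isOpen_lt continuous_abs continuous_const).mem_nhds hx] with y hy
  exact volterraTranspose_eq_charOp hc hH G Q.continuous hqQ φ.continuous hφ (le_of_lt hy)

/-- This is the transposed intertwining relation. Off the support bound both sides vanish; elsewhere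
a plane kernel represents `𝐓^□ φ` near the point and `GoursatKernel.hasDerivAt_charOpDeriv` applies,
its term `-Q φ` completing `φ''` to `φ'' - q φ`. -/
lemma hasDerivAt_deriv_volterraTranspose (hH : IsGoursatSolution a q H)
    (hq : ContDiffOn ℝ ∞ q (Ioo (-a) a)) (φ : TestFun a) (x : ℝ) :
    DifferentiableAt ℝ (volterraTranspose a (kernelOf H) φ) x ∧
    HasDerivAt (deriv (volterraTranspose a (kernelOf H) φ))
      (volterraTranspose a (kernelOf H) (testSchrodinger a q hq φ) x) x := by
  obtain ⟨b, hb, hφ⟩ := exists_bound_of_test φ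
  by_cases hx : b < |x|
  · have h0 : ∀ y, b < |y| → volterraTranspose a (kernelOf H) φ y = 0 := fun y hy =>
      volterraTranspose_eq_zero hb _ hφ hy
    have hev : ∀ {f : ℝ → ℂ}, (∀ y, b < |y| → f y = 0) → f =ᶠ[𝓝 x] fun _ => (0 : ℂ) := by
      intro f hf
      filter_upwards [(isOpen_lt continuous_const continuous_abs).mem_nhds hx] with y hy
      exact hf y hy
    refine ⟨(differentiableAt_const (0 : ℂ)).congr_of_eventuallyEq (hev h0), ?_⟩
    rw [volterraTranspose_eq_zero hb _ (testSchrodinger_eq_zero hq hφ) hx]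
    exact (hasDerivAt_const x (0 : ℂ)).congr_of_eventuallyEq
      (hev (deriv_eq_zero_of_forall_lt h0))
  · have hxa : |x| < a := (not_lt.1 hx).trans_lt hb
    -- With `|x| < c` strictly, the formula with the plane kernel holds in a neighbourhood of `x`
    -- and can be differentiated.
    obtain ⟨c, hcb, hca⟩ := exists_between (max_lt hb hxa)
    have hbc : b < c := (le_max_left _ _).trans_lt hcb
    have hxc : |x| < c := (le_max_right _ _).trans_lt hcb
    have hφc : ∀ x, c < |x| → φ x = 0 := fun x hx => hφ x (hbc.trans hx)
    obtain ⟨Q, hqQ, ⟨G⟩⟩ := exists_goursatKernel hq ((abs_nonneg x).trans_lt hxc) hca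
    refine ⟨(hasDerivAt_volterraTranspose hH hca hqQ G hφc hxc).differentiableAt, ?_⟩
    have hev : deriv (volterraTranspose a (kernelOf H) φ) =ᶠ[𝓝 x]
        fun y => deriv φ y + G.charOpDeriv a φ y := by
      filter_upwards [(isOpen_lt continuous_abs continuous_const).mem_nhds hxc] with y hy
      exact (hasDerivAt_volterraTranspose hH hca hqQ G hφc hy).deriv
    have hxc' := abs_lt.1 hxc
    have hz : c < |x + 2 * a| := lt_of_lt_of_le (by linarith) (le_abs_self _)
    have h1 := G.hasDerivAt_charOpDeriv Q.continuous φ.contDiff (N := a) (x := x)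
      (hφc _ hz) (hφc _ (by rwa [abs_neg]))
    have h2 : HasDerivAt (deriv φ) (deriv (deriv φ) x) x := by
      have := hasDerivAt_test (testDeriv a φ) x
      rwa [testDeriv_apply, coe_testDeriv] at this
    have hS : ⇑(testSchrodinger a q hq φ) = fun t => deriv (deriv φ) t - Q t * φ t := by
      ext t
      rw [testSchrodinger_apply]
      by_cases ht : c < |t|
      · simp [hφc t ht]
      · rw [hqQ (abs_le.1 (not_lt.1 ht))]
    refine ((h2.add h1).congr_of_eventuallyEq hev).congr_deriv ?_
    rw [volterraTranspose_eq_charOp hca hH G Q.continuous hqQ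
      (testSchrodinger a q hq φ).continuous
      (fun x hx => testSchrodinger_eq_zero hq hφc x hx) hxc.le, hS]
    ring

/-- The second derivative of `𝐓^□ φ` is again `𝐓^□` of a test function, so the order of smoothness
rises by two per step. -/
lemma contDiff_volterraTranspose (hH : IsGoursatSolution a q H)
    (hq : ContDiffOn ℝ ∞ q (Ioo (-a) a)) (φ : TestFun a) :
    ContDiff ℝ ∞ (volterraTranspose a (kernelOf H) φ) := by
  have hd : ∀ φ : TestFun a, Differentiable ℝ (volterraTranspose a (kernelOf H) φ) := fun φ x =>
    (hasDerivAt_deriv_volterraTranspose hH hq φ x).1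
  have hd' : ∀ φ : TestFun a, Differentiable ℝ (deriv (volterraTranspose a (kernelOf H) φ)) :=
    fun φ x => (hasDerivAt_deriv_volterraTranspose hH hq φ x).2.differentiableAt
  rw [contDiff_infty]
  intro n
  induction n using Nat.twoStepInduction generalizing φ with
  | zero => exact contDiff_zero.2 (hd φ).continuous
  | one => exact contDiff_one_iff_deriv.2 ⟨hd φ, (hd' φ).continuous⟩
  | more n ih _ =>
    have e : ((n + 2 : ℕ) : ℕ∞ω) = (n : ℕ∞ω) + 1 + 1 := by push_cast; ring
    rw [e, contDiff_succ_iff_deriv, contDiff_succ_iff_deriv]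
    refine ⟨hd φ, by simp, hd' φ, by simp, ?_⟩
    rw [funext fun x => (hasDerivAt_deriv_volterraTranspose hH hq φ x).2.deriv]
    exact ih _

/-- Orders 0 and 1, the two starting cases of the induction for all seminorms. -/
lemma exists_bound_volterraTranspose (hH : IsGoursatSolution a q H)
    (hq : ContDiffOn ℝ ∞ q (Ioo (-a) a)) {b : ℝ} (hb : b < a) (hb0 : 0 < b) :
    ∃ C : ℝ, 0 ≤ C ∧ ∀ φ : TestFun a, (∀ x, b < |x| → φ x = 0) → ∀ M : ℝ, (∀ x, ‖φ x‖ ≤ M) →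
      (∀ x, ‖volterraTranspose a (kernelOf H) φ x‖ ≤ C * M) ∧
      ((∀ x, ‖deriv φ x‖ ≤ M) → ∀ x, ‖deriv (volterraTranspose a (kernelOf H) φ) x‖ ≤ C * M) := by
  obtain ⟨c, hbc, hca⟩ := exists_between hb
  obtain ⟨Q, hqQ, ⟨G⟩⟩ := exists_goursatKernel hq (hb0.trans hbc) hca
  obtain ⟨C₁, hC₁, h₁⟩ := exists_bound_charInt G.continuous_H a b
  obtain ⟨C₂, hC₂, h₂⟩ := exists_bound_charInt (GoursatKernel.continuous_refl G.continuous_H) a b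
  obtain ⟨C₃, hC₃, h₃⟩ := exists_bound_charInt G.continuous_Hu a b
  obtain ⟨C₄, hC₄, h₄⟩ := exists_bound_charInt
    (GoursatKernel.continuous_neg_refl G.continuous_Hv) a b
  refine ⟨1 + 2 * (C₁ + C₂ + C₃ + C₄), by positivity, fun φ hφ M hM => ?_⟩
  have hM0 : 0 ≤ M := (norm_nonneg _).trans (hM 0)
  have hφc : ∀ x, c < |x| → φ x = 0 := fun x hx => hφ x (hbc.trans hx)
  have hn : ‖(2 : ℂ)‖ = 2 := by simp
  have m₁ := mul_nonneg hC₁ hM0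
  have m₂ := mul_nonneg hC₂ hM0
  have m₃ := mul_nonneg hC₃ hM0
  have m₄ := mul_nonneg hC₄ hM0
  have hz : ∀ x, b < |x| → volterraTranspose a (kernelOf H) φ x = 0 := fun x hx =>
    volterraTranspose_eq_zero hb _ hφ hx
  constructor
  · intro x
    by_cases hx : b < |x|
    · rw [hz x hx, norm_zero]
      positivity
    · rw [not_lt] at hx
      rw [volterraTranspose_eq_charOp hca hH G Q.continuous hqQ φ.continuous hφc (hx.trans hbc.le),
        GoursatKernel.charOp]
      have e1 := h₁ φ M hM x hx
      have e2 := h₂ (fun t => φ (-t)) M (fun t => hM _) x hx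
      refine (norm_add_le _ _).trans ?_
      have e3 := norm_sub_le (2 * charInt G.H φ a x)
        (2 * charInt (GoursatKernel.refl G.H) (fun t => φ (-t)) a x)
      rw [norm_mul, norm_mul, hn] at e3
      linarith [hM x]
  · intro hM' x
    by_cases hx : b < |x|
    · rw [deriv_eq_zero_of_forall_lt hz x hx, norm_zero]
      positivity
    · rw [not_lt] at hx
      rw [(hasDerivAt_volterraTranspose hH hca hqQ G hφc (hx.trans_lt hbc)).deriv,
        GoursatKernel.charOpDeriv]
      have e1 := h₃ φ M hM x hx
      have e2 := h₁ (deriv φ) M hM' x hx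
      have e3 := h₄ (fun t => φ (-t)) M (fun t => hM _) x hx
      have e4 := h₂ (fun t => -deriv φ (-t)) M (fun t => by rw [norm_neg]; exact hM' _) x hx
      refine (norm_add_le _ _).trans ?_
      refine (add_le_add (hM' x) (norm_sub_le _ _)).trans ?_
      rw [norm_mul, norm_mul, hn]
      have e5 := norm_add_le (charInt G.Hu φ a x) (charInt G.H (deriv φ) a x)
      have e6 := norm_add_le (charInt (fun u v => -GoursatKernel.refl G.Hv u v) (fun t => φ (-t)) a x)
        (charInt (GoursatKernel.refl G.H) (fun t => -deriv φ (-t)) a x)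
      linarith

/-- Two derivatives of `𝐓^□ φ` are exchanged for `φ'' - q φ`, whose derivatives up to order `i` are
controlled by those of `φ` up to order `i + 2`. -/
lemma exists_bound_iteratedDeriv_volterraTranspose (hH : IsGoursatSolution a q H)
    (hq : ContDiffOn ℝ ∞ q (Ioo (-a) a)) {b : ℝ} (hb : b < a) (hb0 : 0 < b) (i : ℕ) :
    ∃ C : ℝ, 0 ≤ C ∧ ∀ φ : TestFun a, (∀ x, b < |x| → φ x = 0) → ∀ M : ℝ,
      (∀ j ≤ i, ∀ x, ‖iteratedDeriv j φ x‖ ≤ M) →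
      ∀ x, ‖iteratedDeriv i (volterraTranspose a (kernelOf H) φ) x‖ ≤ C * M := by
  induction i using Nat.twoStepInduction with
  | zero =>
    obtain ⟨C, hC, h⟩ := exists_bound_volterraTranspose hH hq hb hb0
    refine ⟨C, hC, fun φ hφ M hM x => ?_⟩
    rw [iteratedDeriv_zero]
    exact (h φ hφ M fun x => by simpa using hM 0 le_rfl x).1 x
  | one =>
    obtain ⟨C, hC, h⟩ := exists_bound_volterraTranspose hH hq hb hb0
    refine ⟨C, hC, fun φ hφ M hM x => ?_⟩
    rw [iteratedDeriv_one]
    exact (h φ hφ M fun x => by simpa using hM 0 zero_le_one x).2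
      (fun x => by simpa using hM 1 le_rfl x) x
  | more i ih _ =>
    obtain ⟨C, hC, h⟩ := ih
    obtain ⟨D, hD, h'⟩ := testSchrodinger_bound hq hb hb0 i
    refine ⟨C * D, mul_nonneg hC hD, fun φ hφ M hM x => ?_⟩
    rw [iteratedDeriv_succ', iteratedDeriv_succ',
      funext fun x => (hasDerivAt_deriv_volterraTranspose hH hq φ x).2.deriv, mul_assoc]
    exact h _ (testSchrodinger_eq_zero hq hφ) _ (h' φ hφ M hM) x

lemma volterraTranspose_add (ha : 0 < a) (hH : IsGoursatSolution a q H)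
    (hq : ContDiffOn ℝ ∞ q (Ioo (-a) a)) (φ ψ : TestFun a) (x : ℝ) :
    volterraTranspose a (kernelOf H) (fun t => φ t + ψ t) x =
      volterraTranspose a (kernelOf H) φ x + volterraTranspose a (kernelOf H) ψ x := by
  obtain ⟨b, hb, hφ⟩ := exists_bound_of_test φ
  obtain ⟨c, hc, hψ⟩ := exists_bound_of_test ψ
  obtain ⟨d, hd, hda⟩ := exists_between (max_lt ha (max_lt hb hc))
  simp only [max_lt_iff] at hd
  have hφ' : ∀ x, d < |x| → φ x = 0 := fun x hx => hφ x (hd.2.1.trans hx)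
  have hψ' : ∀ x, d < |x| → ψ x = 0 := fun x hx => hψ x (hd.2.2.trans hx)
  have h' : ∀ x, d < |x| → φ x + ψ x = 0 := fun x hx => by simp [hφ' x hx, hψ' x hx]
  by_cases hx : d < |x|
  · rw [volterraTranspose_eq_zero hda _ hφ' hx, volterraTranspose_eq_zero hda _ hψ' hx,
      volterraTranspose_eq_zero hda _ h' hx, add_zero]
  · rw [not_lt] at hx
    obtain ⟨Q, hqQ, ⟨G⟩⟩ := exists_goursatKernel hq hd.1 hda
    have hc : Continuous fun t => φ t + ψ t := φ.continuous.add ψ.continuous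
    have n₁ : Continuous fun t => φ (-t) := φ.continuous.comp continuous_neg
    have n₂ : Continuous fun t => ψ (-t) := ψ.continuous.comp continuous_neg
    rw [volterraTranspose_eq_charOp hda hH G Q.continuous hqQ φ.continuous hφ' hx,
      volterraTranspose_eq_charOp hda hH G Q.continuous hqQ ψ.continuous hψ' hx,
      volterraTranspose_eq_charOp hda hH G Q.continuous hqQ hc h' hx]
    simp only [GoursatKernel.charOp]
    rw [charInt_add G.continuous_H φ.continuous ψ.continuous,
      charInt_add (GoursatKernel.continuous_refl G.continuous_H) n₁ n₂]
    ring

/-- The operator `𝐓^□` on test functions. -/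
def testVolterra (ha : 0 < a) (hH : IsGoursatSolution a q H)
    (hq : ContDiffOn ℝ ∞ q (Ioo (-a) a)) : TestFun a →L[ℂ] TestFun a :=
  testOp a (fun φ => volterraTranspose a (kernelOf H) φ) (volterraTranspose_add ha hH hq)
    (fun c φ x => by
      simp only [volterraTranspose, FunLike.coe_smul, Pi.smul_apply, smul_eq_mul,
        mul_left_comm _ c, intervalIntegral.integral_const_mul]
      ring)
    (contDiff_volterraTranspose hH hq)
    (fun b hb φ h x hx => volterraTranspose_eq_zero hb _ h hx)
    (fun b hb i => by
      -- `b` may be nonpositive while the estimates need a positive radius, so the support bound is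
      -- enlarged to `c`.
      obtain ⟨c, hc, hca⟩ := exists_between (max_lt ha hb)
      rw [max_lt_iff] at hc
      obtain ⟨C, hC, h⟩ := exists_bound_iteratedDeriv_volterraTranspose hH hq hca hc.1 i
      simp only [norm_iteratedFDeriv_eq_norm_iteratedDeriv]
      exact ⟨C, hC, fun φ hφ M hM x _ => h φ (fun x hx => hφ x (hc.2.trans hx)) M hM x⟩)

lemma testVolterra_apply (ha : 0 < a) (hH : IsGoursatSolution a q H)
    (hq : ContDiffOn ℝ ∞ q (Ioo (-a) a)) (φ : TestFun a) (x : ℝ) :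
    testVolterra ha hH hq φ x = volterraTranspose a (kernelOf H) φ x := rfl

lemma testDeriv_testDeriv_testVolterra (ha : 0 < a) (hH : IsGoursatSolution a q H)
    (hq : ContDiffOn ℝ ∞ q (Ioo (-a) a)) (φ : TestFun a) :
    testDeriv a (testDeriv a (testVolterra ha hH hq φ)) =
      testVolterra ha hH hq (testSchrodinger a q hq φ) := by
  ext x
  rw [testDeriv_apply, coe_testDeriv, testVolterra_apply]
  exact (hasDerivAt_deriv_volterraTranspose hH hq φ x).2.deriv

/-- For `t` and `x` in `I` the kernel `K(t, x)` evaluates `H` at a point with `u + v = t` and `u - v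
= x`, inside the square where all Goursat solutions agree. Test functions vanish off `I`, so their
values on `I` determine the operator. -/
lemma existsUnique_isVolterraTransmutation (ha : 0 < a)
    (hq : ContDiffOn ℝ ∞ q (Ioo (-a) a)) :
    ∃! T : Distr a →L[ℂ] Distr a, IsVolterraTransmutation a q T := by
  obtain ⟨H, hH⟩ := exists_isGoursatSolution ha hq
  refine ⟨transposeOp (testVolterra ha hH hq), ⟨H, hH, fun φ =>
    ⟨testVolterra ha hH hq φ, fun x _ => rfl, fun u => rfl⟩⟩, ?_⟩
  rintro T ⟨H', hH', hT⟩
  ext u φ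
  obtain ⟨ψ, hψ, hu⟩ := hT φ
  rw [hu u]
  change u ψ = u (testVolterra ha hH hq φ)
  congr 1
  ext x
  by_cases hx : x ∈ Ioo (-a) a
  · rw [hψ x hx, testVolterra_apply]
    have e : ∀ t, kernelOf H' t x * φ t = kernelOf H t x * φ t := by
      intro t
      by_cases ht : t ∈ Ioo (-a) a
      · rw [kernelOf, kernelOf, hH'.eq_of_isGoursatSolution hq.continuousOn hH]
        refine abs_add_abs_lt_iff.2 ⟨?_, ?_⟩
        · ring_nf; exact abs_lt.2 ht
        · ring_nf; exact abs_lt.2 hx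
      · rw [image_eq_zero_of_notMem_tsupport fun h => ht (φ.tsupport_subset h)]
        simp
    simp only [volterraTranspose, e]
  · rw [image_eq_zero_of_notMem_tsupport fun h => hx (ψ.tsupport_subset h),
      image_eq_zero_of_notMem_tsupport fun h =>
        hx ((testVolterra ha hH hq φ).tsupport_subset h)]

lemma IsVolterraTransmutation.exists_eq_transposeOp (ha : 0 < a)
    (hq : ContDiffOn ℝ ∞ q (Ioo (-a) a)) {T : Distr a →L[ℂ] Distr a}
    (hT : IsVolterraTransmutation a q T) :
    ∃ H, ∃ hH : IsGoursatSolution a q H, T = transposeOp (testVolterra ha hH hq) := by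
  obtain ⟨H, hH⟩ := exists_isGoursatSolution ha hq
  exact ⟨H, hH, (existsUnique_isVolterraTransmutation ha hq).unique hT
    ⟨H, hH, fun φ => ⟨testVolterra ha hH hq φ, fun x _ => rfl, fun u => rfl⟩⟩⟩

end VolterraTest

/-! ### Regular distributions -/

section Regular

variable {a : ℝ}

lemma test_eq_zero_of_notMem (φ : TestFun a) {x : ℝ} (hx : x ∉ Ioo (-a) a) : φ x = 0 :=
  image_eq_zero_of_notMem_tsupport fun h => hx (φ.tsupport_subset h)

lemma continuous_mul_test {f : ℝ → ℂ} (hf : ContinuousOn f (Ioo (-a) a)) (φ : TestFun a) :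
    Continuous fun x => f x * φ x :=
  continuous_iff_continuousAt.2 fun x => by
    by_cases hx : x ∈ tsupport φ
    · exact (hf.continuousAt (isOpen_Ioo.mem_nhds (φ.tsupport_subset hx))).mul
        φ.continuous.continuousAt
    · have h0 : (fun y => f y * φ y) =ᶠ[𝓝 x] fun _ => (0 : ℂ) := by
        filter_upwards [notMem_tsupport_iff_eventuallyEq.1 hx] with y hy
        simp [hy]
      exact continuousAt_const.congr h0.symm

lemma integrable_mul_test {f : ℝ → ℂ} (hf : ContinuousOn f (Ioo (-a) a)) (φ : TestFun a) :
    Integrable fun x => f x * φ x :=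
  (continuous_mul_test hf φ).integrable_of_hasCompactSupport φ.hasCompactSupport.mul_left

lemma regular_apply {f : ℝ → ℂ} (hf : ContinuousOn f (Ioo (-a) a)) (φ : TestFun a) :
    regular a f φ = ∫ x, f x * φ x := by
  have h : LocallyIntegrableOn f (symmI a : Set ℝ) volume :=
    ContinuousOn.locallyIntegrableOn hf measurableSet_Ioo
  refine (TestFunction.integralAgainstBilinCLM_eq_integral h).trans ?_
  simp [mul_comm]

lemma regular_congr {f g : ℝ → ℂ} (hf : ContinuousOn f (Ioo (-a) a))
    (h : EqOn f g (Ioo (-a) a)) : regular a f = regular a g := by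
  ext φ
  rw [regular_apply hf, regular_apply (hf.congr h.symm)]
  refine integral_congr_ae (ae_of_all _ fun x => ?_)
  by_cases hx : x ∈ Ioo (-a) a
  · simp only [h hx]
  · simp only [test_eq_zero_of_notMem φ hx, mul_zero]

lemma regular_linear {f g : ℝ → ℂ} (hf : ContinuousOn f (Ioo (-a) a))
    (hg : ContinuousOn g (Ioo (-a) a)) (c d : ℂ) :
    regular a (fun x => c * f x + d * g x) = c • regular a f + d • regular a g := by
  ext φ
  have hc : ContinuousOn (fun x => c * f x + d * g x) (Ioo (-a) a) :=
    (continuousOn_const.mul hf).add (continuousOn_const.mul hg)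
  change _ = c * regular a f φ + d * regular a g φ
  rw [regular_apply hc,
    regular_apply hf, regular_apply hg, ← integral_const_mul, ← integral_const_mul,
    ← integral_add ((integrable_mul_test hf φ).const_mul c)
      ((integrable_mul_test hg φ).const_mul d)]
  refine integral_congr_ae (ae_of_all _ fun x => ?_)
  simp only
  ring

lemma integral_mul_testDeriv {f f' : ℝ → ℂ} (hf : ∀ x ∈ Ioo (-a) a, HasDerivAt f (f' x) x)
    (hf' : ContinuousOn f' (Ioo (-a) a)) (φ : TestFun a) :
    ∫ x, f x * testDeriv a φ x = -∫ x, f' x * φ x := by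
  have hc : ContinuousOn f (Ioo (-a) a) := fun x hx => (hf x hx).continuousAt.continuousWithinAt
  exact integral_mul_deriv_eq_deriv_mul_of_integrable
    (fun x hx => hf x (φ.tsupport_subset hx)) (fun x _ => hasDerivAt_test φ x)
    (integrable_mul_test hc _) (integrable_mul_test hf' _) (integrable_mul_test hc _)

lemma ddx_apply (u : Distr a) (φ : TestFun a) : ddx a u φ = -u (testDeriv a φ) := rfl

lemma ddx_regular {f f' : ℝ → ℂ} (hf : ∀ x ∈ Ioo (-a) a, HasDerivAt f (f' x) x)
    (hf' : ContinuousOn f' (Ioo (-a) a)) : ddx a (regular a f) = regular a f' := by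
  ext φ
  have hc : ContinuousOn f (Ioo (-a) a) := fun x hx => (hf x hx).continuousAt.continuousWithinAt
  rw [ddx_apply, regular_apply hc, regular_apply hf', integral_mul_testDeriv hf hf', neg_neg]

lemma schrodinger_apply {q : ℝ → ℂ} (hq : ContDiffOn ℝ ∞ q (Ioo (-a) a)) (u : Distr a)
    (φ : TestFun a) : schrodinger a q hq u φ = u (testSchrodinger a q hq φ) := by
  change - -u (testDeriv a (testDeriv a φ)) - u (testMul a q hq φ) = _
  rw [neg_neg, ← map_sub]
  rfl

lemma eqOn_of_forall_integral_eq {f g : ℝ → ℂ} (hf : ContinuousOn f (Ioo (-a) a))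
    (hg : ContinuousOn g (Ioo (-a) a))
    (h : ∀ φ : TestFun a, ∫ x, f x * φ x = ∫ x, g x * φ x) : EqOn f g (Ioo (-a) a) := by
  have hfg : ContinuousOn (fun x => f x - g x) (Ioo (-a) a) := hf.sub hg
  have h1 : ∀ᵐ x, x ∈ Ioo (-a) a → f x - g x = 0 := by
    refine isOpen_Ioo.ae_eq_zero_of_integral_contDiff_smul_eq_zero
      (ContinuousOn.locallyIntegrableOn hfg measurableSet_Ioo) fun k hk hkc hks => ?_
    have hsub : tsupport (fun x => (k x : ℂ)) ⊆ tsupport k :=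
      closure_mono fun x hx h => hx (by simp [h])
    let φ : TestFun a := ⟨fun x => (k x : ℂ), Complex.ofRealCLM.contDiff.comp hk,
      hkc.comp_left Complex.ofReal_zero, hsub.trans hks⟩
    have h2 := h φ
    rw [← sub_eq_zero, ← integral_sub (integrable_mul_test hf φ) (integrable_mul_test hg φ)] at h2
    rw [← h2]
    refine integral_congr_ae (ae_of_all _ fun x => ?_)
    change k x • (f x - g x) = f x * (k x : ℂ) - g x * (k x : ℂ)
    rw [Complex.real_smul]
    ring
  refine Measure.eqOn_open_of_ae_eq (μ := volume) ?_ isOpen_Ioo hf hg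
  rw [EventuallyEq, ae_restrict_iff' measurableSet_Ioo]
  filter_upwards [h1] with x hx hxI using sub_eq_zero.1 (hx hxI)

/-! ### Weak solutions of second order equations -/

lemma integrable_test (φ : TestFun a) : Integrable φ :=
  φ.continuous.integrable_of_hasCompactSupport φ.hasCompactSupport

/-- The primitive from `-∞` vanishes to the left of the support and equals the total integral, that
is 0, to the right of it. -/
lemma exists_testDeriv_eq (φ : TestFun a) (h : ∫ x, φ x = 0) :
    ∃ χ : TestFun a, testDeriv a χ = φ := by
  obtain ⟨b, hb, hφ⟩ := exists_bound_of_test φ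
  let χ : ℝ → ℂ := fun x => ∫ t in Iic x, φ t
  have hd : ∀ x, HasDerivAt χ (φ x) x := by
    intro x
    have h1 : ∀ y, χ y = χ 0 + ∫ t in (0 : ℝ)..y, φ t := fun y => by
      rw [← intervalIntegral.integral_Iic_sub_Iic (integrable_test φ).integrableOn
        (integrable_test φ).integrableOn]
      ring
    exact ((hasDerivAt_primitive φ.continuous x).const_add (χ 0)).congr_of_eventuallyEq
      (Eventually.of_forall h1)
  have hz : ∀ x, b < |x| → χ x = 0 := by
    intro x hx
    rcases lt_abs.1 hx with h1 | h1
    · rw [← h]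
      refine setIntegral_eq_integral_of_forall_compl_eq_zero fun t ht => hφ t ?_
      exact lt_of_lt_of_le (h1.trans (not_le.1 ht)) (le_abs_self t)
    · refine setIntegral_eq_zero_of_forall_eq_zero fun t ht => hφ t ?_
      exact lt_of_lt_of_le (lt_of_lt_of_le h1 (neg_le_neg ht)) (neg_le_abs t)
  have hts : tsupport χ ⊆ Icc (-b) b := closure_minimal (fun x hx => by
      by_contra hn
      exact hx (hz x (not_le.1 fun h => hn (abs_le.1 h)))) isClosed_Icc
  have hs : ContDiff ℝ ∞ χ := by
    rw [contDiff_infty_iff_deriv]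
    refine ⟨fun x => (hd x).differentiableAt, ?_⟩
    rw [funext fun x => (hd x).deriv]
    exact φ.contDiff
  refine ⟨⟨χ, hs, isCompact_Icc.of_isClosed_subset (isClosed_tsupport _) hts,
    hts.trans fun x hx => ⟨by linarith [hx.1], lt_of_le_of_lt hx.2 hb⟩⟩, ?_⟩
  ext x
  rw [testDeriv_apply]
  exact (hd x).deriv

lemma exists_test_integral_eq_one (ha : 0 < a) : ∃ ρ : TestFun a, ∫ x, ρ x = 1 := by
  let B : ContDiffBump (0 : ℝ) := ⟨a / 4, a / 2, by linarith, by linarith⟩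
  have hsub : Function.support (fun x => (B x : ℂ)) ⊆ Function.support B := fun x hx h =>
    hx (by simp [h])
  let χ : TestFun a := ⟨fun x => (B x : ℂ), Complex.ofRealCLM.contDiff.comp B.contDiff,
    B.hasCompactSupport.comp_left Complex.ofReal_zero, by
      refine (closure_mono hsub).trans ?_
      rw [← tsupport, B.tsupport_eq, Real.closedBall_eq_Icc]
      intro x hx
      have h1 : B.rOut = a / 2 := rfl
      rw [h1] at hx
      exact ⟨by linarith [hx.1], by linarith [hx.2]⟩⟩
  have hχ : ∫ x, χ x = ((∫ x, B x : ℝ) : ℂ) := integral_ofReal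
  have hpos : 0 < ∫ x, B x := B.integral_pos (μ := volume)
  refine ⟨(∫ x, χ x)⁻¹ • χ, ?_⟩
  have : ∫ x, ((∫ x, χ x)⁻¹ • χ : TestFun a) x = (∫ x, χ x)⁻¹ * ∫ x, χ x := by
    rw [← integral_const_mul]
    rfl
  rw [this, inv_mul_cancel₀]
  rw [hχ]
  exact_mod_cast hpos.ne'

/-- Fix `ρ` of integral 1. Removing means twice writes any test function as `φ = I ρ + s ρ' + η''`
with `I = ∫ φ` and `s = I m - ∫ x φ`. Hence `∫ f φ = I A + s B`, which is the integral of `φ`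
against an affine function. -/
lemma exists_eq_affine (ha : 0 < a) {f : ℝ → ℂ} (hf : ContinuousOn f (Ioo (-a) a))
    (h : ∀ ψ : TestFun a, ∫ x, f x * testDeriv a (testDeriv a ψ) x = 0) :
    ∃ c d : ℂ, ∀ x ∈ Ioo (-a) a, f x = c + d * x := by
  obtain ⟨ρ, hρ⟩ := exists_test_integral_eq_one ha
  set A := ∫ x, f x * ρ x
  set B := ∫ x, f x * testDeriv a ρ x
  have hid : Continuous fun x : ℝ => (x : ℂ) := Complex.continuous_ofReal
  set m := ∫ x : ℝ, (x : ℂ) * ρ x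
  have hx' : ∀ φ : TestFun a, ∫ x : ℝ, (x : ℂ) * testDeriv a φ x = -∫ x, φ x := by
    intro φ
    have := integral_mul_testDeriv (f := fun x => (x : ℂ)) (f' := fun _ => 1)
      (fun x _ => Complex.ofRealCLM.hasDerivAt) continuousOn_const φ
    simpa using this
  have hsub : ∀ (g : ℝ → ℂ), ContinuousOn g (Ioo (-a) a) → ∀ (φ χ : TestFun a) (c : ℂ),
      ∫ x, g x * (φ - c • χ : TestFun a) x = (∫ x, g x * φ x) - c * ∫ x, g x * χ x := by
    intro g hg φ χ c
    rw [← integral_const_mul, ← integral_sub (integrable_mul_test hg φ)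
      ((integrable_mul_test hg χ).const_mul c)]
    refine integral_congr_ae (ae_of_all _ fun x => ?_)
    change g x * (φ x - c * χ x) = _
    ring
  refine ⟨A + B * m, -B, ?_⟩
  refine eqOn_of_forall_integral_eq (g := fun x : ℝ => A + B * m + -B * x) hf
    (by fun_prop) fun φ => ?_
  set I := ∫ x, φ x
  obtain ⟨χ, hχ⟩ := exists_testDeriv_eq (φ - I • ρ) (by
    have := hsub (fun _ => 1) continuousOn_const φ ρ I
    simp only [one_mul] at this
    rw [this, hρ, mul_one, sub_self])
  set s := ∫ x, χ x with hs
  obtain ⟨η, hη⟩ := exists_testDeriv_eq (χ - s • ρ) (by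
    have := hsub (fun _ => 1) continuousOn_const χ ρ s
    simp only [one_mul] at this
    rw [this, hρ, mul_one, sub_self])
  have hs' : s = -(∫ x : ℝ, (x : ℂ) * φ x) + I * m := by
    have h1 := hx' χ
    rw [hχ, hsub _ hid.continuousOn] at h1
    linear_combination h1
  have h2 := h η
  rw [hη, map_sub, map_smul, hχ, hsub _ hf, hsub _ hf] at h2
  have h3 : ∀ c d : ℂ, ∫ x : ℝ, (c + d * (x : ℂ)) * φ x = c * I + d * ∫ x : ℝ, (x : ℂ) * φ x := by
    intro c d
    rw [← integral_const_mul, ← integral_const_mul, ← integral_add ((integrable_test φ).const_mul _)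
      ((integrable_mul_test hid.continuousOn φ).const_mul _)]
    refine integral_congr_ae (ae_of_all _ fun x => ?_)
    simp only
    ring
  rw [h3]
  linear_combination h2 + B * hs'

lemma hasDerivAt_primitive_of_continuousOn (ha : 0 < a) {h : ℝ → ℂ}
    (hh : ContinuousOn h (Ioo (-a) a)) {x : ℝ} (hx : x ∈ Ioo (-a) a) :
    HasDerivAt (fun x => ∫ t in (0 : ℝ)..x, h t) (h x) x := by
  have hsub : uIcc 0 x ⊆ Ioo (-a) a :=
    ordConnected_Ioo.uIcc_subset ⟨by linarith, ha⟩ hx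
  exact intervalIntegral.integral_hasDerivAt_right (hh.mono hsub).intervalIntegrable
    (hh.stronglyMeasurableAtFilter isOpen_Ioo x hx) (hh.continuousAt (isOpen_Ioo.mem_nhds hx))

/-- A continuous weak solution of `g'' = h` with continuous `h` is a classical solution. -/
lemma exists_hasDerivAt_of_weak (ha : 0 < a) {g h : ℝ → ℂ} (hg : ContinuousOn g (Ioo (-a) a))
    (hh : ContinuousOn h (Ioo (-a) a))
    (hw : ∀ ψ : TestFun a, ∫ x, g x * testDeriv a (testDeriv a ψ) x = ∫ x, h x * ψ x) :
    ∃ g' : ℝ → ℂ, ∀ x ∈ Ioo (-a) a, HasDerivAt g (g' x) x ∧ HasDerivAt g' (h x) x := by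
  let h₁ : ℝ → ℂ := fun x => ∫ t in (0 : ℝ)..x, h t
  have d₁ : ∀ x ∈ Ioo (-a) a, HasDerivAt h₁ (h x) x := fun x hx =>
    hasDerivAt_primitive_of_continuousOn ha hh hx
  have c₁ : ContinuousOn h₁ (Ioo (-a) a) := fun x hx => (d₁ x hx).continuousAt.continuousWithinAt
  let h₂ : ℝ → ℂ := fun x => ∫ t in (0 : ℝ)..x, h₁ t
  have d₂ : ∀ x ∈ Ioo (-a) a, HasDerivAt h₂ (h₁ x) x := fun x hx =>
    hasDerivAt_primitive_of_continuousOn ha c₁ hx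
  have c₂ : ContinuousOn h₂ (Ioo (-a) a) := fun x hx => (d₂ x hx).continuousAt.continuousWithinAt
  -- `g` minus a double primitive of `h` has vanishing weak second derivative, so it is affine.
  obtain ⟨c, d, hcd⟩ := exists_eq_affine ha (f := fun x => g x - h₂ x) (hg.sub c₂) fun ψ => by
    have h3 : ∫ x, h₂ x * testDeriv a (testDeriv a ψ) x = ∫ x, h x * ψ x := by
      rw [integral_mul_testDeriv d₂ c₁, integral_mul_testDeriv d₁ hh, neg_neg]
    simp only [sub_mul]
    rw [integral_sub (integrable_mul_test hg _) (integrable_mul_test c₂ _), hw, h3, sub_self]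
  refine ⟨fun x => d + h₁ x, fun x hx => ⟨?_, (d₁ x hx).const_add d⟩⟩
  have h4 : g =ᶠ[𝓝 x] fun x => c + d * x + h₂ x := by
    filter_upwards [isOpen_Ioo.mem_nhds hx] with y hy
    rw [← hcd y hy]
    ring
  have h5 : HasDerivAt (fun x : ℝ => (x : ℂ)) 1 x := Complex.ofRealCLM.hasDerivAt
  refine HasDerivAt.congr_of_eventuallyEq ?_ h4
  simpa using ((h5.const_mul d).const_add c).fun_add (d₂ x hx)

/-- A continuous distributional solution of `L g = h` is a classical solution. -/
lemma exists_hasDerivAt_of_schrodinger (ha : 0 < a) {q g h : ℝ → ℂ}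
    (hq : ContDiffOn ℝ ∞ q (Ioo (-a) a)) (hg : ContinuousOn g (Ioo (-a) a))
    (hh : ContinuousOn h (Ioo (-a) a))
    (hL : schrodinger a q hq (regular a g) = regular a h) :
    ∃ g' : ℝ → ℂ, ∀ x ∈ Ioo (-a) a,
      HasDerivAt g (g' x) x ∧ HasDerivAt g' (q x * g x + h x) x := by
  refine exists_hasDerivAt_of_weak ha hg ((hq.continuousOn.mul hg).add hh) fun ψ => ?_
  have h1 : schrodinger a q hq (regular a g) ψ = regular a h ψ := by rw [hL]
  rw [schrodinger_apply, regular_apply hg, regular_apply hh] at h1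
  have hqg : ContinuousOn (fun x => q x * g x) (Ioo (-a) a) := hq.continuousOn.mul hg
  have h2 : ∫ x, g x * testSchrodinger a q hq ψ x =
      (∫ x, g x * testDeriv a (testDeriv a ψ) x) - ∫ x, q x * g x * ψ x := by
    rw [← integral_sub (integrable_mul_test hg _) (integrable_mul_test hqg ψ)]
    refine integral_congr_ae (ae_of_all _ fun x => ?_)
    change g x * (testDeriv a (testDeriv a ψ) x - q x * ψ x) = _
    ring
  simp only [add_mul]
  rw [integral_add (integrable_mul_test hqg ψ) (integrable_mul_test hh ψ)]
  linear_combination h1 - h2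

/-- Uniqueness for the Cauchy problem for `g'' = q g`. -/
lemma eq_zero_of_cauchy {q g g' : ℝ → ℂ} (hq : ContinuousOn q (Ioo (-a) a))
    (hg : ∀ x ∈ Ioo (-a) a, HasDerivAt g (g' x) x ∧ HasDerivAt g' (q x * g x) x)
    (h0 : g 0 = 0) (h1 : g' 0 = 0) : ∀ x ∈ Ioo (-a) a, g x = 0 := by
  intro x hx
  obtain ⟨b, hb, hba⟩ := exists_between (abs_lt.2 hx)
  have hb0 : 0 < b := (abs_nonneg x).trans_lt hb
  have hsub : Icc (-b) b ⊆ Ioo (-a) a := fun x hx =>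
    ⟨by linarith [hx.1], lt_of_le_of_lt hx.2 hba⟩
  obtain ⟨M, hM⟩ := isCompact_Icc.exists_bound_of_continuousOn (hq.mono hsub)
  have hM0 : 0 ≤ M := (norm_nonneg _).trans (hM 0 ⟨by linarith, hb0.le⟩)
  -- The first order system for `(g, g')` is Lipschitz with constant `max 1 M` on the compact
  -- interval where `‖q‖ ≤ M`; the zero solution has the same data.
  have := ODE_solution_unique_of_mem_Ioo (E := ℂ × ℂ) (a := -b) (b := b) (t₀ := 0)
    (v := fun t y => (y.2, q t * y.1)) (s := fun _ => univ) (K := ⟨max 1 M, by positivity⟩)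
    (f := fun t => (g t, g' t)) (g := fun _ => 0) (fun t ht => by
      refine (LipschitzWith.of_dist_le_mul fun y z => ?_).lipschitzOnWith
      have hMt := hM t (Ioo_subset_Icc_self ht)
      have e1 : dist y.2 z.2 ≤ dist y z := le_max_right _ _
      have e2 : dist y.1 z.1 ≤ dist y z := le_max_left _ _
      change max (dist y.2 z.2) (dist (q t * y.1) (q t * z.1)) ≤ max 1 M * dist y z
      refine max_le ?_ ?_
      · exact e1.trans (le_mul_of_one_le_left dist_nonneg (le_max_left _ _))
      · rw [dist_eq_norm, ← mul_sub, norm_mul, ← dist_eq_norm]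
        exact mul_le_mul (hMt.trans (le_max_right _ _)) e2 dist_nonneg (by positivity))
    ⟨by linarith, hb0⟩
    (fun t ht => ⟨(hg t (hsub (Ioo_subset_Icc_self ht))).1.prodMk
      (hg t (hsub (Ioo_subset_Icc_self ht))).2, mem_univ _⟩)
    (fun t _ => ⟨(hasDerivAt_const t (0 : ℂ × ℂ)).congr_deriv (by simp; rfl), mem_univ _⟩)
    (by simp [h0, h1])
  exact congr_arg Prod.fst (this (abs_lt.1 hb))

/-! ### Density of polynomials -/

/-- A continuous linear functional on distributions is the evaluation at a test function. -/
lemma exists_transpose_apply (𝒯 : Distr a →L[ℂ] Distr a) (φ : TestFun a) :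
    ∃ ψ : TestFun a, ∀ u, 𝒯 u φ = u ψ := by
  -- Pointwise convergence is the weak topology of the dual, and functionals continuous for it are
  -- evaluations.
  let e := PointwiseConvergenceCLM.equivWeakDual ℂ (TestFun a)
  let F : WeakDual ℂ (TestFun a) →L[ℂ] ℂ := (PointwiseConvergenceCLM.evalCLM (RingHom.id ℂ) ℂ φ)
    ∘L 𝒯 ∘L (e.symm : WeakDual ℂ (TestFun a) →L[ℂ] Distr a)
  obtain ⟨ψ, hψ⟩ := LinearMap.dualEmbedding_surjective (topDualPairing ℂ (TestFun a)) F
  exact ⟨ψ, fun u => (DFunLike.congr_fun hψ (e u)).symm⟩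

/-- `f` is orthogonal to all polynomials. One that is `ε`-close to `f` on `[-a, a]` gives `∫ f² ≤ ε
∫ |f|`. -/
lemma eq_zero_of_real_moments {f : ℝ → ℝ} (hf : Continuous f) (hfc : HasCompactSupport f)
    (hfs : tsupport f ⊆ Icc (-a) a) (h : ∀ k : ℕ, ∫ x, x ^ k * f x = 0) : f = 0 := by
  by_contra hne
  obtain ⟨x₀, hx₀⟩ := Function.ne_iff.1 hne
  have hint : ∀ g : ℝ → ℝ, Continuous g → Integrable fun x => g x * f x := fun g hg =>
    (hg.mul hf).integrable_of_hasCompactSupport hfc.mul_left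
  have hpos : 0 < ∫ x, f x * f x :=
    (hf.mul hf).integral_pos_of_hasCompactSupport_nonneg_nonzero (x := x₀) hfc.mul_left
      (fun x => mul_self_nonneg (f x)) (mul_self_ne_zero.2 hx₀)
  have hpoly : ∀ p : Polynomial ℝ, ∫ x, p.eval x * f x = 0 := by
    intro p
    simp only [Polynomial.eval_eq_sum_range, Finset.sum_mul, mul_assoc]
    rw [integral_finsetSum _ fun i _ => (hint (fun x => x ^ i) (by fun_prop)).const_mul _]
    refine Finset.sum_eq_zero fun i _ => ?_
    rw [integral_const_mul, h i, mul_zero]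
  have hfi : Integrable fun x => |f x| := (hf.integrable_of_hasCompactSupport hfc).abs
  set N := ∫ x, |f x|
  have hN : 0 ≤ N := integral_nonneg fun x => abs_nonneg _
  -- With this tolerance `ε (N + 1) = ∫ f²`, which contradicts `∫ f² ≤ ε N` because `ε > 0`.
  obtain ⟨p, hp⟩ := exists_polynomial_near_of_continuousOn (-a) a f hf.continuousOn
    ((∫ x, f x * f x) / (N + 1)) (by positivity)
  set ε := (∫ x, f x * f x) / (N + 1) with hε
  have h1 : ∫ x, f x * f x ≤ ε * N := by
    have h2 : ∫ x, f x * f x = ∫ x, (f x * f x - p.eval x * f x) := by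
      rw [integral_sub (hint f hf) (hint _ p.continuous), hpoly, sub_zero]
    rw [h2, ← integral_const_mul]
    refine integral_mono ((hint f hf).sub (hint _ p.continuous)) (hfi.const_mul ε) fun x => ?_
    by_cases hx : x ∈ tsupport f
    · have h3 := (hp x (hfs hx)).le
      simp only
      rw [← sub_mul]
      refine (le_abs_self _).trans ?_
      rw [abs_mul, abs_sub_comm]
      gcongr
    · simp [image_eq_zero_of_notMem_tsupport hx]
  have h4 : ε * (N + 1) = ∫ x, f x * f x := by
    rw [hε]; field_simp
  have h5 : 0 < ε := by positivity
  linarith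

lemma test_ext_of_moments {φ ψ : TestFun a}
    (h : ∀ k : ℕ, ∫ x : ℝ, (x : ℂ) ^ k * φ x = ∫ x : ℝ, (x : ℂ) ^ k * ψ x) : φ = ψ := by
  have hpow : ∀ k : ℕ, ContinuousOn (fun x : ℝ => (x : ℂ) ^ k) (Ioo (-a) a) := fun k => by fun_prop
  have h0 : ∀ k : ℕ, ∫ x : ℝ, (x : ℂ) ^ k * (φ - ψ : TestFun a) x = 0 := by
    intro k
    rw [← sub_eq_zero.2 (h k), ← integral_sub (integrable_mul_test (hpow k) φ)
      (integrable_mul_test (hpow k) ψ)]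
    refine integral_congr_ae (ae_of_all _ fun x => ?_)
    change _ * (φ x - ψ x) = _
    ring
  set χ := φ - ψ
  have key : ∀ L : ℂ →L[ℝ] ℝ, (fun x => L (χ x)) = 0 := by
    intro L
    have hsub : tsupport (fun x => L (χ x)) ⊆ tsupport χ :=
      closure_mono fun x hx h => hx (by simp [h])
    refine eq_zero_of_real_moments (a := a) (L.continuous.comp χ.continuous)
      (χ.hasCompactSupport.comp_left (map_zero L))
      (hsub.trans (χ.tsupport_subset.trans Ioo_subset_Icc_self)) fun k => ?_
    have h1 := L.integral_comp_comm (integrable_mul_test (hpow k) χ)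
    rw [h0, map_zero] at h1
    rw [← h1]
    refine integral_congr_ae (ae_of_all _ fun x => ?_)
    have h2 : (x : ℂ) ^ k * χ x = (x ^ k : ℝ) • χ x := by
      rw [Complex.real_smul]; push_cast; ring
    simp only [h2, map_smul, smul_eq_mul]
  refine sub_eq_zero.1 ?_
  ext x
  exact Complex.ext (congr_fun (key Complex.reCLM) x) (congr_fun (key Complex.imCLM) x)

/-- A continuous operator on distributions is determined by its values at the monomials. -/
lemma distr_clm_ext {𝒯₁ 𝒯₂ : Distr a →L[ℂ] Distr a}
    (h : ∀ k : ℕ, 𝒯₁ (regular a fun x => (x : ℂ) ^ k) = 𝒯₂ (regular a fun x => (x : ℂ) ^ k)) :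
    𝒯₁ = 𝒯₂ := by
  ext u φ
  obtain ⟨ψ₁, h₁⟩ := exists_transpose_apply 𝒯₁ φ
  obtain ⟨ψ₂, h₂⟩ := exists_transpose_apply 𝒯₂ φ
  rw [h₁, h₂, test_ext_of_moments (φ := ψ₁) (ψ := ψ₂) fun k => ?_]
  have hc : ContinuousOn (fun x : ℝ => (x : ℂ) ^ k) (Ioo (-a) a) := by fun_prop
  rw [← regular_apply hc, ← regular_apply hc, ← h₁, ← h₂, h k]

end Regular

/-! ### The Volterra operator on functions -/

/-- Fubini for `F` times the indicator of `x < t` on the square `(-b, b]²`. -/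
lemma integral_triangle_swap {F : ℝ → ℝ → ℂ} (hF : Continuous F.uncurry) {b : ℝ} (hb : 0 ≤ b) :
    ∫ x in (-b)..b, ∫ t in x..b, F x t = ∫ t in (-b)..b, ∫ x in (-b)..t, F x t := by
  have hbb : -b ≤ b := by linarith
  let μ : Measure ℝ := volume.restrict (Ioc (-b) b)
  let S : Set (ℝ × ℝ) := {p | p.1 < p.2}
  have hS : MeasurableSet S := measurableSet_lt measurable_fst measurable_snd
  have hint : Integrable (Function.uncurry fun x t => S.indicator F.uncurry (x, t)) (μ.prod μ) := by
    refine Integrable.indicator (f := F.uncurry) ?_ hS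
    rw [Measure.prod_restrict]
    exact (hF.continuousOn.integrableOn_compact (isCompact_Icc.prod isCompact_Icc)).mono_set
      (prod_mono Ioc_subset_Icc_self Ioc_subset_Icc_self)
  have hswap := integral_integral_swap hint
  rw [intervalIntegral.integral_of_le hbb, intervalIntegral.integral_of_le hbb]
  have e1 : ∀ x ∈ Ioc (-b) b, ∫ t, S.indicator F.uncurry (x, t) ∂μ = ∫ t in x..b, F x t := by
    intro x hx
    have h1 : (fun t => S.indicator F.uncurry (x, t)) = (Ioi x).indicator (F x) := by
      ext t
      simp only [indicator, S, mem_ofPred_eq, mem_Ioi, Function.uncurry]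
    rw [h1, setIntegral_indicator measurableSet_Ioi, Ioc_inter_Ioi, max_eq_right hx.1.le,
      intervalIntegral.integral_of_le hx.2]
  have e2 : ∀ t ∈ Ioc (-b) b, ∫ x, S.indicator F.uncurry (x, t) ∂μ = ∫ x in (-b)..t, F x t := by
    intro t ht
    have h1 : (fun x => S.indicator F.uncurry (x, t)) = (Iio t).indicator fun x => F x t := by
      ext x
      simp only [indicator, S, mem_ofPred_eq, mem_Iio, Function.uncurry]
    have h2 : Ioc (-b) b ∩ Iio t = Ioo (-b) t := by
      ext x
      simp only [mem_inter_iff, mem_Ioc, mem_Iio, mem_Ioo]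
      exact ⟨fun h => ⟨h.1.1, h.2⟩, fun h => ⟨⟨h.1, h.2.le.trans ht.2⟩, h.2⟩⟩
    rw [h1, setIntegral_indicator measurableSet_Iio, h2, ← integral_Ioc_eq_integral_Ioo,
      intervalIntegral.integral_of_le ht.1.le]
  rw [← setIntegral_congr_fun measurableSet_Ioc e1, ← setIntegral_congr_fun measurableSet_Ioc e2]
  exact hswap

lemma integral_triangle_swap_neg {F : ℝ → ℝ → ℂ} (hF : Continuous F.uncurry) {b : ℝ}
    (hb : 0 ≤ b) :
    ∫ x in (-b)..b, ∫ t in (-b)..(-x), F x t = ∫ t in (-b)..b, ∫ x in (-b)..(-t), F x t := by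
  have hF' : Continuous (Function.uncurry fun x t => F x (-t)) := by
    have h1 : Continuous fun p : ℝ × ℝ => F.uncurry (p.1, -p.2) := by fun_prop
    exact h1
  have h := integral_triangle_swap hF' hb
  have e1 : ∀ x, ∫ t in x..b, F x (-t) = ∫ t in (-b)..(-x), F x t := fun x =>
    intervalIntegral.integral_comp_neg (F x)
  simp only [e1] at h
  rw [h]
  have e2 := intervalIntegral.integral_comp_neg (a := -b) (b := b)
    (fun t => ∫ x in (-b)..(-t), F x t)
  simp only [neg_neg] at e2
  exact e2

/-- The Volterra operator `p ↦ p(x) + ∫₋ₓˣ K(x, t) p(t) dt` on functions. -/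
def volterra (K : ℝ → ℝ → ℂ) (p : ℝ → ℂ) (x : ℝ) : ℂ := p x + ∫ t in (-x)..x, K x t * p t

lemma GoursatKernel.continuous_kernelOf {Q : ℝ → ℂ} (G : GoursatKernel Q) :
    Continuous (kernelOf G.H).uncurry := by
  have := G.continuous_H
  have h1 : Continuous fun p : ℝ × ℝ => G.H.uncurry ((p.1 + p.2) / 2, (p.1 - p.2) / 2) := by
    fun_prop
  exact h1

lemma continuous_volterra {K : ℝ → ℝ → ℂ} (hK : Continuous K.uncurry) {p : ℝ → ℂ}
    (hp : Continuous p) : Continuous (volterra K p) := by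
  have hF : Continuous (Function.uncurry fun x t => K x t * p t) := hK.mul (hp.comp continuous_snd)
  have e : volterra K p = fun x => p x + ((∫ t in (0 : ℝ)..x, K x t * p t) -
      ∫ t in (0 : ℝ)..(-x), K x t * p t) := by
    ext x
    have i : ∀ s t, IntervalIntegrable (fun t => K x t * p t) volume s t := fun s t =>
      (hF.uncurry_left x).intervalIntegrable s t
    rw [volterra, intervalIntegral.integral_interval_sub_left (i _ _) (i _ _)]
  rw [e]
  exact hp.add ((intervalIntegral.continuous_parametric_intervalIntegral_of_continuous hF
    continuous_id).sub (intervalIntegral.continuous_parametric_intervalIntegral_of_continuous hF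
    continuous_neg))

/-- Since `K 0 0 = 0`, the integrand is small near the origin, and the interval has length `2|x|`:
the integral is `o(x)` and adds nothing to the derivative at 0. -/
lemma hasDerivAt_volterra_zero {K : ℝ → ℝ → ℂ} (hK : Continuous K.uncurry) (hK0 : K 0 0 = 0)
    {p : ℝ → ℂ} (hp : Continuous p) {p' : ℂ} (hd : HasDerivAt p p' 0) :
    HasDerivAt (volterra K p) p' 0 := by
  have hF : Continuous (Function.uncurry fun x t => K x t * p t) := hK.mul (hp.comp continuous_snd)
  have h : HasDerivAt (fun x => ∫ t in (-x)..x, K x t * p t) 0 0 := by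
    rw [hasDerivAt_iff_isLittleO, Asymptotics.isLittleO_iff]
    intro c hc
    obtain ⟨δ, hδ, hball⟩ := Metric.continuous_iff.1 hF (0, 0) (c / 2) (by positivity)
    filter_upwards [Metric.ball_mem_nhds (0 : ℝ) hδ] with x hx
    rw [mem_ball_zero_iff, Real.norm_eq_abs] at hx
    have hb : ∀ t ∈ uIoc (-x) x, ‖K x t * p t‖ ≤ c / 2 := by
      intro t ht
      have ht' : |t| ≤ |x| := by
        have h1 := uIoc_subset_uIcc ht
        rcases le_total 0 x with h0 | h0
        · rw [uIcc_of_le (by linarith)] at h1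
          rw [abs_of_nonneg h0]
          exact abs_le.2 h1
        · rw [uIcc_of_ge (by linarith)] at h1
          rw [abs_of_nonpos h0]
          exact abs_le.2 ⟨by linarith [h1.1], h1.2⟩
      have h2 := hball (x, t) (by
        rw [Prod.dist_eq, dist_zero_right, dist_zero_right]
        exact max_lt hx (ht'.trans_lt hx))
      simp only [Function.uncurry, hK0, zero_mul, dist_zero_right] at h2
      exact h2.le
    have h3 := intervalIntegral.norm_integral_le_of_norm_le_const hb
    have h4 : |x - -x| = 2 * |x| := by
      rw [sub_neg_eq_add, ← two_mul, abs_mul, abs_two]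
    rw [h4] at h3
    simp only [neg_zero, intervalIntegral.integral_same, sub_zero, smul_zero, Real.norm_eq_abs]
    linarith
  have := hd.fun_add h
  rwa [add_zero] at this

section VolterraRegular

variable {a : ℝ} {q : ℝ → ℂ} {H : ℝ → ℝ → ℂ}

lemma volterra_congr {b : ℝ} (hb : b < a) (hH : IsGoursatSolution a q H) {Q : ℝ → ℂ}
    (G : GoursatKernel Q) (hQ : Continuous Q) (hqQ : EqOn q Q (Icc (-b) b)) (p : ℝ → ℂ) {x : ℝ}
    (hx : |x| ≤ b) : volterra (kernelOf H) p x = volterra (kernelOf G.H) p x := by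
  rw [volterra, volterra]
  congr 1
  refine intervalIntegral.integral_congr fun t ht => ?_
  have ht' : |t| ≤ b := by
    rw [abs_le] at hx ⊢
    rcases le_total (-x) x with h | h
    · rw [uIcc_of_le h] at ht
      exact ⟨by linarith [ht.1], by linarith [ht.2]⟩
    · rw [uIcc_of_ge h] at ht
      exact ⟨by linarith [ht.1], by linarith [ht.2]⟩
  rw [hH.kernelOf_eq hb G hQ hqQ hx ht']

lemma exists_volterra_eventuallyEq (hH : IsGoursatSolution a q H)
    (hq : ContDiffOn ℝ ∞ q (Ioo (-a) a)) {x : ℝ} (hx : x ∈ Ioo (-a) a) :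
    ∃ Q : TestFun a, ∃ G : GoursatKernel Q, ∀ p : ℝ → ℂ,
      volterra (kernelOf H) p =ᶠ[𝓝 x] volterra (kernelOf G.H) p := by
  obtain ⟨b, hb, hba⟩ := exists_between (abs_lt.2 hx)
  obtain ⟨Q, hqQ, ⟨G⟩⟩ := exists_goursatKernel hq ((abs_nonneg x).trans_lt hb) hba
  refine ⟨Q, G, fun p => ?_⟩
  filter_upwards [(isOpen_lt continuous_abs continuous_const).mem_nhds hb] with y hy
  exact volterra_congr hba hH G Q.continuous hqQ p (le_of_lt hy)

lemma continuousOn_volterra (hH : IsGoursatSolution a q H) (hq : ContDiffOn ℝ ∞ q (Ioo (-a) a))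
    {p : ℝ → ℂ} (hp : Continuous p) : ContinuousOn (volterra (kernelOf H) p) (Ioo (-a) a) := by
  intro x hx
  obtain ⟨Q, G, h⟩ := exists_volterra_eventuallyEq hH hq hx
  exact ((continuous_volterra G.continuous_kernelOf hp).continuousAt.congr
    (h p).symm).continuousWithinAt

lemma hasDerivAt_volterra_kernelOf_zero (ha : 0 < a) (hH : IsGoursatSolution a q H)
    (hq : ContDiffOn ℝ ∞ q (Ioo (-a) a)) {p : ℝ → ℂ} (hp : Continuous p) {p' : ℂ}
    (hd : HasDerivAt p p' 0) : HasDerivAt (volterra (kernelOf H) p) p' 0 := by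
  obtain ⟨Q, G, h⟩ := exists_volterra_eventuallyEq hH hq (x := 0) ⟨by linarith, ha⟩
  refine (hasDerivAt_volterra_zero G.continuous_kernelOf ?_ hp hd).congr_of_eventuallyEq (h p)
  simp [kernelOf, G.goursat 0 0]

/-- On continuous functions the transposed definition gives back the Volterra formula: the order of
integration is exchanged on the two triangles, after replacing `H` by a plane kernel that is correct
on the support of `φ`. -/
lemma transposeOp_testVolterra_regular (ha : 0 < a) (hH : IsGoursatSolution a q H)
    (hq : ContDiffOn ℝ ∞ q (Ioo (-a) a)) {p : ℝ → ℂ} (hp : Continuous p) :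
    transposeOp (testVolterra ha hH hq) (regular a p) =
      regular a (volterra (kernelOf H) p) := by
  ext φ
  change regular a p (testVolterra ha hH hq φ) = _
  rw [regular_apply hp.continuousOn, regular_apply (continuousOn_volterra hH hq hp)]
  obtain ⟨c, hca, hφ'⟩ := exists_bound_of_test φ
  obtain ⟨b, hb, hba⟩ := exists_between (max_lt ha hca)
  rw [max_lt_iff] at hb
  have hφ : ∀ x, b ≤ |x| → φ x = 0 := fun x hx => hφ' x (hb.2.trans_le hx)
  have hψ : ∀ x, b ≤ |x| → testVolterra ha hH hq φ x = 0 := fun x hx =>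
    volterraTranspose_eq_zero hca _ hφ' (hb.2.trans_le hx)
  obtain ⟨Q, hqQ, ⟨G⟩⟩ := exists_goursatKernel hq hb.1 hba
  have hsupp : ∀ f : ℝ → ℂ, (∀ x, b ≤ |x| → f x = 0) → ∀ g : ℝ → ℂ,
      ∫ x, g x * f x = ∫ x in (-b)..b, g x * f x := by
    intro f hf g
    refine (intervalIntegral.integral_eq_integral_of_support_subset fun x hx => ?_).symm
    by_contra hn
    refine hx ?_
    simp only
    rw [hf x, mul_zero]
    by_contra h
    have := abs_lt.1 (not_le.1 h)
    exact hn ⟨this.1, this.2.le⟩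
  rw [hsupp _ hψ, hsupp _ hφ]
  let K := kernelOf G.H
  have hK : Continuous K.uncurry := G.continuous_kernelOf
  let F : ℝ → ℝ → ℂ := fun x t => p x * (K t x * φ t)
  have hF : Continuous F.uncurry := by
    have := φ.continuous
    have h1 : Continuous fun z : ℝ × ℝ => p z.1 * (K.uncurry (z.2, z.1) * φ z.2) := by fun_prop
    exact h1
  have hF₁ : Continuous fun x => ∫ t in x..b, F x t := by
    have h1 : (fun x => ∫ t in x..b, F x t) = fun x => -∫ t in b..x, F x t := by
      ext x
      rw [intervalIntegral.integral_symm]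
    rw [h1]
    exact (intervalIntegral.continuous_parametric_intervalIntegral_of_continuous hF
      continuous_id).neg
  have hF₂ : Continuous fun x => ∫ t in (-b)..(-x), F x t :=
    intervalIntegral.continuous_parametric_intervalIntegral_of_continuous hF continuous_neg
  have hF₃ : Continuous fun x => (∫ t in x..b, F x t) - ∫ t in (-b)..(-x), F x t := hF₁.sub hF₂
  have hpφ : Continuous fun x => p x * φ x := hp.mul φ.continuous
  have e1 : ∫ x in (-b)..b, p x * testVolterra ha hH hq φ x = (∫ x in (-b)..b, p x * φ x) +
      ((∫ x in (-b)..b, ∫ t in x..b, F x t) - ∫ x in (-b)..b, ∫ t in (-b)..(-x), F x t) := by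
    rw [← intervalIntegral.integral_sub (hF₁.intervalIntegrable _ _) (hF₂.intervalIntegrable _ _),
      ← intervalIntegral.integral_add (hpφ.intervalIntegrable _ _)
        (hF₃.intervalIntegrable _ _)]
    refine intervalIntegral.integral_congr fun x hx => ?_
    rw [uIcc_of_le (by linarith [hb.1])] at hx
    have hc : Continuous fun t => K t x * φ t := (hK.uncurry_right x).mul φ.continuous
    have i : ∀ s t, IntervalIntegrable (fun t => K t x * φ t) volume s t := fun s t =>
      hc.intervalIntegrable s t
    have z1 : ∫ t in b..a, K t x * φ t = 0 := by
      rw [intervalIntegral.integral_congr (g := fun _ => (0 : ℂ)), intervalIntegral.integral_zero]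
      intro t ht
      rw [uIcc_of_le hba.le] at ht
      simp [hφ t (ht.1.trans (le_abs_self t))]
    have z2 : ∫ t in (-a)..(-b), K t x * φ t = 0 := by
      rw [intervalIntegral.integral_congr (g := fun _ => (0 : ℂ)), intervalIntegral.integral_zero]
      intro t ht
      rw [uIcc_of_le (by linarith)] at ht
      simp [hφ t ((by linarith [ht.2] : b ≤ -t).trans (neg_le_abs t))]
    simp only [F]
    rw [testVolterra_apply, volterraTranspose_eq_triangles hba hH G Q.continuous hqQ φ.continuous
      (fun x hx => hφ x hx.le) (abs_le.2 hx),
      ← intervalIntegral.integral_add_adjacent_intervals (i x b) (i b a), z1,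
      ← intervalIntegral.integral_add_adjacent_intervals (i (-a) (-b)) (i (-b) (-x)), z2,
      intervalIntegral.integral_const_mul, intervalIntegral.integral_const_mul]
    ring
  have hG₁ : Continuous fun t => ∫ x in (-b)..t, F x t :=
    intervalIntegral.continuous_parametric_intervalIntegral_of_continuous
      (f := fun t x => F x t) (hF.comp continuous_swap) continuous_id
  have hG₂ : Continuous fun t => ∫ x in (-b)..(-t), F x t :=
    intervalIntegral.continuous_parametric_intervalIntegral_of_continuous
      (f := fun t x => F x t) (hF.comp continuous_swap) continuous_neg
  have hG₃ : Continuous fun t => (∫ x in (-b)..t, F x t) - ∫ x in (-b)..(-t), F x t := hG₁.sub hG₂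
  rw [e1, integral_triangle_swap hF hb.1.le, integral_triangle_swap_neg hF hb.1.le,
    ← intervalIntegral.integral_sub (hG₁.intervalIntegrable _ _) (hG₂.intervalIntegrable _ _),
    ← intervalIntegral.integral_add (hpφ.intervalIntegrable _ _)
      (hG₃.intervalIntegrable _ _)]
  refine intervalIntegral.integral_congr fun t ht => ?_
  rw [uIcc_of_le (by linarith [hb.1])] at ht
  have i : ∀ r s, IntervalIntegrable (fun x => F x t) volume r s := fun r s =>
    (hF.uncurry_right t).intervalIntegrable r s
  rw [volterra_congr hba hH G Q.continuous hqQ p (abs_le.2 ht), volterra,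
    intervalIntegral.integral_interval_sub_left (i _ _) (i _ _), add_mul,
    ← intervalIntegral.integral_mul_const]
  congr 1
  refine intervalIntegral.integral_congr fun x _ => ?_
  simp only [F, K]
  ring

end VolterraRegular

section Monomials

variable {a : ℝ}

/-! ### The operators `P₊`, `P₋`, `d/dx` and `A P₊` on monomials -/

/-- The distribution `xᵏ`. -/
def monomialDistr (a : ℝ) (k : ℕ) : Distr a := regular a fun x => (x : ℂ) ^ k

lemma continuous_monomial (k : ℕ) : Continuous fun x : ℝ => (x : ℂ) ^ k := by fun_prop

lemma hasDerivAt_monomial (k : ℕ) (x : ℝ) :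
    HasDerivAt (fun x : ℝ => (x : ℂ) ^ k) (k * (x : ℂ) ^ (k - 1)) x := by
  simpa using (Complex.ofRealCLM.hasDerivAt (x := x)).fun_pow k

lemma monomialDistr_apply (k : ℕ) (φ : TestFun a) :
    monomialDistr a k φ = ∫ x : ℝ, (x : ℂ) ^ k * φ x :=
  regular_apply (continuous_monomial k).continuousOn φ

lemma zero_smul_distr (u : Distr a) : (0 : ℂ) • u = 0 := by module

lemma smul_zero_distr (c : ℂ) : c • (0 : Distr a) = 0 := by module

lemma smul_monomialDistr (c : ℂ) (k : ℕ) :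
    c • monomialDistr a k = regular a fun x => c * (x : ℂ) ^ k := by
  have := regular_linear (a := a) (continuous_monomial k).continuousOn
    (continuous_monomial k).continuousOn c 0
  simp only [zero_mul, add_zero, zero_smul_distr] at this
  exact this.symm

lemma ddx_monomialDistr (k : ℕ) : ddx a (monomialDistr a k) = (k : ℂ) • monomialDistr a (k - 1) := by
  rw [smul_monomialDistr]
  exact ddx_regular (fun x _ => hasDerivAt_monomial k x)
    (continuous_const.mul (continuous_monomial _)).continuousOn

lemma transposeOp_testReflect_monomialDistr (k : ℕ) :
    transposeOp (testReflect a) (monomialDistr a k) = (-1 : ℂ) ^ k • monomialDistr a k := by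
  ext φ
  change monomialDistr a k (testReflect a φ) = (-1 : ℂ) ^ k * monomialDistr a k φ
  rw [monomialDistr_apply, monomialDistr_apply, ← integral_const_mul,
    ← integral_neg_eq_self]
  refine integral_congr_ae (ae_of_all _ fun x => ?_)
  change ((-x : ℝ) : ℂ) ^ k * φ (- -x) = (-1) ^ k * ((x : ℂ) ^ k * φ x)
  rw [neg_neg, Complex.ofReal_neg, neg_pow]
  ring

lemma Pplus_monomialDistr (k : ℕ) :
    Pplus a (monomialDistr a k) = ((1 + (-1 : ℂ) ^ k) / 2) • monomialDistr a k := by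
  change (2⁻¹ : ℂ) • (monomialDistr a k + transposeOp (testReflect a) (monomialDistr a k)) = _
  rw [transposeOp_testReflect_monomialDistr]
  module

lemma Pminus_monomialDistr (k : ℕ) :
    Pminus a (monomialDistr a k) = ((1 - (-1 : ℂ) ^ k) / 2) • monomialDistr a k := by
  change (2⁻¹ : ℂ) • (monomialDistr a k - transposeOp (testReflect a) (monomialDistr a k)) = _
  rw [transposeOp_testReflect_monomialDistr]
  module

/-- On test functions the derivative of `∫ₓᵃ P₋ φ` is `-P₋ φ`. As `xᵏ` is a multiple of the
derivative of `xᵏ⁺¹`, this yields `A P₊` on monomials without computing an integral. -/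
lemma ddx_APplus (u : Distr a) : APplus a (ddx a u) = Pminus a u := by
  ext φ
  change -u (testDeriv a (testAPplus a φ)) = (2⁻¹ : ℂ) * (u φ - u (testReflect a φ))
  have h : testDeriv a (testAPplus a φ) = -((2⁻¹ : ℂ) • (φ - testReflect a φ)) := by
    ext x
    rw [testDeriv_apply]
    refine (hasDerivAt_tailIntegral φ x).deriv.trans ?_
    change -((φ x - φ (-x)) / 2) = -(2⁻¹ * (φ x - φ (-x)))
    ring
  rw [h, map_neg, map_smul, map_sub, neg_neg, smul_eq_mul]

lemma APplus_monomialDistr (k : ℕ) : APplus a (monomialDistr a k) =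
    ((1 - (-1 : ℂ) ^ (k + 1)) / 2 / (k + 1)) • monomialDistr a (k + 1) := by
  have hk : (k : ℂ) + 1 ≠ 0 := Nat.cast_add_one_ne_zero k
  have h : monomialDistr a k = ((k : ℂ) + 1)⁻¹ • ddx a (monomialDistr a (k + 1)) := by
    rw [ddx_monomialDistr, smul_smul, Nat.add_sub_cancel]
    push_cast
    rw [inv_mul_cancel₀ hk, one_smul]
  rw [h, map_smul, ddx_APplus, Pminus_monomialDistr, smul_smul]
  congr 1
  ring

lemma ddx_ddx_monomialDistr (k : ℕ) : ddx a (ddx a (monomialDistr a (k + 2))) =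
    (((k : ℂ) + 2) * ((k : ℂ) + 1)) • monomialDistr a k := by
  rw [ddx_monomialDistr, map_smul, ddx_monomialDistr, smul_smul]
  congr 1
  push_cast [Nat.add_sub_cancel]
  ring

lemma ddx_ddx_monomialDistr_zero : ddx a (ddx a (monomialDistr a 0)) = 0 := by
  rw [ddx_monomialDistr, Nat.cast_zero, zero_smul_distr, map_zero]

lemma ddx_ddx_monomialDistr_one : ddx a (ddx a (monomialDistr a 1)) = 0 := by
  rw [ddx_monomialDistr, map_smul, ddx_monomialDistr, Nat.cast_zero, zero_smul_distr,
    smul_zero_distr]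

/-- Operators which commute with `d²/dx²`. -/
lemma commute_of_monomials {B : Distr a →L[ℂ] Distr a}
    (h : ∀ k, ddx a (ddx a (B (monomialDistr a k))) = B (ddx a (ddx a (monomialDistr a k))))
    (u : Distr a) : ddx a (ddx a (B u)) = B (ddx a (ddx a u)) :=
  DFunLike.congr_fun (distr_clm_ext (𝒯₁ := ddx a ∘L ddx a ∘L B) (𝒯₂ := B ∘L ddx a ∘L ddx a) h) u

lemma Pplus_commute (u : Distr a) : ddx a (ddx a (Pplus a u)) = Pplus a (ddx a (ddx a u)) := by
  refine commute_of_monomials (fun k => ?_) u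
  rw [Pplus_monomialDistr, map_smul, map_smul]
  rcases k with _ | _ | k
  · rw [ddx_ddx_monomialDistr_zero, map_zero, smul_zero_distr]
  · rw [ddx_ddx_monomialDistr_one, map_zero, smul_zero_distr]
  · rw [ddx_ddx_monomialDistr, map_smul, Pplus_monomialDistr, smul_comm]
    simp [pow_add]

lemma Pminus_commute (u : Distr a) : ddx a (ddx a (Pminus a u)) = Pminus a (ddx a (ddx a u)) := by
  refine commute_of_monomials (fun k => ?_) u
  rw [Pminus_monomialDistr, map_smul, map_smul]
  rcases k with _ | _ | k
  · rw [ddx_ddx_monomialDistr_zero, map_zero, smul_zero_distr]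
  · rw [ddx_ddx_monomialDistr_one, map_zero, smul_zero_distr]
  · rw [ddx_ddx_monomialDistr, map_smul, Pminus_monomialDistr, smul_comm]
    simp [pow_add]

lemma APplus_commute (u : Distr a) : ddx a (ddx a (APplus a u)) = APplus a (ddx a (ddx a u)) := by
  refine commute_of_monomials (fun k => ?_) u
  rw [ddx_APplus, APplus_monomialDistr, map_smul, map_smul]
  -- At `k = 0` the exponent `k - 1` is truncated, but its coefficient is zero.
  rcases k with _ | k
  · rw [zero_add, ddx_ddx_monomialDistr_one, ddx_monomialDistr, Nat.cast_zero, zero_smul_distr,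
      map_zero, smul_zero_distr]
  · have hk : (k : ℂ) + 1 + 1 ≠ 0 := by exact_mod_cast (Nat.succ_ne_zero (k + 1))
    rw [ddx_ddx_monomialDistr, ddx_monomialDistr, map_smul, Pminus_monomialDistr, smul_smul,
      smul_smul, Nat.add_sub_cancel]
    congr 1
    push_cast
    have e : (-1 : ℂ) ^ (k + 1 + 1) = (-1) ^ k := by ring
    rw [e]
    field_simp
    ring

end Monomials

section Main

variable {a : ℝ} {q : ℝ → ℂ} {H : ℝ → ℝ → ℂ}

/-! ### The intertwining relation for `𝐓`. -/

lemma isTransmutation_transposeOp_testVolterra (ha : 0 < a) (hH : IsGoursatSolution a q H)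
    (hq : ContDiffOn ℝ ∞ q (Ioo (-a) a)) :
    IsTransmutation a q hq (transposeOp (testVolterra ha hH hq)) := by
  intro u
  ext φ
  rw [schrodinger_apply]
  change u (testVolterra ha hH hq (testSchrodinger a q hq φ)) =
    - -u (testDeriv a (testDeriv a (testVolterra ha hH hq φ)))
  rw [neg_neg, testDeriv_testDeriv_testVolterra]

/-! ### The standard `L`-base `𝐓[xᵏ]` -/

/-- The image of the monomial `xᵏ` under the Volterra operator. -/
def volterraMonomial (H : ℝ → ℝ → ℂ) (k : ℕ) : ℝ → ℂ :=
  volterra (kernelOf H) fun x => (x : ℂ) ^ k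

lemma continuousOn_volterraMonomial (hH : IsGoursatSolution a q H)
    (hq : ContDiffOn ℝ ∞ q (Ioo (-a) a)) (k : ℕ) :
    ContinuousOn (volterraMonomial H k) (Ioo (-a) a) :=
  continuousOn_volterra hH hq (continuous_monomial k)

lemma transposeOp_testVolterra_monomialDistr (ha : 0 < a) (hH : IsGoursatSolution a q H)
    (hq : ContDiffOn ℝ ∞ q (Ioo (-a) a)) (k : ℕ) :
    transposeOp (testVolterra ha hH hq) (monomialDistr a k) = regular a (volterraMonomial H k) :=
  transposeOp_testVolterra_regular ha hH hq (continuous_monomial k)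

/-- Bootstrapping `g'' = q g + h`: `g` and `g'` together gain one order of smoothness per step. -/
lemma contDiffOn_of_schrodinger (ha : 0 < a) (hq : ContDiffOn ℝ ∞ q (Ioo (-a) a)) {g h : ℝ → ℂ}
    (hg : ContinuousOn g (Ioo (-a) a)) (hh : ContDiffOn ℝ ∞ h (Ioo (-a) a))
    (hL : schrodinger a q hq (regular a g) = regular a h) : ContDiffOn ℝ ∞ g (Ioo (-a) a) := by
  obtain ⟨g', hg'⟩ := exists_hasDerivAt_of_schrodinger ha hq hg hh.continuousOn hL
  have d₁ : ∀ x ∈ Ioo (-a) a, deriv g x = g' x := fun x hx => (hg' x hx).1.deriv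
  have d₂ : ∀ x ∈ Ioo (-a) a, deriv g' x = q x * g x + h x := fun x hx => (hg' x hx).2.deriv
  have key : ∀ n : ℕ, ContDiffOn ℝ n g (Ioo (-a) a) ∧ ContDiffOn ℝ n g' (Ioo (-a) a) := by
    intro n
    induction n with
    | zero =>
      exact ⟨contDiffOn_zero.2 hg, contDiffOn_zero.2 fun x hx =>
        (hg' x hx).2.continuousAt.continuousWithinAt⟩
    | succ n ih =>
      have hn : (n : ℕ∞ω) ≤ ∞ := by exact_mod_cast le_top
      have e : ((n + 1 : ℕ) : ℕ∞ω) = (n : ℕ∞ω) + 1 := by push_cast; rfl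
      rw [e, contDiffOn_succ_iff_deriv_of_isOpen isOpen_Ioo,
        contDiffOn_succ_iff_deriv_of_isOpen isOpen_Ioo]
      refine ⟨⟨fun x hx => (hg' x hx).1.differentiableAt.differentiableWithinAt, by simp,
        ih.2.congr d₁⟩, fun x hx => (hg' x hx).2.differentiableAt.differentiableWithinAt, by simp,
        ContDiffOn.congr ?_ d₂⟩
      exact ((hq.of_le hn).mul ih.1).add (hh.of_le hn)
  exact contDiffOn_infty.2 fun n => (key n).1

lemma regular_zero : regular a (fun _ => 0) = 0 := by
  ext φ
  rw [regular_apply continuousOn_const]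
  simp

lemma schrodinger_volterraMonomial_zero (ha : 0 < a) (hH : IsGoursatSolution a q H)
    (hq : ContDiffOn ℝ ∞ q (Ioo (-a) a)) :
    schrodinger a q hq (regular a (volterraMonomial H 0)) = 0 := by
  rw [← transposeOp_testVolterra_monomialDistr ha hH hq,
    isTransmutation_transposeOp_testVolterra ha hH hq, ddx_ddx_monomialDistr_zero, map_zero]

lemma schrodinger_volterraMonomial_one (ha : 0 < a) (hH : IsGoursatSolution a q H)
    (hq : ContDiffOn ℝ ∞ q (Ioo (-a) a)) :
    schrodinger a q hq (regular a (volterraMonomial H 1)) = 0 := by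
  rw [← transposeOp_testVolterra_monomialDistr ha hH hq,
    isTransmutation_transposeOp_testVolterra ha hH hq, ddx_ddx_monomialDistr_one, map_zero]

lemma schrodinger_volterraMonomial_add_two (ha : 0 < a) (hH : IsGoursatSolution a q H)
    (hq : ContDiffOn ℝ ∞ q (Ioo (-a) a)) (k : ℕ) :
    schrodinger a q hq (regular a (volterraMonomial H (k + 2))) =
      (((k : ℂ) + 2) * ((k : ℂ) + 1)) • regular a (volterraMonomial H k) := by
  rw [← transposeOp_testVolterra_monomialDistr ha hH hq,
    isTransmutation_transposeOp_testVolterra ha hH hq, ddx_ddx_monomialDistr, map_smul,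
    transposeOp_testVolterra_monomialDistr]

lemma contDiffOn_volterraMonomial (ha : 0 < a) (hH : IsGoursatSolution a q H)
    (hq : ContDiffOn ℝ ∞ q (Ioo (-a) a)) (k : ℕ) :
    ContDiffOn ℝ ∞ (volterraMonomial H k) (Ioo (-a) a) := by
  have hc := continuousOn_volterraMonomial hH hq
  induction k using Nat.twoStepInduction with
  | zero =>
    exact contDiffOn_of_schrodinger ha hq (hc 0) contDiffOn_const
      ((schrodinger_volterraMonomial_zero ha hH hq).trans regular_zero.symm)
  | one =>
    exact contDiffOn_of_schrodinger ha hq (hc 1) contDiffOn_const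
      ((schrodinger_volterraMonomial_one ha hH hq).trans regular_zero.symm)
  | more k ih _ =>
    refine contDiffOn_of_schrodinger ha hq (hc (k + 2))
      -- The vanishing second summand only fits the two-term form of `regular_linear`.
      (h := fun x => (((k : ℂ) + 2) * ((k : ℂ) + 1)) * volterraMonomial H k x
        + 0 * volterraMonomial H k x) ?_ ?_
    · exact (contDiffOn_const.mul ih).add (contDiffOn_const.mul ih)
    · rw [regular_linear (hc k) (hc k), zero_smul_distr, add_zero]
      exact schrodinger_volterraMonomial_add_two ha hH hq k

lemma volterraMonomial_apply_zero (k : ℕ) : volterraMonomial H k 0 = 0 ^ k := by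
  simp [volterraMonomial, volterra]

lemma hasDerivAt_volterraMonomial_zero (ha : 0 < a) (hH : IsGoursatSolution a q H)
    (hq : ContDiffOn ℝ ∞ q (Ioo (-a) a)) (k : ℕ) :
    HasDerivAt (volterraMonomial H k) (k * 0 ^ (k - 1)) 0 := by
  have := hasDerivAt_monomial k 0
  rw [Complex.ofReal_zero] at this
  exact hasDerivAt_volterra_kernelOf_zero ha hH hq (continuous_monomial k) this

/-- Uniqueness for the Cauchy problem for `L g = h`. -/
lemma eqOn_of_schrodinger_eq (ha : 0 < a) (hq : ContDiffOn ℝ ∞ q (Ioo (-a) a)) {f g : ℝ → ℂ}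
    (hf : ContDiffOn ℝ ∞ f (Ioo (-a) a)) (hg : ContDiffOn ℝ ∞ g (Ioo (-a) a))
    (hL : schrodinger a q hq (regular a f) = schrodinger a q hq (regular a g))
    (h0 : f 0 = g 0) (h1 : deriv f 0 = deriv g 0) : EqOn f g (Ioo (-a) a) := by
  have hm : (0 : ℝ) ∈ Ioo (-a) a := ⟨by linarith, ha⟩
  have hd : ∀ {k : ℝ → ℂ}, ContDiffOn ℝ ∞ k (Ioo (-a) a) → HasDerivAt k (deriv k 0) 0 :=
    fun hk => ((hk.differentiableOn (by simp)).differentiableAt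
      (isOpen_Ioo.mem_nhds hm)).hasDerivAt
  have hc : ContinuousOn (fun x => 1 * f x + -1 * g x) (Ioo (-a) a) :=
    (continuousOn_const.mul hf.continuousOn).add (continuousOn_const.mul hg.continuousOn)
  obtain ⟨g', hg'⟩ := exists_hasDerivAt_of_schrodinger ha hq hc (h := fun _ => 0)
    continuousOn_const (by
      rw [regular_linear hf.continuousOn hg.continuousOn, regular_zero, map_add, map_smul, map_smul,
        hL]
      module)
  have h2 : g' 0 = 0 := by
    have h3 := ((hd hf).const_mul 1).fun_add ((hd hg).const_mul (-1))
    rw [(hg' 0 hm).1.unique h3, h1]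
    ring
  have := eq_zero_of_cauchy hq.continuousOn (fun x hx => ⟨(hg' x hx).1, by
    simpa using (hg' x hx).2⟩) (by rw [h0]; ring) h2
  intro x hx
  linear_combination this x hx

/-- Two standard `L`-bases with the same first two members agree. -/
lemma IsSLBase.eqOn (ha : 0 < a) {hq : ContDiffOn ℝ ∞ q (Ioo (-a) a)} {φ ψ : ℕ → ℝ → ℂ}
    (hφ : IsSLBase a q hq φ) (hψ : IsSLBase a q hq ψ) (h0 : EqOn (φ 0) (ψ 0) (Ioo (-a) a))
    (h1 : EqOn (φ 1) (ψ 1) (Ioo (-a) a)) (k : ℕ) : EqOn (φ k) (ψ k) (Ioo (-a) a) := by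
  induction k using Nat.twoStepInduction with
  | zero => exact h0
  | one => exact h1
  | more k ih _ =>
    refine eqOn_of_schrodinger_eq ha hq (hφ.smooth _) (hψ.smooth _) ?_ ?_ ?_
    · rw [hφ.eq_add_two, hψ.eq_add_two, regular_congr (hφ.smooth k).continuousOn ih]
    · rw [hφ.value_zero _ (by omega), hψ.value_zero _ (by omega)]
    · rw [hφ.deriv_zero _ (by omega), hψ.deriv_zero _ (by omega)]

/-! ### The operators `c₁ 𝐓 P₊ + c₂ 𝐓 P₋ + c₃ 𝐓 A P₊ + c₄ 𝐓 d/dx P₋` -/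

/-- The operator `c₁ T P₊ + c₂ T P₋ + c₃ T A P₊ + c₄ T d/dx P₋`. -/
def combination (T : Distr a →L[ℂ] Distr a) (c₁ c₂ c₃ c₄ : ℂ) : Distr a →L[ℂ] Distr a :=
  c₁ • (T ∘L Pplus a) + c₂ • (T ∘L Pminus a) + c₃ • (T ∘L APplus a)
    + c₄ • (T ∘L ddx a ∘L Pminus a)

lemma combination_apply (T : Distr a →L[ℂ] Distr a) (c₁ c₂ c₃ c₄ : ℂ) (u : Distr a) :
    combination T c₁ c₂ c₃ c₄ u = c₁ • T (Pplus a u) + c₂ • T (Pminus a u) + c₃ • T (APplus a u)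
      + c₄ • T (ddx a (Pminus a u)) := rfl

lemma IsTransmutation.combination {hq : ContDiffOn ℝ ∞ q (Ioo (-a) a)}
    {T : Distr a →L[ℂ] Distr a} (hT : IsTransmutation a q hq T) (c₁ c₂ c₃ c₄ : ℂ) :
    IsTransmutation a q hq (combination T c₁ c₂ c₃ c₄) := by
  intro u
  rw [combination_apply, combination_apply]
  simp only [map_add, map_smul]
  rw [hT, hT, hT, hT, Pplus_commute, Pminus_commute, APplus_commute]

/-- The image of the monomial `xᵏ` under the operator `combination T c₁ c₂ c₃ c₄`. -/
def combinationBase (H : ℝ → ℝ → ℂ) (c₁ c₂ c₃ c₄ : ℂ) (k : ℕ) (x : ℝ) : ℂ :=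
  1 * ((c₁ * ((1 + (-1) ^ k) / 2) + c₂ * ((1 - (-1) ^ k) / 2)) * volterraMonomial H k x
    + (c₃ * ((1 - (-1) ^ (k + 1)) / 2 / (k + 1))) * volterraMonomial H (k + 1) x)
  + (c₄ * ((1 - (-1) ^ k) / 2 * k)) * volterraMonomial H (k - 1) x

lemma combination_monomialDistr (ha : 0 < a) (hH : IsGoursatSolution a q H)
    (hq : ContDiffOn ℝ ∞ q (Ioo (-a) a)) (c₁ c₂ c₃ c₄ : ℂ) (k : ℕ) :
    combination (transposeOp (testVolterra ha hH hq)) c₁ c₂ c₃ c₄ (monomialDistr a k) =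
      regular a (combinationBase H c₁ c₂ c₃ c₄ k) := by
  have hc := continuousOn_volterraMonomial hH hq
  -- The leading factor 1 in `combinationBase` lets `regular_linear` apply twice, to a sum of two
  -- and then of three terms.
  have e : regular a (combinationBase H c₁ c₂ c₃ c₄ k) = _ :=
    (regular_linear ((continuousOn_const.mul (hc k)).add (continuousOn_const.mul (hc (k + 1))))
      (hc (k - 1)) 1 (c₄ * ((1 - (-1) ^ k) / 2 * k))).trans
      (congr_arg₂ _ (congr_arg _ (regular_linear (hc k) (hc (k + 1)) _ _)) rfl)
  rw [e, combination_apply, Pplus_monomialDistr, Pminus_monomialDistr, APplus_monomialDistr,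
    map_smul (ddx a), ddx_monomialDistr]
  simp only [map_smul, transposeOp_testVolterra_monomialDistr]
  module

lemma isSLBase_combinationBase (ha : 0 < a) (hH : IsGoursatSolution a q H)
    (hq : ContDiffOn ℝ ∞ q (Ioo (-a) a)) (c₁ c₂ c₃ c₄ : ℂ) :
    IsSLBase a q hq (combinationBase H c₁ c₂ c₃ c₄) := by
  have hs := contDiffOn_volterraMonomial ha hH hq
  have hT := (isTransmutation_transposeOp_testVolterra ha hH hq).combination c₁ c₂ c₃ c₄
  refine ⟨fun k => ?_, ?_, ?_, fun k => ?_, fun k hk => ?_, fun k hk => ?_⟩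
  · exact (contDiffOn_const.mul ((contDiffOn_const.mul (hs k)).add
      (contDiffOn_const.mul (hs (k + 1))))).add (contDiffOn_const.mul (hs (k - 1)))
  · rw [← combination_monomialDistr ha hH hq, hT, ddx_ddx_monomialDistr_zero, map_zero]
  · rw [← combination_monomialDistr ha hH hq, hT, ddx_ddx_monomialDistr_one, map_zero]
  · rw [← combination_monomialDistr ha hH hq, hT, ddx_ddx_monomialDistr, map_smul,
      combination_monomialDistr]
  · obtain ⟨k, rfl⟩ := Nat.exists_eq_add_of_le' hk
    simp only [combinationBase, volterraMonomial_apply_zero]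
    rcases k with _ | k <;> simp
  · have h := ((((hasDerivAt_volterraMonomial_zero ha hH hq k).const_mul
      (c₁ * ((1 + (-1) ^ k) / 2) + c₂ * ((1 - (-1) ^ k) / 2))).fun_add
      ((hasDerivAt_volterraMonomial_zero ha hH hq (k + 1)).const_mul
      (c₃ * ((1 - (-1) ^ (k + 1)) / 2 / (k + 1))))).const_mul 1).fun_add
      ((hasDerivAt_volterraMonomial_zero ha hH hq (k - 1)).const_mul
      (c₄ * ((1 - (-1) ^ k) / 2 * k)))
    refine h.deriv.trans ?_
    obtain ⟨k, rfl⟩ := Nat.exists_eq_add_of_le' hk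
    -- At index 2 the last term contains `𝐓x`, whose derivative at 0 is 1, but its coefficient
    -- vanishes by parity.
    rcases k with _ | k <;> simp

/-! ### Characterization of the s-transmutations. -/

lemma isSTransmutation_iff (ha : 0 < a) (hH : IsGoursatSolution a q H)
    (hq : ContDiffOn ℝ ∞ q (Ioo (-a) a)) (𝒯 : Distr a →L[ℂ] Distr a) :
    IsSTransmutation a q hq 𝒯 ↔ ∃ c₁ c₂ c₃ c₄ : ℂ,
      𝒯 = combination (transposeOp (testVolterra ha hH hq)) c₁ c₂ c₃ c₄ := by
  constructor
  · rintro ⟨-, φ, hφ, h𝒯⟩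
    have hs := contDiffOn_volterraMonomial ha hH hq
    have hv := volterraMonomial_apply_zero (H := H)
    have hd := hasDerivAt_volterraMonomial_zero ha hH hq
    -- The combination maps `1` to `c₁ 𝐓1 + c₃ 𝐓x` and `x` to `c₂ 𝐓x + c₄ 𝐓1`. As `𝐓1` and `𝐓x` have
    -- Cauchy data (1, 0) and (0, 1), the constants must be the data of `φ 0` and `φ 1` at 0.
    let c := combinationBase H (φ 0 0) (deriv (φ 1) 0) (deriv (φ 0) 0) (φ 1 0)
    have hc : IsSLBase a q hq c := isSLBase_combinationBase ha hH hq _ _ _ _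
    have e0 : c 0 = fun x => φ 0 0 * volterraMonomial H 0 x +
        deriv (φ 0) 0 * volterraMonomial H 1 x := by
      ext x
      simp [c, combinationBase]
    have e1 : c 1 = fun x => deriv (φ 1) 0 * volterraMonomial H 1 x +
        φ 1 0 * volterraMonomial H 0 x := by
      ext x
      simp [c, combinationBase]
    have h0 : EqOn (φ 0) (c 0) (Ioo (-a) a) := by
      refine eqOn_of_schrodinger_eq ha hq (hφ.smooth 0) (hc.smooth 0)
        (hφ.eq_zero.trans hc.eq_zero.symm) ?_ ?_
      · simp [e0, hv]
      · rw [e0, (((hd 0).const_mul _).fun_add ((hd 1).const_mul _)).deriv]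
        simp
    have h1 : EqOn (φ 1) (c 1) (Ioo (-a) a) := by
      refine eqOn_of_schrodinger_eq ha hq (hφ.smooth 1) (hc.smooth 1)
        (hφ.eq_one.trans hc.eq_one.symm) ?_ ?_
      · simp [e1, hv]
      · rw [e1, (((hd 1).const_mul _).fun_add ((hd 0).const_mul _)).deriv]
        simp
    refine ⟨φ 0 0, deriv (φ 1) 0, deriv (φ 0) 0, φ 1 0, distr_clm_ext fun k => ?_⟩
    rw [h𝒯]
    exact (regular_congr (hφ.smooth k).continuousOn (hφ.eqOn ha hc h0 h1 k)).trans
      (combination_monomialDistr ha hH hq _ _ _ _ k).symm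
  · rintro ⟨c₁, c₂, c₃, c₄, rfl⟩
    exact ⟨(isTransmutation_transposeOp_testVolterra ha hH hq).combination c₁ c₂ c₃ c₄,
      combinationBase H c₁ c₂ c₃ c₄, isSLBase_combinationBase ha hH hq c₁ c₂ c₃ c₄,
      combination_monomialDistr ha hH hq c₁ c₂ c₃ c₄⟩

end Main

end

end STransmutation

open STransmutation

theorem mainTheorem9 (a : ℝ) (ha : 0 < a) (q : ℝ → ℂ)
    (hq : ContDiffOn ℝ ∞ q (Set.Ioo (-a) a)) :
    (∃! T : Distr a →L[ℂ] Distr a, IsVolterraTransmutation a q T) ∧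
    ∀ T : Distr a →L[ℂ] Distr a, IsVolterraTransmutation a q T →
      ∀ 𝒯 : Distr a →L[ℂ] Distr a,
        IsSTransmutation a q hq 𝒯 ↔
          ∃ c₁ c₂ c₃ c₄ : ℂ,
            𝒯 = c₁ • (T ∘L Pplus a) + c₂ • (T ∘L Pminus a) + c₃ • (T ∘L APplus a)
              + c₄ • (T ∘L ddx a ∘L Pminus a) := by
  refine ⟨existsUnique_isVolterraTransmutation ha hq, fun T hT 𝒯 => ?_⟩
  obtain ⟨H, hH, rfl⟩ := hT.exists_eq_transposeOp ha hq
  exact isSTransmutation_iff ha hH hq 𝒯
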